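/- Let $\delta, s\in\mathbb{R}$ and $T>0$. For $r\in\mathbb{R}$ let $H^r(0,T)$ denote the space of restrictions to $(0,T)$ of distributions in $H^r(\mathbb{R})$, with the quotient norm. For every $\varphi\in H^s(\mathbb{R})$ the Cauchy problem $$p_t+p_{xxxx}+\delta p_{xxx}=0\quad\text{in }\mathbb{R}\times(0,T),\qquad p(\cdot,0)=\varphi,$$ where the equation is understood in the sense of distributions, has a unique solution $p\in C([0,T];H^s(\mathbb{R}))\cap L^2(0,T;H^{s+2}(\mathbb{R}))$. This solution satisfies $\partial_x^kp\in C\big(\mathbb{R};H^{\frac{s-k}{4}+\frac38}(0,T)\big)$ for $k=0,1$ (as functions of $x$ with values in spaces of distributions in $t$). Moreover, there is a constant $C>0$ (depending only on $\delta,s,T$) such that for all $\varphi\in H^s(\mathbb{R})$ $$\sup_{t\in[0,T]}\|p(\cdot,t)\|_{H^s(\mathbb{R})}\le C\|\varphi\|_{H^s(\mathbb{R})},\qquad \|p\|_{L^2(0,T;H^{s+2}(\mathbb{R}))}\le C\|\varphi\|_{H^s(\mathbb{R})},$$ $$\sup_{x\in\mathbb{R}}\|\partial_x^kp(x,\cdot)\|_{H^{\frac{s-k}{4}+\frac38}(0,T)}\le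 C\|\varphi\|_{H^s(\mathbb{R})}\qquad(k=0,1).$$ Furthermore, if $s<0$ and $0<T\le1$, then also $$\sup_{t\in[0,T]}\|t^{\frac{|s|}{4}}p(\cdot,t)\|_{L^2(\mathbb{R})}\le C\|\varphi\|_{H^s(\mathbb{R})},\qquad \|t^{\frac{|s|}{4}}p\|_{L^2(0,T;H^2(\mathbb{R}))}\le C\|\varphi\|_{H^s(\mathbb{R})},$$ $$\sup_{x\in\mathbb{R}}\|t^{\frac{|s|}{4}}\partial_x^kp(x,\cdot)\|_{H^{-\frac k4+\frac38}(0,T)}\le C\|\varphi\|_{H^s(\mathbb{R})}\qquad(k=0,1).$$ -/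

import Mathlib

open MeasureTheory Set TemperedDistribution
open scoped SchwartzMap

noncomputable section

namespace LinearKS

/-! ### The Sobolev spaces `H^s(ℝ)`, `s ∈ ℝ` -/

/-- The tempered distributions on `ℝ` that belong to `H^s(ℝ)`, as a complex vector space. -/
def sobolevSubmodule (s : ℝ) : Submodule ℂ 𝓢'(ℝ, ℂ) where
  carrier := {u | MemSobolev s 2 u}
  add_mem' hu hv := hu.add hv
  zero_mem' := memSobolev_fun_zero ℝ ℂ s 2
  smul_mem' c _ hu := hu.smul c

/-- The space `H^s(ℝ)`. It is a type of its own, so that it does not inherit the weak topology of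
the tempered distributions; its norm is defined below. -/
def SobolevSpace (s : ℝ) : Type := ↥(sobolevSubmodule s)

namespace SobolevSpace

variable {s : ℝ}

instance : AddCommGroup (SobolevSpace s) := inferInstanceAs (AddCommGroup ↥(sobolevSubmodule s))

instance : Module ℂ (SobolevSpace s) := inferInstanceAs (Module ℂ ↥(sobolevSubmodule s))

/-- The inclusion `H^s(ℝ) → 𝓢'(ℝ)`. -/
def toDistr : SobolevSpace s →ₗ[ℂ] 𝓢'(ℝ, ℂ) := (sobolevSubmodule s).subtype

theorem memSobolev (u : SobolevSpace s) : MemSobolev s 2 (toDistr u) := u.2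

theorem toDistr_injective : Function.Injective (toDistr : SobolevSpace s → 𝓢'(ℝ, ℂ)) :=
  Subtype.val_injective

theorem lp_injective : Function.Injective
    (Lp.toTemperedDistributionCLM ℂ (volume : Measure ℝ) 2) :=
  LinearMap.ker_eq_bot.mp Lp.ker_toTemperedDistributionCLM_eq_bot

/-- The function `𝓕⁻¹ (1 + ξ²)^(s/2) 𝓕 u ∈ L²(ℝ)` attached to `u ∈ H^s(ℝ)`. -/
def l2Rep (u : SobolevSpace s) : Lp ℂ 2 (volume : Measure ℝ) := (memSobolev u).choose

theorem l2Rep_spec (u : SobolevSpace s) :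
    Lp.toTemperedDistributionCLM ℂ (volume : Measure ℝ) 2 (l2Rep u) =
      besselPotential ℝ ℂ s (toDistr u) :=
  (memSobolev u).choose_spec.symm

/-- The isometry `u ↦ 𝓕⁻¹ (1 + ξ²)^(s/2) 𝓕 u` from `H^s(ℝ)` to `L²(ℝ)`. -/
def toL2 : SobolevSpace s →ₗ[ℂ] Lp ℂ 2 (volume : Measure ℝ) where
  toFun := l2Rep
  map_add' u v := lp_injective <| by
    rw [map_add, l2Rep_spec, l2Rep_spec, l2Rep_spec, map_add, map_add]
  map_smul' c u := lp_injective <| by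
    rw [RingHom.id_apply, map_smul, l2Rep_spec, l2Rep_spec, map_smul, map_smul]

theorem besselPotential_toDistr (u : SobolevSpace s) :
    besselPotential ℝ ℂ s (toDistr u) = (toL2 u : 𝓢'(ℝ, ℂ)) :=
  (memSobolev u).choose_spec

theorem toDistr_eq (u : SobolevSpace s) :
    toDistr u = besselPotential ℝ ℂ (-s)
      (Lp.toTemperedDistributionCLM ℂ (volume : Measure ℝ) 2 (toL2 u)) := by
  rw [Lp.toTemperedDistributionCLM_apply]
  exact ((besselPotential_neg_apply_eq_iff s _ _).mpr (besselPotential_toDistr u)).symm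

theorem toL2_injective : Function.Injective (toL2 : SobolevSpace s → _) := fun u v h =>
  toDistr_injective <| by rw [toDistr_eq, toDistr_eq, h]

/-- The norm of `H^s(ℝ)` is `‖u‖ = ‖𝓕⁻¹ (1 + ξ²)^(s/2) 𝓕 u‖_{L²}`. -/
instance : NormedAddCommGroup (SobolevSpace s) :=
  NormedAddCommGroup.induced _ _ toL2 toL2_injective

instance : NormedSpace ℂ (SobolevSpace s) := NormedSpace.induced ℂ _ _ toL2

theorem norm_eq (u : SobolevSpace s) : ‖u‖ = ‖toL2 u‖ := rfl

theorem continuous_toDistr : Continuous (toDistr : SobolevSpace s → 𝓢'(ℝ, ℂ)) := by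
  have h : Continuous (toL2 : SobolevSpace s → _) := continuous_induced_dom
  have e : (toDistr : SobolevSpace s → 𝓢'(ℝ, ℂ)) = fun u => besselPotential ℝ ℂ (-s)
      (Lp.toTemperedDistributionCLM ℂ (volume : Measure ℝ) 2 (toL2 u)) := funext toDistr_eq
  rw [e]
  fun_prop

theorem continuous_toDistr_apply (ψ : 𝓢(ℝ, ℂ)) :
    Continuous (fun u : SobolevSpace s => toDistr u ψ) :=
  (PointwiseConvergenceCLM.evalCLM (RingHom.id ℂ) ℂ ψ).continuous.comp continuous_toDistr

end SobolevSpace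

/-! ### The Sobolev spaces `H^r(0,T)`, `r ∈ ℝ` -/

/-- `C_c^∞(0,T)`: the Schwartz functions whose support is contained in the open interval. -/
abbrev IntervalTest (T : ℝ) : Type := {η : 𝓢(ℝ, ℂ) // tsupport η ⊆ Ioo 0 T}

/-- The elements of `H^r(ℝ)` that vanish, as distributions, on `(0,T)`. -/
def vanishingOn (r T : ℝ) : Submodule ℂ (SobolevSpace r) where
  carrier := {u | Distribution.IsVanishingOn (SobolevSpace.toDistr u) (Ioo 0 T)}
  add_mem' {u v} hu hv η hη := by
    rw [map_add]
    change SobolevSpace.toDistr u η + SobolevSpace.toDistr v η = 0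
    rw [hu η hη, hv η hη, add_zero]
  zero_mem' η _ := by rw [map_zero]; rfl
  smul_mem' c u hu η hη := by
    rw [map_smul]
    change c • SobolevSpace.toDistr u η = 0
    rw [hu η hη, smul_zero]

instance isClosed_vanishingOn (r T : ℝ) : IsClosed (vanishingOn r T : Set (SobolevSpace r)) := by
  have e : (vanishingOn r T : Set (SobolevSpace r)) =
      ⋂ (η : 𝓢(ℝ, ℂ)) (_ : tsupport η ⊆ Ioo 0 T),
        {u : SobolevSpace r | SobolevSpace.toDistr u η = 0} := by
    ext u
    simp only [mem_iInter, mem_ofPred_eq]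
    rfl
  rw [e]
  exact isClosed_iInter fun η => isClosed_iInter fun _ =>
    isClosed_eq (SobolevSpace.continuous_toDistr_apply η) continuous_const

/-- The space `H^r(0,T)` of the restrictions to `(0,T)` of the elements of `H^r(ℝ)`, with the
quotient norm `‖h‖ = inf {‖u‖_{H^r(ℝ)} : u|_{(0,T)} = h}`. -/
abbrev SobolevInterval (r T : ℝ) : Type := SobolevSpace r ⧸ vanishingOn r T

/-- The pairing `⟨h, η⟩` of `h ∈ H^r(0,T)`, a distribution on `(0,T)`, with `η ∈ C_c^∞(0,T)`. -/
def pairing {r T : ℝ} (h : SobolevInterval r T) (η : IntervalTest T) : ℂ :=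
  Quotient.liftOn' h (fun u => SobolevSpace.toDistr u η.1) fun u v huv => by
    have h0 : SobolevSpace.toDistr (u - v) η.1 = 0 :=
      (Submodule.quotientRel_def _).mp huv η.1 η.2
    rw [map_sub] at h0
    exact sub_eq_zero.mp h0

theorem pairing_mk {r T : ℝ} (u : SobolevSpace r) (η : IntervalTest T) :
    pairing (Submodule.Quotient.mk u : SobolevInterval r T) η = SobolevSpace.toDistr u η.1 := rfl

/-- `g = t^a h` as distributions on `(0,T)`, i.e. `⟨g, η⟩ = ⟨h, t^a η⟩` for `η ∈ C_c^∞(0,T)`. -/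
def IsPowMul {r r' T : ℝ} (a : ℝ) (h : SobolevInterval r T) (g : SobolevInterval r' T) : Prop :=
  ∀ η ζ : IntervalTest T, (∀ t : ℝ, ζ.1 t = ((t ^ a : ℝ) : ℂ) * η.1 t) → pairing g η = pairing h ζ

/-! ### Solutions and their traces -/

/-- The distributional derivative `∂_x^k` of a tempered distribution. -/
def dx (k : ℕ) (u : 𝓢'(ℝ, ℂ)) : 𝓢'(ℝ, ℂ) := (derivCLM ℂ)^[k] u

/-- `q ∈ L²(0,T; H^σ(ℝ))` and `q(t) = w(t)` as distributions for almost every `t ∈ (0,T)`. -/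
def IsL2Version {σ : ℝ} (T : ℝ) (w : ℝ → 𝓢'(ℝ, ℂ)) (q : ℝ → SobolevSpace σ) : Prop :=
  MemLp q 2 (volume.restrict (Ioo 0 T)) ∧
    ∀ᵐ t ∂(volume.restrict (Ioo 0 T)), SobolevSpace.toDistr (q t) = w t

/-- `p ∈ C([0,T]; H^s(ℝ)) ∩ L²(0,T; H^{s+2}(ℝ))` solves `p_t + p_xxxx + δ p_xxx = 0`, `p(0) = φ`.
The equation is understood in the sense of `𝓢'(ℝ)`-valued distributions on `(0,T)`: it is tested
against all products `ψ(x) η(t)` with `ψ ∈ 𝓢(ℝ)` and `η ∈ C_c^∞(0,T)`. -/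
structure IsSolution (δ s T : ℝ) (φ : SobolevSpace s) (p : ℝ → SobolevSpace s) : Prop where
  continuousOn : ContinuousOn p (Icc 0 T)
  memL2 : ∃ q : ℝ → SobolevSpace (s + 2),
    IsL2Version T (fun t => SobolevSpace.toDistr (p t)) q
  initial : p 0 = φ
  equation : ∀ (ψ : 𝓢(ℝ, ℂ)) (η : IntervalTest T),
    ∫ t in Ioo 0 T, (-(deriv η.1 t) * SobolevSpace.toDistr (p t) ψ +
      η.1 t * (dx 4 (SobolevSpace.toDistr (p t)) ψ +
        (δ : ℂ) * dx 3 (SobolevSpace.toDistr (p t)) ψ)) = 0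

/-- `∂_x^k p ∈ C(ℝ; H^r(0,T))`, and `h x = ∂_x^k p(x, ·)` for `x ∈ ℝ`: the map `h` is continuous
and the distribution on `ℝ × (0,T)` it induces is `∂_x^k p`. -/
def IsTrace {s r T : ℝ} (k : ℕ) (p : ℝ → SobolevSpace s) (h : ℝ → SobolevInterval r T) : Prop :=
  Continuous h ∧ ∀ (ψ : 𝓢(ℝ, ℂ)) (η : IntervalTest T), HasCompactSupport ψ →
    ∫ t in Ioo 0 T, η.1 t * dx k (SobolevSpace.toDistr (p t)) ψ = ∫ x, ψ x * pairing (h x) η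

end LinearKS

end

/-! On the Fourier side the equation is multiplication by `exp(-t a(ξ))`, where `a(ξ) = (2πiξ)⁴ +
δ(2πiξ)³` and `Re a = (2πξ)⁴ ≥ 0`. Write `X = ⟨ξ⟩⁴`, `Y = ⟨τ⟩`. For `|ξ| > 1` one has `X ≤ Re a` and
`|a| ≤ (1+|δ|) Re a`, so the third-order term never competes with the dissipation; for `|ξ| ≤ 1`
everything is bounded. The flow is therefore a contraction on `H^s`. The parabolic gain, with or
without the weight `t^b`, comes from `∫ X exp(-tX) dt = 1` and the boundedness of `(tX)^c exp(-tX)`.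

The traces are the main point. For each `ξ` the function `exp(-ta)` on `(0,T)` is extended to a
function `m_ξ` on `ℝ`. The Fourier transform in time of the trace at `x` is then an integral
operator in `ξ`, with kernel `𝓕 m_ξ(τ)` times powers of `⟨ξ⟩`, applied to `exp(2πixξ)` times the
weighted transform of the datum. Since `x` enters only through a unimodular factor, one `L²` bound
for the kernel gives the uniform bound and the continuity in `x`. The kernels are all dominated by
`(X^{3/8} + Y^{3/8})/(X + Y)`, which is bounded on `L²` by Schur's test
(`exists_lintegral_kap_sq_le`).

As the order `r` of the trace space is arbitrary, `𝓕 m_ξ` must decay fast for `Y ≫ X` (for `r > 0`)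
and be small for `Y ≪ X` (for `r < 0`). For `|ξ| > 1` the extension to negative times is a
combination of `exp((j+1)at)` with coefficients such that `𝓕 m_ξ` is a multiple of
`zᴺ/((1+z)∏(j+1-z))`, `z = 2πiτ/a` (`exists_partial_fraction`): this has a zero of order `N` at `0`
and decays like `z^{-N-1}`. Low frequencies are cut off smoothly in time. With the weight
`t^{|s|/4}`, extension by zero to negative times suffices, since the target orders `3/8 - k/4` are
nonnegative and less than one.

Uniqueness: for `θ ∈ C_c^∞` the moments `z_j(t) = ∫ aʲ θ û(t)` of the difference `u` of two
solutions satisfy `z_j' = -z_{j+1}`, `z_j(0) = 0` and `|z_j| ≤ M Bʲ`. Iterating the integrated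
relation gives `|z_0| ≤ M (Bt)ⁿ/n!` for all `n`, hence `z_0 = 0`. -/

noncomputable section

namespace LinearKS

open FourierTransform

/-! ### `H^s(ℝ)` as a weighted `L²` space on the Fourier side -/

namespace SobolevSpace

variable {s : ℝ}

/-- The weighted Fourier transform `(1 + ξ²)^(s/2) 𝓕 u` of `u ∈ H^s(ℝ)`. -/
def hat (u : SobolevSpace s) : Lp ℂ 2 (volume : Measure ℝ) := 𝓕 (toL2 u)

theorem norm_hat (u : SobolevSpace s) : ‖hat u‖ = ‖u‖ := by
  rw [hat, Lp.norm_fourier_eq, norm_eq]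

theorem hat_sub (u v : SobolevSpace s) : hat (u - v) = hat u - hat v := by
  rw [hat, map_sub]
  exact (Lp.fourierTransformₗᵢ ℝ ℂ).map_sub _ _

theorem hat_injective : Function.Injective (hat : SobolevSpace s → _) := fun u v h => by
  have : hat (u - v) = 0 := by rw [hat_sub, h, sub_self]
  have h0 : ‖u - v‖ = 0 := by rw [← norm_hat, this, norm_zero]
  exact sub_eq_zero.mp (norm_eq_zero.mp h0)

theorem hasTemperateGrowth_weight (r : ℝ) :
    (fun ξ : ℝ => (((1 + ‖ξ‖ ^ 2) ^ r : ℝ) : ℂ)).HasTemperateGrowth := by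
  fun_prop

/-- The pairing is bilinear, so moving the Fourier transform off `u` puts `𝓕⁻` on `ψ`. This formula
turns statements about distributions into statements about integrals in `ξ`. -/
theorem toDistr_apply (u : SobolevSpace s) (ψ : 𝓢(ℝ, ℂ)) :
    toDistr u ψ = ∫ ξ, (((1 + ξ ^ 2) ^ (-s / 2) : ℝ) : ℂ) * (𝓕⁻ ψ) ξ * hat u ξ := by
  rw [toDistr_eq, besselPotential, fourierMultiplierCLM_apply, fourierInv_apply,
    smulLeftCLM_apply_apply, Lp.toTemperedDistributionCLM_apply,
    Lp.fourier_toTemperedDistribution_eq, Lp.toTemperedDistribution_apply]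
  refine integral_congr_ae (Filter.Eventually.of_forall fun ξ => ?_)
  beta_reduce
  rw [SchwartzMap.smulLeftCLM_apply_apply (hasTemperateGrowth_weight (-s / 2)), smul_eq_mul,
    smul_eq_mul, Real.norm_eq_abs, sq_abs]
  rfl

/-- The element of `H^s(ℝ)` with weighted Fourier transform `g`. -/
def ofHat (s : ℝ) (g : Lp ℂ 2 (volume : Measure ℝ)) : SobolevSpace s :=
  ⟨besselPotential ℝ ℂ (-s) ((𝓕⁻ g : Lp ℂ 2 (volume : Measure ℝ)) : 𝓢'(ℝ, ℂ)),
    ⟨𝓕⁻ g, by rw [besselPotential_besselPotential_apply]; simp⟩⟩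

theorem hat_ofHat (g : Lp ℂ 2 (volume : Measure ℝ)) : hat (ofHat s g) = g := by
  have h : toL2 (ofHat s g) = 𝓕⁻ g := by
    apply lp_injective
    rw [Lp.toTemperedDistributionCLM_apply, Lp.toTemperedDistributionCLM_apply,
      ← besselPotential_toDistr]
    change besselPotential ℝ ℂ s (besselPotential ℝ ℂ (-s) _) = _
    rw [besselPotential_besselPotential_apply]; simp
  rw [hat, h, fourier_fourierInv_eq]

open Classical in
/-- The element of `H^s(ℝ)` with weighted Fourier transform `f`, for square integrable `f`. -/
def ofFun (s : ℝ) (f : ℝ → ℂ) : SobolevSpace s :=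
  if h : MemLp f 2 volume then ofHat s (h.toLp f) else 0

theorem hat_ofFun {f : ℝ → ℂ} (hf : MemLp f 2 volume) : hat (ofFun s f) = hf.toLp f := by
  rw [ofFun, dif_pos hf, hat_ofHat]

theorem coeFn_hat_ofFun {f : ℝ → ℂ} (hf : MemLp f 2 volume) : hat (ofFun s f) =ᵐ[volume] f := by
  rw [hat_ofFun hf]; exact hf.coeFn_toLp

theorem enorm_ofFun {f : ℝ → ℂ} (hf : MemLp f 2 volume) :
    ‖ofFun s f‖ₑ = eLpNorm f 2 volume := by
  rw [← ofReal_norm, ← norm_hat, hat_ofFun hf, Lp.norm_toLp, ENNReal.ofReal_toReal hf.2.ne]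

theorem eLpNorm_hat (u : SobolevSpace s) : eLpNorm (hat u) 2 volume = ENNReal.ofReal ‖u‖ := by
  rw [← norm_hat, Lp.norm_def, ENNReal.ofReal_toReal (Lp.eLpNorm_ne_top _)]

theorem norm_ofFun_le {f : ℝ → ℂ} (hf : MemLp f 2 volume) {C : ℝ} (hC : 0 ≤ C)
    (h : eLpNorm f 2 volume ≤ ENNReal.ofReal C) : ‖ofFun s f‖ ≤ C := by
  rw [← enorm_ofFun (s := s) hf, ← ofReal_norm] at h
  exact (ENNReal.ofReal_le_ofReal_iff hC).mp h

theorem ofFun_sub {f g : ℝ → ℂ} (hf : MemLp f 2 volume) (hg : MemLp g 2 volume) :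
    ofFun s f - ofFun s g = ofFun s (f - g) := by
  apply hat_injective
  rw [hat_sub, hat_ofFun hf, hat_ofFun hg, hat_ofFun (hf.sub hg), MemLp.toLp_sub]

theorem ofFun_hat (u : SobolevSpace s) : ofFun s (hat u) = u := by
  apply hat_injective
  rw [hat_ofFun (Lp.memLp _), Lp.toLp_coeFn]

theorem toDistr_ofFun {f : ℝ → ℂ} (hf : MemLp f 2 volume) (ψ : 𝓢(ℝ, ℂ)) :
    toDistr (ofFun s f) ψ = ∫ ξ, (((1 + ξ ^ 2) ^ (-s / 2) : ℝ) : ℂ) * (𝓕⁻ ψ) ξ * f ξ := by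
  rw [toDistr_apply]
  refine integral_congr_ae ?_
  filter_upwards [coeFn_hat_ofFun (s := s) hf] with ξ h
  rw [h]

/-- Weighted square integrability of `(2πiξ)^k (1 + ξ²)^(-s/2) 𝓕⁻ψ` for Schwartz `ψ`. -/
theorem memLp_weight_fourierInv (k : ℕ) (r : ℝ) (ψ : 𝓢(ℝ, ℂ)) (q : ENNReal) :
    MemLp (fun ξ : ℝ => (2 * Real.pi * Complex.I * ξ) ^ k * (((1 + ξ ^ 2) ^ r : ℝ) : ℂ) *
      (𝓕⁻ ψ) ξ) q volume := by
  have h1 : (fun ξ : ℝ => (2 * Real.pi * Complex.I * ξ) ^ k).HasTemperateGrowth := by fun_prop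
  have h2 := hasTemperateGrowth_weight r
  have h3 := h1.mul h2
  refine ((SchwartzMap.smulLeftCLM ℂ ((fun ξ : ℝ => (2 * Real.pi * Complex.I * ξ) ^ k) *
      fun ξ : ℝ => (((1 + ‖ξ‖ ^ 2) ^ r : ℝ) : ℂ)) (𝓕⁻ ψ)).memLp q volume).congr_norm
    (Continuous.aestronglyMeasurable ?_)
    (Filter.Eventually.of_forall fun ξ => ?_)
  · exact (h1.1.continuous.mul (by simpa using h2.1.continuous)).mul (𝓕⁻ ψ).continuous
  · rw [SchwartzMap.smulLeftCLM_apply_apply h3]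
    simp

theorem fourierInv_deriv_iterate (k : ℕ) (ψ : 𝓢(ℝ, ℂ)) (ξ : ℝ) :
    𝓕⁻ ((fun f : 𝓢(ℝ, ℂ) => -SchwartzMap.derivCLM ℂ ℂ f)^[k] ψ) ξ =
      (2 * Real.pi * Complex.I * ξ) ^ k * (𝓕⁻ ψ) ξ := by
  induction k generalizing ψ with
  | zero => simp
  | succ k ih =>
    rw [Function.iterate_succ, Function.comp, ih]
    have h : SchwartzMap.derivCLM ℂ ℂ ψ = LineDeriv.lineDerivOp (1 : ℝ) ψ := by
      ext x
      simp [SchwartzMap.lineDerivOp_apply_eq_fderiv]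
    rw [FourierTransform.fourierInv_neg, h, SchwartzMap.fourierInv_lineDerivOp_eq]
    have h1 : (fun x : ℝ => inner ℝ x (1 : ℝ)).HasTemperateGrowth := by fun_prop
    simp only [neg_apply, smul_apply, SchwartzMap.smulLeftCLM_apply_apply h1]
    simp
    ring

theorem dx_apply (k : ℕ) (u : 𝓢'(ℝ, ℂ)) (ψ : 𝓢(ℝ, ℂ)) :
    dx k u ψ = u ((fun f : 𝓢(ℝ, ℂ) => -SchwartzMap.derivCLM ℂ ℂ f)^[k] ψ) := by
  induction k generalizing u ψ with
  | zero => rfl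
  | succ k ih =>
    rw [dx, Function.iterate_succ', Function.comp, derivCLM_apply_apply]
    change dx k u _ = _
    rw [ih]
    rfl

theorem dx_toDistr_apply (k : ℕ) (u : SobolevSpace s) (ψ : 𝓢(ℝ, ℂ)) :
    dx k (toDistr u) ψ = ∫ ξ, (2 * Real.pi * Complex.I * ξ) ^ k *
      (((1 + ξ ^ 2) ^ (-s / 2) : ℝ) : ℂ) * (𝓕⁻ ψ) ξ * hat u ξ := by
  rw [dx_apply, toDistr_apply]
  refine integral_congr_ae (Filter.Eventually.of_forall fun ξ => ?_)
  simp only [fourierInv_deriv_iterate]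
  ring

theorem integrable_dx (k : ℕ) (s : ℝ) {g : ℝ → ℂ} (hg : MemLp g 2 volume) (ψ : 𝓢(ℝ, ℂ)) :
    Integrable (fun ξ : ℝ => (2 * Real.pi * Complex.I * ξ) ^ k *
      (((1 + ξ ^ 2) ^ (-s / 2) : ℝ) : ℂ) * (𝓕⁻ ψ) ξ * g ξ) volume :=
  (memLp_weight_fourierInv k (-s / 2) ψ 2).integrable_mul hg

/-- Dominated convergence for the squared difference, with majorant `(2F)²`. It yields the
continuity of the flow in `t` and of the traces in `x`. -/
theorem tendsto_eLpNorm_sub {ι : Type*} {l : Filter ι} [l.IsCountablyGenerated]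
    {f : ι → ℝ → ℂ} {f0 : ℝ → ℂ} {F : ℝ → ℝ}
    (hF : MemLp F 2 volume) (hf : ∀ i, AEStronglyMeasurable (f i) volume)
    (hf0 : AEStronglyMeasurable f0 volume)
    (hb : ∀ᶠ i in l, ∀ᵐ ξ, ‖f i ξ‖ ≤ F ξ) (hb0 : ∀ᵐ ξ, ‖f0 ξ‖ ≤ F ξ)
    (hc : ∀ᵐ ξ, Filter.Tendsto (fun i => f i ξ) l (nhds (f0 ξ))) :
    Filter.Tendsto (fun i => eLpNorm (f i - f0) 2 volume) l (nhds 0) := by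
  have hm : ∀ i, AEStronglyMeasurable (f i - f0) volume := fun i => (hf i).sub hf0
  have hb' : ∀ᶠ i in l, ∀ᵐ ξ, ‖(f i - f0) ξ‖ ≤ 2 * F ξ := by
    filter_upwards [hb] with i hi
    filter_upwards [hi, hb0] with ξ h1 h2
    exact (norm_sub_le _ _).trans (by linarith)
  have hF2 : MemLp (fun ξ => 2 * F ξ) 2 volume := hF.const_mul 2
  have key : Filter.Tendsto (fun i => ∫ ξ, ‖(f i - f0) ξ‖ ^ 2) l (nhds (∫ _ : ℝ, (0 : ℝ))) := by
    refine tendsto_integral_filter_of_dominated_convergence (fun ξ => (2 * F ξ) ^ 2)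
      (Filter.Eventually.of_forall fun i => (hm i).norm.pow 2) ?_ hF2.integrable_sq ?_
    · filter_upwards [hb'] with i hi
      filter_upwards [hi] with ξ h1
      rw [norm_pow, norm_norm]
      exact pow_le_pow_left₀ (norm_nonneg _) h1 2
    · filter_upwards [hc] with ξ h
      have := ((h.sub_const (f0 ξ)).norm).pow 2
      simpa using this
  rw [integral_zero] at key
  have h2 : Filter.Tendsto (fun i => ENNReal.ofReal ((∫ ξ, ‖(f i - f0) ξ‖ ^ 2) ^ (2⁻¹ : ℝ))) l
      (nhds 0) := by
    have := (ENNReal.continuous_ofReal.tendsto _).comp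
      (((Real.continuous_rpow_const (q := (2⁻¹ : ℝ)) (by norm_num)).tendsto 0).comp key)
    simpa [Function.comp_def] using this
  -- The `L²` seminorm is given by a real integral once the difference is square integrable, which
  -- the majorant ensures eventually.
  refine h2.congr' ?_
  filter_upwards [hb'] with i hi
  rw [(hF2.of_le (hm i) (hi.mono fun ξ h => h.trans (le_abs_self _))).eLpNorm_eq_integral_rpow_norm
    (by norm_num) (by norm_num)]
  simp

theorem continuousWithinAt_ofFun {f : ℝ → ℝ → ℂ} {S : Set ℝ} {t₀ : ℝ} {F : ℝ → ℝ}
    (ht₀ : t₀ ∈ S) (hF : MemLp F 2 volume) (hf : ∀ t, AEStronglyMeasurable (f t) volume)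
    (hb : ∀ t ∈ S, ∀ᵐ ξ, ‖f t ξ‖ ≤ F ξ)
    (hc : ∀ᵐ ξ, ContinuousWithinAt (fun t => f t ξ) S t₀) :
    ContinuousWithinAt (fun t => ofFun s (f t)) S t₀ := by
  have hL : ∀ t ∈ S, MemLp (f t) 2 volume := fun t ht =>
    hF.of_le (hf t) ((hb t ht).mono fun ξ h => h.trans (le_abs_self _))
  rw [ContinuousWithinAt, tendsto_iff_norm_sub_tendsto_zero]
  have h := tendsto_eLpNorm_sub (l := nhdsWithin t₀ S) hF hf (hf t₀)
    (eventually_mem_nhdsWithin.mono hb) (hb t₀ ht₀) hc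
  have h2 := (ENNReal.tendsto_toReal ENNReal.zero_ne_top).comp h
  refine h2.congr' ?_
  filter_upwards [eventually_mem_nhdsWithin] with t ht
  rw [ofFun_sub (hL t ht) (hL t₀ ht₀), ← toReal_enorm, enorm_ofFun ((hL t ht).sub (hL t₀ ht₀))]
  rfl

end SobolevSpace

end LinearKS

end

/-! ### Schur's test and the model kernel -/

noncomputable section

namespace LinearKS

open scoped ENNReal

/-- Schur's test. -/
theorem lintegral_sq_le_of_schur {K : ℝ → ℝ → ℝ≥0∞} (hK : Measurable (Function.uncurry K))
    {p q F : ℝ → ℝ≥0∞} (hp : Measurable p) (hq : Measurable q) (hF : Measurable F)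
    (hp0 : ∀ ξ, p ξ ≠ 0) (hpt : ∀ ξ, p ξ ≠ ∞) {C₁ C₂ : ℝ≥0∞}
    (h₁ : ∀ τ, ∫⁻ ξ, K τ ξ * p ξ ≤ C₁ * q τ) (h₂ : ∀ ξ, ∫⁻ τ, K τ ξ * q τ ≤ C₂ * p ξ) :
    ∫⁻ τ, (∫⁻ ξ, K τ ξ * F ξ) ^ 2 ≤ C₁ * C₂ * ∫⁻ ξ, F ξ ^ 2 := by
  have hKτ : ∀ τ, Measurable (K τ) := fun τ => hK.of_uncurry_left
  have hKξ : ∀ ξ, Measurable (fun τ => K τ ξ) := fun ξ => hK.of_uncurry_right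
  have half : ∀ a : ℝ≥0∞, (a ^ (1 / 2 : ℝ)) ^ (2 : ℝ) = a := fun a => by
    rw [← ENNReal.rpow_mul]; norm_num
  -- Cauchy–Schwarz for the splitting `K F = (K p)^{1/2} (K F²/p)^{1/2}`; the first factor is
  -- controlled by `h₁`. The condition `h₂` enters after Tonelli.
  have cs : ∀ τ, (∫⁻ ξ, K τ ξ * F ξ) ^ 2 ≤
      (C₁ * q τ) * ∫⁻ ξ, K τ ξ * (F ξ ^ 2 * (p ξ)⁻¹) := by
    intro τ
    have e : ∀ ξ, K τ ξ * F ξ =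
        ((K τ ξ * p ξ) ^ (1 / 2 : ℝ)) * (K τ ξ * (F ξ ^ 2 * (p ξ)⁻¹)) ^ (1 / 2 : ℝ) := by
      intro ξ
      rw [← ENNReal.mul_rpow_of_nonneg _ _ (by norm_num : (0 : ℝ) ≤ 1 / 2)]
      have : K τ ξ * p ξ * (K τ ξ * (F ξ ^ 2 * (p ξ)⁻¹)) = (K τ ξ * F ξ) ^ (2 : ℝ) := by
        rw [ENNReal.rpow_two]
        calc _ = K τ ξ * F ξ * (K τ ξ * F ξ) * (p ξ * (p ξ)⁻¹) := by ring
          _ = _ := by rw [ENNReal.mul_inv_cancel (hp0 ξ) (hpt ξ)]; ring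
      rw [this, ← ENNReal.rpow_mul]; norm_num
    have h := ENNReal.lintegral_mul_le_Lp_mul_Lq volume Real.HolderConjugate.two_two
      (f := fun ξ => (K τ ξ * p ξ) ^ (1 / 2 : ℝ))
      (g := fun ξ => (K τ ξ * (F ξ ^ 2 * (p ξ)⁻¹)) ^ (1 / 2 : ℝ))
      (by have := hKτ τ; fun_prop) (by have := hKτ τ; fun_prop)
    simp only [half, Pi.mul_apply] at h
    simp only [← e] at h
    calc _ ≤ ((∫⁻ ξ, K τ ξ * p ξ) ^ (1 / 2 : ℝ) *
          (∫⁻ ξ, K τ ξ * (F ξ ^ 2 * (p ξ)⁻¹)) ^ (1 / 2 : ℝ)) ^ (2 : ℝ) := by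
          rw [ENNReal.rpow_two]; gcongr
      _ = (∫⁻ ξ, K τ ξ * p ξ) * ∫⁻ ξ, K τ ξ * (F ξ ^ 2 * (p ξ)⁻¹) := by
          rw [ENNReal.mul_rpow_of_nonneg _ _ (by norm_num), half, half]
      _ ≤ _ := by gcongr; exact h₁ τ
  calc _ ≤ ∫⁻ τ, ∫⁻ ξ, C₁ * q τ * (K τ ξ * (F ξ ^ 2 * (p ξ)⁻¹)) := by
        refine lintegral_mono fun τ => (cs τ).trans_eq ?_
        rw [lintegral_const_mul]
        have := hKτ τ; fun_prop
    _ = ∫⁻ ξ, ∫⁻ τ, C₁ * q τ * (K τ ξ * (F ξ ^ 2 * (p ξ)⁻¹)) := by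
        refine lintegral_lintegral_swap (Measurable.aemeasurable ?_)
        have h1 : Measurable fun z : ℝ × ℝ => K z.1 z.2 := hK
        change Measurable fun z : ℝ × ℝ => C₁ * q z.1 * (K z.1 z.2 * (F z.2 ^ 2 * (p z.2)⁻¹))
        fun_prop
    _ ≤ ∫⁻ ξ, C₁ * C₂ * F ξ ^ 2 := by
        refine lintegral_mono fun ξ => ?_
        have e : ∀ τ, C₁ * q τ * (K τ ξ * (F ξ ^ 2 * (p ξ)⁻¹)) =
            (C₁ * (F ξ ^ 2 * (p ξ)⁻¹)) * (K τ ξ * q τ) := fun τ => by ring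
        simp only [e]
        rw [lintegral_const_mul _ (by have := hKξ ξ; fun_prop)]
        calc _ ≤ (C₁ * (F ξ ^ 2 * (p ξ)⁻¹)) * (C₂ * p ξ) := by gcongr; exact h₂ ξ
          _ = C₁ * C₂ * F ξ ^ 2 * (p ξ * (p ξ)⁻¹) := by ring
          _ = _ := by rw [ENNReal.mul_inv_cancel (hp0 ξ) (hpt ξ)]; ring
    _ = _ := lintegral_const_mul _ (by fun_prop)

/-- An integrable majorant for the homogeneous kernels below. -/
def majorant (v : ℝ) : ℝ := if |v| ≤ 1 then |v| ^ (-1 / 2 : ℝ) else |v| ^ (-9 / 8 : ℝ)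

theorem integrable_majorant : Integrable majorant volume := by
  have h : IntegrableOn (fun v : ℝ => if v ≤ 1 then v ^ (-1 / 2 : ℝ) else v ^ (-9 / 8 : ℝ))
      (Ioi 0) volume := by
    rw [← Ioc_union_Ioi_eq_Ioi (zero_le_one' ℝ)]
    refine IntegrableOn.union ?_ ?_
    · have h1 : IntegrableOn (fun v : ℝ => v ^ (-1 / 2 : ℝ)) (Ioc 0 1) volume := by
        rw [← intervalIntegrable_iff_integrableOn_Ioc_of_le zero_le_one]
        exact intervalIntegral.intervalIntegrable_rpow' (by norm_num)
      exact h1.congr_fun (fun v hv => by simp [hv.2]) measurableSet_Ioc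
    · have h1 : IntegrableOn (fun v : ℝ => v ^ (-9 / 8 : ℝ)) (Ioi 1) volume :=
        integrableOn_Ioi_rpow_of_lt (by norm_num) zero_lt_one
      exact h1.congr_fun (fun v hv => by simp [not_le.mpr (mem_Ioi.mp hv)]) measurableSet_Ioi
  have hg := (integrable_indicator_iff measurableSet_Ioi).mpr h
  refine (hg.add hg.comp_neg).congr ?_
  filter_upwards [Measure.ae_ne volume 0] with v hv
  rcases lt_or_gt_of_ne hv with h0 | h0
  · simp [majorant, indicator, h0, not_lt.mpr h0.le, abs_of_neg h0]
  · simp [majorant, indicator, h0, not_lt.mpr h0.le, abs_of_pos h0]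

theorem majorant_nonneg (v : ℝ) : 0 ≤ majorant v := by
  unfold majorant; split_ifs <;> positivity

/-- For small `u` the quotient is at most `u^{-c}`, for large `u` at most `u^{-(c+m)}`; in the mixed
case `|v| ≤ 1 ≤ u` it is at most `1`. The thresholds `1/2` and `9/8` are the extreme values over the
pairs `(c,m) = (-1,4), (1/2,4), (1/2,1), (1/8,1)` that occur in the two Schur conditions. -/
theorem le_majorant {c m u v : ℝ} (hv : v ≠ 0) (huv : |v| ≤ u) (hc : c ≤ 1 / 2)
    (hcm : 9 / 8 ≤ c + m) : u ^ (-c) / (u ^ m + 1) ≤ majorant v := by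
  have hv0 : 0 < |v| := abs_pos.mpr hv
  have hu : 0 < u := hv0.trans_le huv
  have hum : 0 < u ^ m := Real.rpow_pos_of_pos hu m
  have huc : 0 < u ^ (-c) := Real.rpow_pos_of_pos hu _
  have large : u ^ (-c) / (u ^ m + 1) ≤ u ^ (-(c + m)) := by
    rw [div_le_iff₀ (by positivity), neg_add, Real.rpow_add hu, Real.rpow_neg hu.le m, mul_assoc]
    have : 1 ≤ (u ^ m)⁻¹ * (u ^ m + 1) := by
      rw [mul_add, inv_mul_cancel₀ hum.ne']; linarith [inv_pos.mpr hum]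
    nlinarith
  unfold majorant
  split_ifs with h
  · have h1 : 1 ≤ |v| ^ (-1 / 2 : ℝ) := Real.one_le_rpow_of_pos_of_le_one_of_nonpos hv0 h
      (by norm_num)
    rcases le_total u 1 with hu1 | hu1
    · calc _ ≤ u ^ (-c) := div_le_self huc.le (by linarith)
        _ ≤ u ^ (-1 / 2 : ℝ) := Real.rpow_le_rpow_of_exponent_ge hu hu1 (by linarith)
        _ ≤ _ := Real.rpow_le_rpow_of_nonpos hv0 huv (by norm_num)
    · calc _ ≤ u ^ (-(c + m)) := large
        _ ≤ 1 := Real.rpow_le_one_of_one_le_of_nonpos hu1 (by linarith)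
        _ ≤ _ := h1
  · push Not at h
    calc _ ≤ u ^ (-(c + m)) := large
      _ ≤ u ^ (-9 / 8 : ℝ) := Real.rpow_le_rpow_of_exponent_le (h.le.trans huv) (by linarith)
      _ ≤ _ := Real.rpow_le_rpow_of_nonpos hv0 huv (by norm_num)

/-- The substitution `z = l v` extracts the power of `l`. Allowing any `Z ≥ |z|` covers the Japanese
bracket `Z = ⟨z⟩`. -/
theorem lintegral_homogeneous_le {c m l : ℝ} {Z : ℝ → ℝ} (hl : 0 < l) (hZ : ∀ z, |z| ≤ Z z)
    (hc : c ≤ 1 / 2) (hcm : 9 / 8 ≤ c + m) :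
    ∫⁻ z, ENNReal.ofReal (Z z ^ (-c) / (Z z ^ m + l ^ m)) ≤
      ENNReal.ofReal (l ^ (1 - c - m) * ∫ v, majorant v) := by
  have hpt : ∀ z : ℝ, z ≠ 0 →
      Z z ^ (-c) / (Z z ^ m + l ^ m) ≤ l ^ (-c - m) * majorant (z / l) := by
    intro z hz
    have hZ0 : 0 < Z z := (abs_pos.mpr hz).trans_le (hZ z)
    have h := le_majorant (u := Z z / l) (v := z / l) (div_ne_zero hz hl.ne')
      (by rw [abs_div, abs_of_pos hl]; gcongr; exact hZ z) hc hcm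
    have e : Z z ^ (-c) / (Z z ^ m + l ^ m) =
        l ^ (-c - m) * ((Z z / l) ^ (-c) / ((Z z / l) ^ m + 1)) := by
      rw [Real.div_rpow hZ0.le hl.le, Real.div_rpow hZ0.le hl.le, Real.rpow_sub hl]
      have h1 : l ^ m ≠ 0 := (Real.rpow_pos_of_pos hl m).ne'
      have h2 : l ^ (-c) ≠ 0 := (Real.rpow_pos_of_pos hl _).ne'
      field_simp
    rw [e]
    gcongr
  have hi : Integrable (fun z => l ^ (-c - m) * majorant (z / l)) volume :=
    (integrable_majorant.comp_div hl.ne').const_mul _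
  calc _ ≤ ∫⁻ z, ENNReal.ofReal (l ^ (-c - m) * majorant (z / l)) := by
        refine lintegral_mono_ae ?_
        filter_upwards [Measure.ae_ne volume 0] with z hz
        exact ENNReal.ofReal_le_ofReal (hpt z hz)
    _ = ENNReal.ofReal (∫ z, l ^ (-c - m) * majorant (z / l)) :=
        (ofReal_integral_eq_lintegral_ofReal hi (Filter.Eventually.of_forall fun z =>
          mul_nonneg (by positivity) (majorant_nonneg _))).symm
    _ = _ := by
        rw [integral_const_mul, Measure.integral_comp_div, abs_of_pos hl, smul_eq_mul, ← mul_assoc]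
        congr 2
        rw [show (1 - c - m : ℝ) = (-c - m) + 1 by ring, Real.rpow_add hl, Real.rpow_one]

/-- The kernel that majorizes all the traces. -/
def kap (τ ξ : ℝ) : ℝ :=
  ((1 + ξ ^ 2) ^ (3 / 4 : ℝ) + (1 + τ ^ 2) ^ (3 / 16 : ℝ)) /
    ((1 + ξ ^ 2) ^ (2 : ℝ) + (1 + τ ^ 2) ^ (1 / 2 : ℝ))

theorem kap_pos (τ ξ : ℝ) : 0 < kap τ ξ := by unfold kap; positivity

theorem measurable_kap : Measurable (Function.uncurry kap) := by
  unfold kap; fun_prop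

theorem abs_le_weight (z : ℝ) : |z| ≤ (1 + z ^ 2) ^ (1 / 2 : ℝ) := by
  rw [← Real.sqrt_eq_rpow]
  exact Real.abs_le_sqrt (by linarith)

/-- The operator with kernel `kap` is bounded on `L²`. -/
theorem exists_lintegral_kap_sq_le : ∃ C : ℝ, 0 ≤ C ∧ ∀ F : ℝ → ℝ≥0∞, Measurable F →
    ∫⁻ τ, (∫⁻ ξ, ENNReal.ofReal (kap τ ξ) * F ξ) ^ 2 ≤ ENNReal.ofReal C * ∫⁻ ξ, F ξ ^ 2 := by
  set I := ∫ v, majorant v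
  have hI : 0 ≤ I := integral_nonneg majorant_nonneg
  refine ⟨(2 * I) * (2 * I), by positivity, fun F hF => ?_⟩
  rw [ENNReal.ofReal_mul (by positivity)]
  -- The Schur weights are `⟨ξ⟩^{-1/2} = X^{-1/8}` and `⟨τ⟩^{-1/2} = Y^{-1/2}`. They match the
  -- scaling `τ ~ ξ⁴`: the kernel has degree `-5/8` in `τ`, `dξ` has degree `1/4`, and `-5/8 + 1/4 -
  -- 1/8 = -1/2`, `-5/8 + 1 - 1/2 = -1/8`.
  refine lintegral_sq_le_of_schur (K := fun τ ξ => ENNReal.ofReal (kap τ ξ))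
    (p := fun ξ => ENNReal.ofReal ((1 + ξ ^ 2) ^ (-1 / 4 : ℝ)))
    (q := fun τ => ENNReal.ofReal ((1 + τ ^ 2) ^ (-1 / 4 : ℝ))) measurable_kap.ennreal_ofReal
    (by fun_prop) (by fun_prop) hF (fun ξ => ?_) (fun _ => ENNReal.ofReal_ne_top)
    (fun τ => ?_) (fun ξ => ?_)
  · exact (ENNReal.ofReal_pos.mpr (by positivity)).ne'
  -- With `l = ⟨τ⟩^{1/4}` the denominator is `⟨ξ⟩⁴ + l⁴`; the two terms of the numerator give `c =
  -- -1` and `c = 1/2` with `m = 4`.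
  · set l : ℝ := (1 + τ ^ 2) ^ (1 / 8 : ℝ) with hl
    have hl0 : 0 < l := by positivity
    have e : ∀ ξ : ℝ, kap τ ξ * (1 + ξ ^ 2) ^ (-1 / 4 : ℝ) =
        ((1 + ξ ^ 2) ^ (1 / 2 : ℝ)) ^ (-(-1) : ℝ) /
          (((1 + ξ ^ 2) ^ (1 / 2 : ℝ)) ^ (4 : ℝ) + l ^ (4 : ℝ))
        + l ^ (3 / 2 : ℝ) * (((1 + ξ ^ 2) ^ (1 / 2 : ℝ)) ^ (-(1 / 2) : ℝ) /
          (((1 + ξ ^ 2) ^ (1 / 2 : ℝ)) ^ (4 : ℝ) + l ^ (4 : ℝ))) := by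
      intro ξ
      have h0 : 0 < 1 + ξ ^ 2 := by positivity
      have h1 : 0 < 1 + τ ^ 2 := by positivity
      rw [hl, kap, ← Real.rpow_mul h0.le, ← Real.rpow_mul h0.le, ← Real.rpow_mul h0.le,
        ← Real.rpow_mul h1.le, ← Real.rpow_mul h1.le, div_mul_eq_mul_div, add_mul,
        ← Real.rpow_add h0, add_div]
      norm_num
      ring
    simp only [← ENNReal.ofReal_mul (kap_pos τ _).le, e]
    calc _ = (∫⁻ ξ : ℝ, ENNReal.ofReal (((1 + ξ ^ 2) ^ (1 / 2 : ℝ)) ^ (-(-1) : ℝ) /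
            (((1 + ξ ^ 2) ^ (1 / 2 : ℝ)) ^ (4 : ℝ) + l ^ (4 : ℝ)))) +
          ENNReal.ofReal (l ^ (3 / 2 : ℝ)) * ∫⁻ ξ : ℝ, ENNReal.ofReal (
            ((1 + ξ ^ 2) ^ (1 / 2 : ℝ)) ^ (-(1 / 2) : ℝ) /
            (((1 + ξ ^ 2) ^ (1 / 2 : ℝ)) ^ (4 : ℝ) + l ^ (4 : ℝ))) := by
          rw [← lintegral_const_mul _ (by fun_prop), ← lintegral_add_left (by fun_prop)]
          refine lintegral_congr fun ξ => ?_
          rw [ENNReal.ofReal_add (by positivity) (by positivity),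
            ENNReal.ofReal_mul (by positivity)]
      _ ≤ ENNReal.ofReal (l ^ (1 - (-1) - 4 : ℝ) * I) +
          ENNReal.ofReal (l ^ (3 / 2 : ℝ)) * ENNReal.ofReal (l ^ (1 - 1 / 2 - 4 : ℝ) * I) := by
          gcongr
          · exact lintegral_homogeneous_le hl0 abs_le_weight (by norm_num) (by norm_num)
          · exact lintegral_homogeneous_le hl0 abs_le_weight (by norm_num) (by norm_num)
      _ = _ := by
          rw [← ENNReal.ofReal_mul (by positivity), ← ENNReal.ofReal_add (by positivity)
            (by positivity), ← ENNReal.ofReal_mul (by positivity), ← mul_assoc,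
            ← Real.rpow_add hl0, hl, ← Real.rpow_mul (by positivity),
            ← Real.rpow_mul (by positivity)]
          congr 1
          norm_num
          ring
  -- With `l = ⟨ξ⟩⁴` the denominator is `⟨τ⟩ + l`; the two terms give `c = 1/2` and `c = 1/8` with
  -- `m = 1`.
  · set l : ℝ := (1 + ξ ^ 2) ^ (2 : ℝ) with hl
    have hl0 : 0 < l := by positivity
    have e : ∀ τ : ℝ, kap τ ξ * (1 + τ ^ 2) ^ (-1 / 4 : ℝ) =
        l ^ (3 / 8 : ℝ) * (((1 + τ ^ 2) ^ (1 / 2 : ℝ)) ^ (-(1 / 2) : ℝ) /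
          (((1 + τ ^ 2) ^ (1 / 2 : ℝ)) ^ (1 : ℝ) + l ^ (1 : ℝ))) +
        ((1 + τ ^ 2) ^ (1 / 2 : ℝ)) ^ (-(1 / 8) : ℝ) /
          (((1 + τ ^ 2) ^ (1 / 2 : ℝ)) ^ (1 : ℝ) + l ^ (1 : ℝ)) := by
      intro τ
      have h0 : 0 < 1 + ξ ^ 2 := by positivity
      have h1 : 0 < 1 + τ ^ 2 := by positivity
      rw [hl, kap, ← Real.rpow_mul h0.le, Real.rpow_one, Real.rpow_one, ← Real.rpow_mul h1.le,
        ← Real.rpow_mul h1.le, div_mul_eq_mul_div, add_mul, ← Real.rpow_add h1, add_div,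
        add_comm ((1 + τ ^ 2) ^ (1 / 2 : ℝ))]
      norm_num
      ring
    simp only [← ENNReal.ofReal_mul (kap_pos _ ξ).le, e]
    calc _ = ENNReal.ofReal (l ^ (3 / 8 : ℝ)) * (∫⁻ τ : ℝ, ENNReal.ofReal (
            ((1 + τ ^ 2) ^ (1 / 2 : ℝ)) ^ (-(1 / 2) : ℝ) /
            (((1 + τ ^ 2) ^ (1 / 2 : ℝ)) ^ (1 : ℝ) + l ^ (1 : ℝ)))) +
          ∫⁻ τ : ℝ, ENNReal.ofReal (((1 + τ ^ 2) ^ (1 / 2 : ℝ)) ^ (-(1 / 8) : ℝ) /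
            (((1 + τ ^ 2) ^ (1 / 2 : ℝ)) ^ (1 : ℝ) + l ^ (1 : ℝ))) := by
          rw [← lintegral_const_mul _ (by fun_prop), ← lintegral_add_left (by fun_prop)]
          refine lintegral_congr fun ξ => ?_
          rw [ENNReal.ofReal_add (by positivity) (by positivity),
            ENNReal.ofReal_mul (by positivity)]
      _ ≤ ENNReal.ofReal (l ^ (3 / 8 : ℝ)) * ENNReal.ofReal (l ^ (1 - 1 / 2 - 1 : ℝ) * I) +
          ENNReal.ofReal (l ^ (1 - 1 / 8 - 1 : ℝ) * I) := by
          gcongr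
          · exact lintegral_homogeneous_le hl0 abs_le_weight (by norm_num) (by norm_num)
          · exact lintegral_homogeneous_le hl0 abs_le_weight (by norm_num) (by norm_num)
      _ = _ := by
          rw [← ENNReal.ofReal_mul (by positivity), ← ENNReal.ofReal_add (by positivity)
            (by positivity), ← ENNReal.ofReal_mul (by positivity), ← mul_assoc,
            ← Real.rpow_add hl0, hl, ← Real.rpow_mul (by positivity),
            ← Real.rpow_mul (by positivity)]
          congr 1
          norm_num
          ring

end LinearKS

end

/-! ### From kernel bounds to traces -/

noncomputable section

namespace LinearKS

open FourierTransform SobolevSpace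
open scoped ENNReal

/-- The integral operator with kernel `kap` applied to `|g|`. -/
def kapInt (g : ℝ → ℂ) (τ : ℝ) : ℝ≥0∞ := ∫⁻ ξ, ENNReal.ofReal (kap τ ξ) * ‖g ξ‖ₑ

theorem measurable_kapInt {g : ℝ → ℂ} (hg : Measurable g) : Measurable (kapInt g) := by
  have hkm : Measurable fun z : ℝ × ℝ => ENNReal.ofReal (kap z.1 z.2) * ‖g z.2‖ₑ :=
    (measurable_kap.ennreal_ofReal (f := Function.uncurry kap)).mul (hg.enorm.comp measurable_snd)
  exact hkm.lintegral_prod_right'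

theorem exists_eLpNorm_kapInt_le : ∃ B : ℝ, 0 ≤ B ∧ ∀ g : ℝ → ℂ, Measurable g →
    eLpNorm (kapInt g) 2 volume ≤ ENNReal.ofReal B * eLpNorm g 2 volume := by
  obtain ⟨C₀, hC₀, H⟩ := exists_lintegral_kap_sq_le
  refine ⟨C₀ ^ (1 / 2 : ℝ), by positivity, fun g hg => ?_⟩
  rw [eLpNorm_eq_lintegral_rpow_enorm_toReal (by norm_num) (by norm_num),
    eLpNorm_eq_lintegral_rpow_enorm_toReal (by norm_num) (by norm_num),
    ← ENNReal.ofReal_rpow_of_nonneg hC₀ (by norm_num)]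
  simp only [ENNReal.toReal_ofNat, enorm_eq_self, ENNReal.rpow_two]
  rw [← ENNReal.mul_rpow_of_nonneg _ _ (by norm_num)]
  exact ENNReal.rpow_le_rpow (H _ hg.enorm) (by norm_num)

theorem lintegral_enorm_mul_le_kapInt {M : ℝ → ℝ → ℂ} {C : ℝ} {g : ℝ → ℂ} (hC : 0 ≤ C)
    (hb : ∀ τ ξ, ‖M τ ξ‖ ≤ C * kap τ ξ) (hg : Measurable g) (τ : ℝ) :
    ∫⁻ ξ, ‖M τ ξ * g ξ‖ₑ ≤ ENNReal.ofReal C * kapInt g τ := by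
  have hk : Measurable fun ξ => ENNReal.ofReal (kap τ ξ) * ‖g ξ‖ₑ :=
    (((measurable_kap.comp (measurable_const.prodMk measurable_id)).ennreal_ofReal).mul hg.enorm :)
  rw [kapInt, ← lintegral_const_mul _ hk]
  refine lintegral_mono fun ξ => ?_
  rw [enorm_mul, ← mul_assoc, ← ENNReal.ofReal_mul hC, ← ofReal_norm (M τ ξ)]
  exact mul_le_mul_left (ENNReal.ofReal_le_ofReal (hb τ ξ)) _

theorem lintegral_enorm_mul_lt_top {f : ℝ → ℂ} {N : ℝ → ℝ≥0∞} (hf : MemLp f 2 volume)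
    (hN : Measurable N) (hN2 : eLpNorm N 2 volume < ∞) : ∫⁻ τ, ‖f τ‖ₑ * N τ < ∞ := by
  have h := ENNReal.lintegral_mul_le_Lp_mul_Lq volume Real.HolderConjugate.two_two
    hf.1.enorm hN.aemeasurable
  refine h.trans_lt (ENNReal.mul_lt_top ?_ ?_)
  · have := hf.2
    rw [eLpNorm_eq_lintegral_rpow_enorm_toReal (by norm_num) (by norm_num)] at this
    simpa using this
  · rw [eLpNorm_eq_lintegral_rpow_enorm_toReal (by norm_num) (by norm_num)] at hN2
    simpa using hN2

/-- By Cauchy–Schwarz `|v|` times `kapInt g` is integrable. This licenses the exchange of the `τ`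
and `ξ` integrals when a trace is paired with a test function. -/
theorem integrable_prod_of_le_kap {M : ℝ → ℝ → ℂ} {C : ℝ} {g v : ℝ → ℂ}
    (hM : Measurable (Function.uncurry M)) (hC : 0 ≤ C) (hb : ∀ τ ξ, ‖M τ ξ‖ ≤ C * kap τ ξ)
    (hg : Measurable g) (hg2 : MemLp g 2 volume) (hv : Measurable v) (hv2 : MemLp v 2 volume) :
    Integrable (fun z : ℝ × ℝ => v z.1 * (M z.1 z.2 * g z.2)) (volume.prod volume) := by
  obtain ⟨B, -, hB⟩ := exists_eLpNorm_kapInt_le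
  have hMm : Measurable fun z : ℝ × ℝ => M z.1 z.2 := hM
  have hm : Measurable fun z : ℝ × ℝ => v z.1 * (M z.1 z.2 * g z.2) :=
    (hv.comp measurable_fst).mul (hMm.mul (hg.comp measurable_snd))
  refine ⟨hm.aestronglyMeasurable, ?_⟩
  rw [HasFiniteIntegral, lintegral_prod _ hm.enorm.aemeasurable]
  calc _ ≤ ∫⁻ τ, ENNReal.ofReal C * (‖v τ‖ₑ * kapInt g τ) := by
        refine lintegral_mono fun τ => ?_
        simp only [enorm_mul (v τ)]
        have hτ : Measurable fun ξ => M τ ξ * g ξ :=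
          (hMm.comp (measurable_const.prodMk measurable_id)).mul hg
        rw [lintegral_const_mul _ hτ.enorm]
        calc _ ≤ ‖v τ‖ₑ * (ENNReal.ofReal C * kapInt g τ) :=
              mul_le_mul_right (lintegral_enorm_mul_le_kapInt hC hb hg τ) _
          _ = _ := by ring
    _ = ENNReal.ofReal C * ∫⁻ τ, ‖v τ‖ₑ * kapInt g τ :=
        lintegral_const_mul _ (hv.enorm.mul (measurable_kapInt hg))
    _ < ∞ := ENNReal.mul_lt_top ENNReal.ofReal_lt_top
        (lintegral_enorm_mul_lt_top hv2 (measurable_kapInt hg)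
          ((hB g hg).trans_lt (ENNReal.mul_lt_top ENNReal.ofReal_lt_top hg2.2)))

/-- The constant `B` does not depend on the kernel `M`, only on the model kernel. The almost
everywhere integrability is part of the conclusion because continuity in `x` requires subtracting
two such integrals. -/
theorem exists_kap_operator_bound : ∃ B : ℝ, 0 ≤ B ∧ ∀ (M : ℝ → ℝ → ℂ) (C : ℝ) (g : ℝ → ℂ),
    Measurable (Function.uncurry M) → 0 ≤ C → (∀ τ ξ, ‖M τ ξ‖ ≤ C * kap τ ξ) → Measurable g →
    MemLp g 2 volume →
    (∀ᵐ τ, Integrable (fun ξ => M τ ξ * g ξ) volume) ∧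
    MemLp (fun τ => ∫ ξ, M τ ξ * g ξ) 2 volume ∧
    eLpNorm (fun τ => ∫ ξ, M τ ξ * g ξ) 2 volume ≤
      ENNReal.ofReal (C * B) * eLpNorm g 2 volume := by
  obtain ⟨B, hB, H⟩ := exists_eLpNorm_kapInt_le
  refine ⟨B, hB, fun M C g hM hC hb hg hg2 => ?_⟩
  have hMm : Measurable fun z : ℝ × ℝ => M z.1 z.2 := hM
  have hN2 : eLpNorm (kapInt g) 2 volume < ∞ :=
    (H g hg).trans_lt (ENNReal.mul_lt_top ENNReal.ofReal_lt_top hg2.2)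
  have hle := lintegral_enorm_mul_le_kapInt hC hb hg
  have hNfin : ∀ᵐ τ, kapInt g τ < ∞ := by
    rw [eLpNorm_lt_top_iff_lintegral_rpow_enorm_lt_top (by norm_num) (by norm_num)] at hN2
    have hNm := measurable_kapInt hg
    filter_upwards [ae_lt_top (by fun_prop) hN2.ne] with τ hτ
    simpa using hτ
  have hTm : StronglyMeasurable fun τ => ∫ ξ, M τ ξ * g ξ := by
    have : StronglyMeasurable (Function.uncurry fun τ ξ => M τ ξ * g ξ) :=
      (hMm.mul (hg.comp measurable_snd)).stronglyMeasurable
    exact this.integral_prod_right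
  have hTb : eLpNorm (fun τ => ∫ ξ, M τ ξ * g ξ) 2 volume ≤
      ENNReal.ofReal (C * B) * eLpNorm g 2 volume := by
    rw [ENNReal.ofReal_mul hC, mul_assoc]
    refine (?_ : _ ≤ ENNReal.ofReal C * eLpNorm (kapInt g) 2 volume).trans
      (mul_le_mul_right (H g hg) _)
    refine eLpNorm_le_mul_eLpNorm_of_ae_le_mul' (c := C.toNNReal)
      (Filter.Eventually.of_forall fun τ => ?_) 2
    rw [enorm_eq_self]
    exact (enorm_integral_le_lintegral_enorm _).trans (hle τ)
  refine ⟨?_, ⟨hTm.aestronglyMeasurable, hTb.trans_lt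
    (ENNReal.mul_lt_top ENNReal.ofReal_lt_top hg2.2)⟩, hTb⟩
  filter_upwards [hNfin] with τ hτ
  exact ⟨((hMm.comp (measurable_const.prodMk measurable_id)).mul hg).aestronglyMeasurable,
    (hle τ).trans_lt (ENNReal.mul_lt_top ENNReal.ofReal_lt_top hτ)⟩

theorem integral_fourier_mul_fourierInv {f : ℝ → ℂ} (hf : Integrable f volume) (η : 𝓢(ℝ, ℂ)) :
    ∫ τ, 𝓕 f τ * (𝓕⁻ η : 𝓢(ℝ, ℂ)) τ = ∫ t, f t * η t := by
  have h := VectorFourier.integral_fourierIntegral_smul_eq_flip (μ := volume) (ν := volume)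
    (L := innerₗ ℝ) (e := Real.fourierChar) (f := f) (g := ⇑(𝓕⁻ η : 𝓢(ℝ, ℂ)))
    Real.continuous_fourierChar (by fun_prop) hf (𝓕⁻ η : 𝓢(ℝ, ℂ)).integrable
  simp only [smul_eq_mul, flip_innerₗ] at h
  have h2 : 𝓕 (⇑(𝓕⁻ η : 𝓢(ℝ, ℂ))) = η := by
    rw [← SchwartzMap.fourier_coe, fourier_fourierInv_eq]
  calc _ = _ := h
    _ = ∫ t, f t * 𝓕 (⇑(𝓕⁻ η : 𝓢(ℝ, ℂ))) t := rfl
    _ = _ := by rw [h2]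

/-- The oscillating factor of the Fourier inversion formula. -/
def osc (x ξ : ℝ) : ℂ := Complex.exp ((2 * Real.pi * x * ξ : ℝ) * Complex.I)

theorem norm_osc (x ξ : ℝ) : ‖osc x ξ‖ = 1 := Complex.norm_exp_ofReal_mul_I _

theorem continuous_osc_left (ξ : ℝ) : Continuous fun x => osc x ξ := by unfold osc; fun_prop

theorem continuous_osc (x : ℝ) : Continuous (osc x) := by unfold osc; fun_prop

theorem memLp_osc_mul (x : ℝ) {g : ℝ → ℂ} (hg : MemLp g 2 volume) :
    MemLp (fun ξ => osc x ξ * g ξ) 2 volume :=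
  hg.congr_norm ((continuous_osc x).aestronglyMeasurable.mul hg.1)
    (Filter.Eventually.of_forall fun ξ => by simp [norm_osc])

theorem eLpNorm_osc_mul (x : ℝ) (g : ℝ → ℂ) :
    eLpNorm (fun ξ => osc x ξ * g ξ) 2 volume = eLpNorm g 2 volume :=
  eLpNorm_congr_norm_ae (Filter.Eventually.of_forall fun ξ => by simp [norm_osc])

/-- The trace attached to a family `m ξ` of functions of time, whose Fourier transforms are
majorized by the kernel `kap`. -/
theorem exists_trace (r s T : ℝ) (k : ℕ) {m : ℝ → ℝ → ℂ} (hm : Measurable (Function.uncurry m))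
    (hmi : ∀ ξ, Integrable (m ξ) volume) {C : ℝ} (hC : 0 ≤ C)
    (hb : ∀ τ ξ, (1 + τ ^ 2) ^ (r / 2) * ‖𝓕 (m ξ) τ‖ * ((2 * Real.pi * |ξ|) ^ k *
      (1 + ξ ^ 2) ^ (-s / 2)) ≤ C * kap τ ξ) :
    ∃ C' : ℝ, 0 ≤ C' ∧ ∀ φ : SobolevSpace s, ∃ h : ℝ → SobolevInterval r T, Continuous h ∧
      (∀ x, ‖h x‖ ≤ C' * ‖φ‖) ∧ ∀ η : IntervalTest T,
        Integrable (fun ξ => (∫ t, m ξ t * η.1 t) * ((2 * Real.pi * Complex.I * ξ) ^ k *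
          (((1 + ξ ^ 2) ^ (-s / 2) : ℝ) : ℂ) * hat φ ξ)) volume ∧
        ∀ x, pairing (h x) η = ∫ ξ, osc x ξ * ((∫ t, m ξ t * η.1 t) *
          ((2 * Real.pi * Complex.I * ξ) ^ k *
            (((1 + ξ ^ 2) ^ (-s / 2) : ℝ) : ℂ) * hat φ ξ)) := by
  obtain ⟨B, hB, H⟩ := exists_kap_operator_bound
  refine ⟨C * B, by positivity, fun φ => ?_⟩
  set g : ℝ → ℂ := ⇑(hat φ) with hg
  have hgm : Measurable g := (Lp.stronglyMeasurable (hat φ)).measurable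
  have hg2 : MemLp g 2 volume := Lp.memLp _
  set S : ℝ → ℂ := fun ξ => (2 * Real.pi * Complex.I * ξ) ^ k * (((1 + ξ ^ 2) ^ (-s / 2) : ℝ) : ℂ)
    with hS
  have hSm : Measurable S := by fun_prop
  have hSn : ∀ ξ, ‖S ξ‖ = (2 * Real.pi * |ξ|) ^ k * (1 + ξ ^ 2) ^ (-s / 2) := fun ξ => by
    rw [hS, norm_mul, norm_pow, Complex.norm_real, Real.norm_of_nonneg (by positivity)]
    simp [abs_of_pos Real.pi_pos]
  have hFm : Measurable fun z : ℝ × ℝ => 𝓕 (m z.2) z.1 := by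
    have h1 : StronglyMeasurable (Function.uncurry fun (z : ℝ × ℝ) (t : ℝ) =>
        Complex.exp ((-2 * Real.pi * (t * z.1) : ℝ) * Complex.I) * m z.2 t) := by
      apply Measurable.stronglyMeasurable
      have h2 : Measurable fun y : (ℝ × ℝ) × ℝ => m y.1.2 y.2 :=
        hm.comp ((measurable_snd.comp measurable_fst).prodMk measurable_snd)
      exact Measurable.mul (by fun_prop) h2
    have h4 := (h1.integral_prod_right (ν := volume)).measurable
    have e : (fun z : ℝ × ℝ => 𝓕 (m z.2) z.1) = fun z =>
        ∫ t, Complex.exp ((-2 * Real.pi * (t * z.1) : ℝ) * Complex.I) * m z.2 t := by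
      funext z
      refine (Real.fourier_real_eq_integral_exp_smul _ _).trans
        (integral_congr_ae (Filter.Eventually.of_forall fun t => ?_))
      simp only [smul_eq_mul, mul_assoc]
    rw [e]
    exact h4
  -- The weighted time transform of the trace at `x` will be `∫ M(τ,ξ) exp(2πixξ) g(ξ) dξ`.
  set M : ℝ → ℝ → ℂ := fun τ ξ => (((1 + τ ^ 2) ^ (r / 2) : ℝ) : ℂ) * 𝓕 (m ξ) τ * S ξ with hM
  have hMm : Measurable (Function.uncurry M) := by
    refine (Measurable.mul ?_ hFm).mul (hSm.comp measurable_snd)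
    fun_prop
  have hMb : ∀ τ ξ, ‖M τ ξ‖ ≤ C * kap τ ξ := fun τ ξ => by
    rw [hM, norm_mul, norm_mul, hSn, Complex.norm_real, Real.norm_of_nonneg (by positivity)]
    exact hb τ ξ
  have hom : ∀ x, Measurable fun ξ => osc x ξ * g ξ := fun x =>
    (continuous_osc x).measurable.mul hgm
  have ho2 : ∀ x, MemLp (fun ξ => osc x ξ * g ξ) 2 volume := fun x => memLp_osc_mul x hg2
  set f : ℝ → ℝ → ℂ := fun x τ => ∫ ξ, M τ ξ * (osc x ξ * g ξ) with hf
  have hfL : ∀ x, MemLp (f x) 2 volume := fun x =>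
    (H M C _ hMm hC hMb (hom x) (ho2 x)).2.1
  refine ⟨fun x => Submodule.Quotient.mk (ofFun r (f x)), ?_, fun x => ?_, fun η => ?_⟩
  -- Continuity in `x` of the modulated function `exp(2πixξ) g` holds in `L²` by dominated
  -- convergence, and the operator with kernel `M` preserves it.
  · have hcont : Continuous fun x => ofFun r (f x) := by
      rw [continuous_iff_continuousAt]
      intro x₀
      rw [ContinuousAt, tendsto_iff_norm_sub_tendsto_zero]
      have hd := tendsto_eLpNorm_sub (l := nhds x₀) (f := fun x ξ => osc x ξ * g ξ)
        (f0 := fun ξ => osc x₀ ξ * g ξ) hg2.norm (fun x => (ho2 x).1) (ho2 x₀).1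
        (Filter.Eventually.of_forall fun x => Filter.Eventually.of_forall fun ξ => by
          simp [norm_osc]) (Filter.Eventually.of_forall fun ξ => by simp [norm_osc])
        (Filter.Eventually.of_forall fun ξ =>
          ((continuous_osc_left ξ).tendsto x₀).mul_const (g ξ))
      have hd2 : Filter.Tendsto (fun x => ENNReal.ofReal (C * B) *
          eLpNorm ((fun ξ => osc x ξ * g ξ) - fun ξ => osc x₀ ξ * g ξ) 2 volume)
          (nhds x₀) (nhds 0) := by
        have := ENNReal.Tendsto.const_mul (a := ENNReal.ofReal (C * B)) hd
          (Or.inr ENNReal.ofReal_ne_top)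
        simpa using this
      have hd3 : Filter.Tendsto (fun x => ‖ofFun r (f x) - ofFun r (f x₀)‖ₑ) (nhds x₀)
          (nhds 0) := by
        refine tendsto_of_tendsto_of_tendsto_of_le_of_le tendsto_const_nhds hd2
          (fun _ => zero_le) fun x => ?_
        beta_reduce
        rw [ofFun_sub (hfL x) (hfL x₀), enorm_ofFun ((hfL x).sub (hfL x₀))]
        refine le_trans (le_of_eq ?_) (H M C _ hMm hC hMb ((hom x).sub (hom x₀))
          ((ho2 x).sub (ho2 x₀))).2.2
        refine eLpNorm_congr_ae ?_
        filter_upwards [(H M C _ hMm hC hMb (hom x) (ho2 x)).1,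
          (H M C _ hMm hC hMb (hom x₀) (ho2 x₀)).1] with τ h1 h2
        rw [Pi.sub_apply, hf, ← integral_sub h1 h2]
        simp only [Pi.sub_apply, mul_sub]
      have hd4 := (ENNReal.tendsto_toReal ENNReal.zero_ne_top).comp hd3
      simpa [Function.comp_def] using hd4
    exact continuous_quot_mk.comp hcont
  · refine (Submodule.Quotient.norm_mk_le _ _).trans ?_
    refine norm_ofFun_le (hfL x) (by positivity) ?_
    refine (H M C _ hMm hC hMb (hom x) (ho2 x)).2.2.trans_eq ?_
    rw [eLpNorm_osc_mul, hg, eLpNorm_hat, ← ENNReal.ofReal_mul (by positivity)]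
  · set v : ℝ → ℂ := fun τ => (((1 + τ ^ 2) ^ (-r / 2) : ℝ) : ℂ) * (𝓕⁻ η.1 : 𝓢(ℝ, ℂ)) τ with hv
    have hv2 : MemLp v 2 volume := by
      have := memLp_weight_fourierInv 0 (-r / 2) η.1 2
      simpa using this
    have hvm : Measurable v := by
      have : Measurable (𝓕⁻ η.1 : 𝓢(ℝ, ℂ)) := (𝓕⁻ η.1 : 𝓢(ℝ, ℂ)).continuous.measurable
      fun_prop
    -- The weights `⟨τ⟩^{r}` and `⟨τ⟩^{-r}` cancel, and the multiplication formula for the Fourier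
    -- transform turns the `τ` integral back into a pairing in `t`.
    have inner : ∀ x ξ, ∫ τ, v τ * (M τ ξ * (osc x ξ * g ξ)) =
        osc x ξ * ((∫ t, m ξ t * η.1 t) * (S ξ * g ξ)) := by
      intro x ξ
      rw [← integral_fourier_mul_fourierInv (hmi ξ) η.1]
      have e : ∀ τ, v τ * (M τ ξ * (osc x ξ * g ξ)) =
          𝓕 (m ξ) τ * (𝓕⁻ η.1 : 𝓢(ℝ, ℂ)) τ * (osc x ξ * (S ξ * g ξ)) := by
        intro τ
        have h1 : (((1 + τ ^ 2) ^ (-r / 2) : ℝ) : ℂ) * (((1 + τ ^ 2) ^ (r / 2) : ℝ) : ℂ) = 1 := by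
          rw [← Complex.ofReal_mul, ← Real.rpow_add (by positivity)]
          ring_nf; simp
        calc _ = ((((1 + τ ^ 2) ^ (-r / 2) : ℝ) : ℂ) * (((1 + τ ^ 2) ^ (r / 2) : ℝ) : ℂ)) *
              (𝓕 (m ξ) τ * (𝓕⁻ η.1 : 𝓢(ℝ, ℂ)) τ * (osc x ξ * (S ξ * g ξ))) := by rw [hv, hM]; ring
          _ = _ := by rw [h1, one_mul]
      simp only [e]
      rw [integral_mul_const]
      ring
    have hprod : ∀ x, Integrable (fun z : ℝ × ℝ => v z.1 * (M z.1 z.2 * (osc x z.2 * g z.2)))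
        (volume.prod volume) := fun x =>
      integrable_prod_of_le_kap (M := M) (g := fun ξ => osc x ξ * g ξ) (v := v) hMm hC hMb
        (hom x) (ho2 x) hvm hv2
    constructor
    -- At `x = 0` the oscillating factor is `1`, so Fubini there gives the integrability of the
    -- unmodulated function.
    · have h : Integrable (fun ξ => ∫ τ, v τ * (M τ ξ * (osc 0 ξ * g ξ))) volume :=
        (hprod 0).integral_prod_right
      refine h.congr (Filter.Eventually.of_forall fun ξ => ?_)
      have h1 : osc 0 ξ = 1 := by simp [osc]
      beta_reduce
      rw [inner, h1, one_mul]
    · intro x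
      rw [pairing_mk, toDistr_ofFun (hfL x)]
      calc _ = ∫ τ, ∫ ξ, v τ * (M τ ξ * (osc x ξ * g ξ)) := by
            refine integral_congr_ae (Filter.Eventually.of_forall fun τ => ?_)
            beta_reduce
            rw [integral_const_mul]
        _ = ∫ ξ, ∫ τ, v τ * (M τ ξ * (osc x ξ * g ξ)) := integral_integral_swap (hprod x)
        _ = _ := by simp only [inner, hS]

end LinearKS

end

/-! ### The symbol and its comparison with `⟨ξ⟩⁴` and `⟨τ⟩` -/

noncomputable section

namespace LinearKS

open FourierTransform
open scoped ContDiff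

/-- The symbol of `∂_x⁴ + δ ∂_x³`. -/
def symb (δ ξ : ℝ) : ℂ := (2 * Real.pi * Complex.I * ξ) ^ 4 + δ * (2 * Real.pi * Complex.I * ξ) ^ 3

theorem symb_eq (δ ξ : ℝ) :
    symb δ ξ = ((2 * Real.pi * ξ) ^ 4 : ℝ) +
      ((-δ * (2 * Real.pi * ξ) ^ 3 : ℝ) : ℂ) * Complex.I := by
  unfold symb
  have h4 : Complex.I ^ 4 = 1 := Complex.I_pow_four
  have h3 : Complex.I ^ 3 = -Complex.I := Complex.I_pow_three
  push_cast
  linear_combination (16 * (Real.pi : ℂ) ^ 4 * ξ ^ 4) * h4 +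
    (8 * δ * (Real.pi : ℂ) ^ 3 * ξ ^ 3) * h3

theorem symb_re (δ ξ : ℝ) : (symb δ ξ).re = (2 * Real.pi * ξ) ^ 4 := by
  rw [symb_eq, Complex.add_re, Complex.ofReal_re, Complex.re_ofReal_mul, Complex.I_re]; ring

theorem symb_re_nonneg (δ ξ : ℝ) : 0 ≤ (symb δ ξ).re := by
  rw [symb_re]; exact Even.pow_nonneg (by decide) _

theorem continuous_symb (δ : ℝ) : Continuous (symb δ) := by unfold symb; fun_prop

theorem norm_symb_le (δ ξ : ℝ) :
    ‖symb δ ξ‖ ≤ |2 * Real.pi * ξ| ^ 4 + |δ| * |2 * Real.pi * ξ| ^ 3 := by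
  rw [symb_eq]
  refine (norm_add_le _ _).trans ?_
  rw [norm_mul, Complex.norm_I, Complex.norm_real, Complex.norm_real]
  simp [abs_mul]

/-- The weight `⟨ξ⟩⁴`. -/
def freqWeight (ξ : ℝ) : ℝ := (1 + ξ ^ 2) ^ 2

/-- The weight `⟨τ⟩`. -/
def timeWeight (τ : ℝ) : ℝ := √(1 + τ ^ 2)

theorem one_le_freqWeight (ξ : ℝ) : 1 ≤ freqWeight ξ :=
  one_le_pow₀ (by nlinarith [sq_nonneg ξ])

theorem one_le_timeWeight (τ : ℝ) : 1 ≤ timeWeight τ :=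
  Real.one_le_sqrt.mpr (by nlinarith [sq_nonneg τ])

theorem abs_le_timeWeight (τ : ℝ) : |τ| ≤ timeWeight τ := Real.abs_le_sqrt (by linarith)

theorem timeWeight_le (τ : ℝ) : timeWeight τ ≤ 1 + |τ| := by
  rw [timeWeight, Real.sqrt_le_left (by positivity)]
  nlinarith [abs_nonneg τ, sq_abs τ]

theorem freqWeight_pos (ξ : ℝ) : 0 < freqWeight ξ := one_pos.trans_le (one_le_freqWeight ξ)

theorem timeWeight_pos (τ : ℝ) : 0 < timeWeight τ := one_pos.trans_le (one_le_timeWeight τ)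

theorem timeWeight_rpow (τ r : ℝ) : (1 + τ ^ 2) ^ (r / 2) = timeWeight τ ^ r := by
  rw [timeWeight, Real.sqrt_eq_rpow, ← Real.rpow_mul (by positivity)]
  ring_nf

theorem freqWeight_rpow (ξ r : ℝ) : (1 + ξ ^ 2) ^ (2 * r) = freqWeight ξ ^ r := by
  rw [Real.rpow_mul (by positivity), freqWeight, Real.rpow_two]

theorem kap_eq (τ ξ : ℝ) : kap τ ξ = (freqWeight ξ ^ (3 / 8 : ℝ) + timeWeight τ ^ (3 / 8 : ℝ)) /
    (freqWeight ξ + timeWeight τ) := by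
  rw [kap, ← freqWeight_rpow, ← timeWeight_rpow, freqWeight, timeWeight, Real.sqrt_eq_rpow]
  norm_num

theorem freqWeight_le_of_one_lt {ξ : ℝ} (h : 1 < |ξ|) (δ : ℝ) : freqWeight ξ ≤ (symb δ ξ).re := by
  rw [symb_re, freqWeight]
  have h1 : 1 ≤ ξ ^ 2 := by rw [← sq_abs]; nlinarith
  have h2 : (3 : ℝ) ≤ Real.pi := Real.pi_gt_three.le
  have h3 : 9 ≤ Real.pi ^ 2 := by nlinarith
  have h4 : 1 + ξ ^ 2 ≤ (2 * Real.pi * ξ) ^ 2 := by nlinarith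
  calc (1 + ξ ^ 2) ^ 2 ≤ ((2 * Real.pi * ξ) ^ 2) ^ 2 := by gcongr
    _ = _ := by ring

theorem symb_re_le (δ ξ : ℝ) : (symb δ ξ).re ≤ (2 * Real.pi) ^ 4 * freqWeight ξ := by
  rw [symb_re, freqWeight, mul_pow]
  gcongr
  nlinarith [sq_nonneg ξ]

theorem norm_symb_le_of_one_lt {ξ : ℝ} (h : 1 < |ξ|) (δ : ℝ) :
    ‖symb δ ξ‖ ≤ (1 + |δ|) * (symb δ ξ).re := by
  refine (norm_symb_le δ ξ).trans ?_
  rw [symb_re, ← abs_of_nonneg (Even.pow_nonneg (by decide) _ : 0 ≤ (2 * Real.pi * ξ) ^ 4), abs_pow]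
  have h1 : 1 ≤ |2 * Real.pi * ξ| := by
    rw [abs_mul, abs_of_pos (by positivity)]
    nlinarith [Real.pi_gt_three]
  have h2 : |2 * Real.pi * ξ| ^ 3 ≤ |2 * Real.pi * ξ| ^ 4 := pow_le_pow_right₀ h1 (by norm_num)
  nlinarith [abs_nonneg δ]

theorem norm_symb_le_of_le_one {ξ : ℝ} (h : |ξ| ≤ 1) (δ : ℝ) :
    ‖symb δ ξ‖ ≤ (2 * Real.pi) ^ 4 + |δ| * (2 * Real.pi) ^ 3 := by
  refine (norm_symb_le δ ξ).trans ?_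
  have h1 : |2 * Real.pi * ξ| ≤ 2 * Real.pi := by
    rw [abs_mul, abs_of_pos (by positivity)]
    exact mul_le_of_le_one_right (by positivity) h
  gcongr

theorem freqWeight_le_four {ξ : ℝ} (h : |ξ| ≤ 1) : freqWeight ξ ≤ 4 := by
  have h1 : ξ ^ 2 ≤ 1 := by rw [← sq_abs]; nlinarith [abs_nonneg ξ]
  rw [freqWeight]; nlinarith [sq_nonneg ξ]

/-- Lower bound for `c a ± 2πiτ`. -/
theorem weight_add_le_norm {ξ : ℝ} (h : 1 < |ξ|) (δ : ℝ) {c : ℝ} (hc : 1 ≤ c) (τ : ℝ) {ε : ℝ}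
    (hε : |ε| = 1) : freqWeight ξ + timeWeight τ ≤
      (3 + c * (1 + |δ|)) * ‖c * symb δ ξ + (ε * (2 * Real.pi * τ) : ℝ) * Complex.I‖ := by
  set a := symb δ ξ
  set D := ‖c * a + (ε * (2 * Real.pi * τ) : ℝ) * Complex.I‖
  have hX := freqWeight_le_of_one_lt h δ
  have hX1 := one_le_freqWeight ξ
  have hre : c * a.re ≤ D := by
    refine le_trans (le_of_eq ?_) (Complex.re_le_norm _)
    rw [Complex.add_re, Complex.re_ofReal_mul, Complex.re_ofReal_mul, Complex.I_re]; ring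
  have hXD : a.re ≤ D := le_trans (by nlinarith [symb_re_nonneg δ ξ]) hre
  have hn := norm_symb_le_of_one_lt h δ
  -- The imaginary part of `c a` may cancel `2πτ`, but it is bounded by a multiple of `Re a`, which
  -- the real part of the sum already controls.
  have hτ : |τ| ≤ D + c * ((1 + |δ|) * a.re) := by
    have h1 : ‖((ε * (2 * Real.pi * τ) : ℝ) : ℂ) * Complex.I‖ ≤ D + ‖c * a‖ := by
      have := norm_sub_le (c * a + (ε * (2 * Real.pi * τ) : ℝ) * Complex.I) (c * a)
      rwa [add_sub_cancel_left] at this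
    rw [norm_mul, norm_mul, Complex.norm_I, Complex.norm_real, Complex.norm_real, Real.norm_eq_abs,
      Real.norm_eq_abs, abs_mul, hε, abs_mul, abs_of_pos (by positivity : 0 < 2 * Real.pi),
      abs_of_pos (by linarith : 0 < c)] at h1
    have h2 : |τ| ≤ 2 * Real.pi * |τ| := by nlinarith [Real.pi_gt_three, abs_nonneg τ]
    have h3 : c * ‖a‖ ≤ c * ((1 + |δ|) * a.re) := by gcongr
    linarith
  have h4 : c * ((1 + |δ|) * a.re) ≤ c * (1 + |δ|) * D := by
    rw [mul_assoc]; gcongr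
  have := timeWeight_le τ
  nlinarith

/-! ### Decay of the Fourier transform for bounded frequencies -/

theorem hasDerivAt_mul_exp {f : ℝ → ℂ} (hf : Differentiable ℝ f) (a : ℂ) (t : ℝ) :
    HasDerivAt (fun t : ℝ => f t * Complex.exp (-(t * a)))
      (deriv f t * Complex.exp (-(t * a)) - a * (f t * Complex.exp (-(t * a)))) t := by
  have h1 : HasDerivAt (fun t : ℝ => Complex.exp (-(t * a)))
      (Complex.exp (-(t * a)) * (-(1 * a))) t :=
    (((hasDerivAt_id t).ofReal_comp.mul_const a).neg).cexp
  refine ((hf t).hasDerivAt.mul h1).congr_deriv ?_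
  ring

theorem fourier_sub_smul_apply {f g : ℝ → ℂ} (hf : Integrable f volume) (hg : Integrable g volume)
    (a : ℂ) (τ : ℝ) : 𝓕 (f - a • g) τ = 𝓕 f τ - a * 𝓕 g τ := by
  have h := VectorFourier.fourierIntegral_add (μ := volume) (L := innerₗ ℝ) (e := Real.fourierChar)
    Real.continuous_fourierChar (by fun_prop) hf (hg.smul (-a))
  have h2 := VectorFourier.fourierIntegral_const_smul Real.fourierChar volume (innerₗ ℝ) g (-a)
  rw [h2] at h
  have e : f - a • g = f + (-a) • g := by rw [neg_smul, sub_eq_add_neg]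
  rw [e]
  refine (congrFun h τ).trans ?_
  rw [Pi.add_apply, Pi.smul_apply, smul_eq_mul, neg_mul, ← sub_eq_add_neg]
  rfl

/-- Integration by parts: the derivative of `f exp(-ta)` is `f' exp(-ta) - a f exp(-ta)`, and its
transform is `2πiτ` times that of `f exp(-ta)`. -/
theorem fourier_mul_exp_eq {f : ℝ → ℂ} (hf : ContDiff ℝ ∞ f) (hc : HasCompactSupport f) (a : ℂ)
    (τ : ℝ) : (a + (2 * Real.pi * τ : ℝ) * Complex.I) *
      𝓕 (fun t : ℝ => f t * Complex.exp (-(t * a))) τ =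
      𝓕 (fun t : ℝ => deriv f t * Complex.exp (-(t * a))) τ := by
  have hd : Differentiable ℝ f := hf.differentiable (by simp)
  have hd' : Continuous (deriv f) := (hf.continuous_deriv (by simp))
  have he : Continuous fun t : ℝ => Complex.exp (-(t * a)) := by fun_prop
  have i1 : Integrable (fun t : ℝ => f t * Complex.exp (-(t * a))) volume :=
    (hf.continuous.mul he).integrable_of_hasCompactSupport hc.mul_right
  have i2 : Integrable (fun t : ℝ => deriv f t * Complex.exp (-(t * a))) volume :=
    (hd'.mul he).integrable_of_hasCompactSupport hc.deriv.mul_right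
  have hder : deriv (fun t : ℝ => f t * Complex.exp (-(t * a))) =
      (fun t : ℝ => deriv f t * Complex.exp (-(t * a))) -
        (a • fun t : ℝ => f t * Complex.exp (-(t * a))) :=
    funext fun t => (hasDerivAt_mul_exp hd a t).deriv
  have i3 := i2.sub (i1.smul a)
  have h := congrFun (Real.fourier_deriv i1 (fun t => (hasDerivAt_mul_exp hd a t).differentiableAt)
    (by rw [hder]; exact i3)) τ
  rw [hder, fourier_sub_smul_apply i2 i1] at h
  simp only [smul_eq_mul] at h
  push_cast
  linear_combination -h

/-- Each integration by parts replaces `f` by `f'` and gains `|a + 2πiτ|⁻¹`, which is `O(⟨τ⟩⁻¹)`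
uniformly for `Re a ≥ 1`, `|a| ≤ R`. The lower bound on `Re a` keeps the divisor away from zero. -/
theorem exists_norm_fourier_mul_exp_le (N : ℕ) {f : ℝ → ℂ} (hf : ContDiff ℝ ∞ f)
    (hc : HasCompactSupport f) (R : ℝ) : ∃ C : ℝ, 0 ≤ C ∧ ∀ a : ℂ, 1 ≤ a.re → ‖a‖ ≤ R → ∀ τ : ℝ,
      timeWeight τ ^ N * ‖𝓕 (fun t : ℝ => f t * Complex.exp (-(t * a))) τ‖ ≤ C := by
  induction N generalizing f with
  | zero =>
    have hi : Integrable (fun t : ℝ => ‖f t‖ * Real.exp (|t| * R)) volume :=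
      (hf.continuous.norm.mul (by fun_prop)).integrable_of_hasCompactSupport hc.norm.mul_right
    refine ⟨∫ t : ℝ, ‖f t‖ * Real.exp (|t| * R), integral_nonneg fun t => by positivity,
      fun a _ ha τ => ?_⟩
    rw [pow_zero, one_mul]
    refine (VectorFourier.norm_fourierIntegral_le_integral_norm _ _ _ _ _).trans ?_
    refine integral_mono_of_nonneg (Filter.Eventually.of_forall fun t => norm_nonneg _) hi
      (Filter.Eventually.of_forall fun t => ?_)
    beta_reduce
    rw [norm_mul, Complex.norm_exp]
    gcongr
    calc (-(t * a)).re ≤ ‖-(t * a)‖ := Complex.re_le_norm _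
      _ = |t| * ‖a‖ := by simp
      _ ≤ |t| * R := by gcongr
  | succ N ih =>
    have hf' : ContDiff ℝ ∞ (deriv f) := (contDiff_infty_iff_deriv.mp hf).2
    obtain ⟨C, hC, h⟩ := ih hf' hc.deriv
    refine ⟨(2 + |R|) * C, by positivity, fun a ha haR τ => ?_⟩
    set D := ‖a + (2 * Real.pi * τ : ℝ) * Complex.I‖ with hD
    have hD1 : 1 ≤ D := by
      refine le_trans (le_of_eq_of_le ?_ ha) (?_ : a.re ≤ D)
      · rfl
      · refine le_trans (le_of_eq ?_) (Complex.re_le_norm _)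
        rw [Complex.add_re, Complex.re_ofReal_mul, Complex.I_re]; ring
    have hτ : timeWeight τ ≤ (2 + |R|) * D := by
      have h1 : ‖((2 * Real.pi * τ : ℝ) : ℂ) * Complex.I‖ ≤ D + ‖a‖ := by
        have := norm_sub_le (a + (2 * Real.pi * τ : ℝ) * Complex.I) a
        rwa [add_sub_cancel_left] at this
      rw [norm_mul, Complex.norm_I, Complex.norm_real, Real.norm_eq_abs, abs_mul,
        abs_of_pos (by positivity : 0 < 2 * Real.pi)] at h1
      have h2 : |τ| ≤ 2 * Real.pi * |τ| := by nlinarith [Real.pi_gt_three, abs_nonneg τ]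
      have h3 := timeWeight_le τ
      have h4 := le_abs_self R
      nlinarith [abs_nonneg R]
    have key := h a ha haR τ
    rw [← fourier_mul_exp_eq hf hc, norm_mul, ← hD] at key
    have hpos : 0 ≤ timeWeight τ ^ N := (pow_pos (timeWeight_pos τ) N).le
    calc _ = timeWeight τ * (timeWeight τ ^ N *
          ‖𝓕 (fun t : ℝ => f t * Complex.exp (-(t * a))) τ‖) := by
          ring
      _ ≤ (2 + |R|) * D * (timeWeight τ ^ N *
          ‖𝓕 (fun t : ℝ => f t * Complex.exp (-(t * a))) τ‖) := by
          gcongr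
      _ = (2 + |R|) * (timeWeight τ ^ N *
          (D * ‖𝓕 (fun t : ℝ => f t * Complex.exp (-(t * a))) τ‖)) := by
          ring
      _ ≤ _ := by gcongr

/-! ### A partial fraction expansion -/

/-- Lagrange interpolation of `zᴺ` at the `2N+1` nodes `-1, 1, …, 2N` is exact, and dividing by the
nodal polynomial yields a partial fraction expansion of the right-hand side. The degree gap gives
decay `z^{-N-1}`, while the zero of order `N` at the origin is kept. -/
theorem exists_partial_fraction (N : ℕ) : ∃ (c : ℕ → ℂ) (B : ℂ), ∀ z : ℂ, z ≠ -1 →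
    (∀ j ∈ Finset.range (2 * N), z ≠ j + 1) →
    1 / (1 + z) + ∑ j ∈ Finset.range (2 * N), c j / ((j + 1 : ℂ) - z) =
      B * z ^ N / ((1 + z) * ∏ j ∈ Finset.range (2 * N), ((j + 1 : ℂ) - z)) := by
  -- Index `0` carries the node `-1`, index `i ≥ 1` the node `i`.
  set v : ℕ → ℂ := fun i => if i = 0 then -1 else i with hv
  set s := Finset.range (2 * N + 1)
  have hinj : Set.InjOn v s := by
    intro i _ j _ hij
    simp only [hv] at hij
    have aux : ∀ n : ℕ, (-1 : ℂ) ≠ n := fun n h => by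
      have := congrArg Complex.re h
      simp at this
      have h2 : (0 : ℝ) ≤ n := Nat.cast_nonneg n
      linarith
    split_ifs at hij with h1 h2 h2
    · rw [h1, h2]
    · exact (aux _ hij).elim
    · exact (aux _ hij.symm).elim
    · exact_mod_cast hij
  set W := Lagrange.nodalWeight s v
  have hW0 : W 0 ≠ 0 := Lagrange.nodalWeight_ne_zero hinj (by simp [s])
  have hX : (Polynomial.X ^ N : Polynomial ℂ) = Lagrange.interpolate s v fun i => v i ^ N := by
    have := Lagrange.eq_interpolate (f := (Polynomial.X ^ N : Polynomial ℂ)) hinj (by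
      rw [Polynomial.degree_X_pow, Finset.card_range]
      exact_mod_cast (by omega : N < 2 * N + 1))
    simpa using this
  -- This normalizes the coefficient of `1/(1+z)` to one, since that term is the prescribed
  -- `exp(-at)` on `t > 0`.
  set B : ℂ := (W 0 * (-1) ^ N)⁻¹
  have hB : W 0 * (-1) ^ N * B = 1 := mul_inv_cancel₀ (mul_ne_zero hW0 (by simp))
  refine ⟨fun j => -(B * W (j + 1) * (j + 1) ^ N), B, fun z hz hj => ?_⟩
  have hne : ∀ i ∈ s, z ≠ v i := by
    intro i hi
    rcases i with _ | i
    · simpa [hv] using hz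
    · have := hj i (by simp [s] at hi ⊢; omega)
      simpa [hv] using this
  have h := Lagrange.eval_interpolate_not_at_node (fun i => v i ^ N) hne
  rw [← hX, Polynomial.eval_pow, Polynomial.eval_X, Lagrange.eval_nodal,
    Finset.prod_range_succ', Finset.sum_range_succ'] at h
  simp only [hv, Nat.add_eq_zero_iff, one_ne_zero, and_false, if_false, if_true, Nat.cast_add,
    Nat.cast_one, sub_neg_eq_add] at h
  -- The number of factors is even, so reversing each of them does not change the sign.
  have hP : ∏ j ∈ Finset.range (2 * N), (z - ((j : ℂ) + 1)) =
      ∏ j ∈ Finset.range (2 * N), (((j : ℂ) + 1) - z) := by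
    have : ∀ j ∈ Finset.range (2 * N), (z - ((j : ℂ) + 1)) = (-1) * (((j : ℂ) + 1) - z) :=
      fun j _ => by ring
    rw [Finset.prod_congr rfl this, Finset.prod_mul_distrib]
    simp
  rw [hP] at h
  set P := ∏ j ∈ Finset.range (2 * N), (((j : ℂ) + 1) - z) with hPdef
  have hP0 : P ≠ 0 := Finset.prod_ne_zero_iff.mpr fun j hj' => sub_ne_zero.mpr (hj j hj').symm
  have hz1 : 1 + z ≠ 0 := fun h => hz (by linear_combination h)
  rw [h]
  have e1 : B * (P * (z + 1) * (∑ k ∈ Finset.range (2 * N), W (k + 1) * (z - ((k : ℂ) + 1))⁻¹ *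
      ((k : ℂ) + 1) ^ N + W 0 * (z + 1)⁻¹ * (-1) ^ N)) / ((1 + z) * P) =
      B * (∑ k ∈ Finset.range (2 * N), W (k + 1) * (z - ((k : ℂ) + 1))⁻¹ *
      ((k : ℂ) + 1) ^ N) + (W 0 * (-1) ^ N * B) * (1 + z)⁻¹ := by
    rw [add_comm z 1]; field_simp
  rw [e1, hB, one_mul, one_div, add_comm, Finset.mul_sum]
  congr 1
  refine Finset.sum_congr rfl fun j hj' => ?_
  rw [← neg_sub ((j : ℂ) + 1) z, inv_neg]
  ring

/-- The function `e^{-at}` on `(0,∞)`, extended to `(-∞,0]` by a sum of exponentials. -/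
def expExtension (n : ℕ) (c : ℕ → ℂ) (a : ℂ) (t : ℝ) : ℂ :=
  if 0 < t then Complex.exp (-(t * a)) else
    ∑ j ∈ Finset.range n, c j * Complex.exp ((j + 1) * a * t)

theorem add_one_mul_re_pos {a : ℂ} (ha : 0 < a.re) (j : ℕ) : 0 < (((j : ℂ) + 1) * a).re := by
  have : (((j : ℂ) + 1) * a).re = ((j : ℝ) + 1) * a.re := by
    simp [Complex.mul_re]
  rw [this]; positivity

theorem integrable_expExtension (n : ℕ) (c : ℕ → ℂ) {a : ℂ} (ha : 0 < a.re) :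
    Integrable (expExtension n c a) volume := by
  rw [← integrableOn_univ, ← Iic_union_Ioi (a := (0 : ℝ))]
  refine IntegrableOn.union ?_ ?_
  · have h : IntegrableOn (fun t : ℝ => ∑ j ∈ Finset.range n, c j * Complex.exp ((j + 1) * a * t))
        (Iic 0) volume := integrable_finsetSum _ fun j _ =>
      (integrableOn_exp_mul_complex_Iic (add_one_mul_re_pos ha j) 0).const_mul _
    exact h.congr_fun (fun t ht => by simp [expExtension, not_lt.mpr (mem_Iic.mp ht)])
      measurableSet_Iic
  · have h : IntegrableOn (fun t : ℝ => Complex.exp (-a * t)) (Ioi 0) volume :=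
      integrableOn_exp_mul_complex_Ioi (by simpa using ha) 0
    exact h.congr_fun (fun t ht => by simp [expExtension, mem_Ioi.mp ht, mul_comm])
      measurableSet_Ioi

theorem fourier_expExtension (n : ℕ) (c : ℕ → ℂ) {a : ℂ} (ha : 0 < a.re) (τ : ℝ) :
    𝓕 (expExtension n c a) τ = 1 / (a + (2 * Real.pi * τ : ℝ) * Complex.I) +
      ∑ j ∈ Finset.range n, c j / ((j + 1) * a - (2 * Real.pi * τ : ℝ) * Complex.I) := by
  set w : ℂ := (2 * Real.pi * τ : ℝ) * Complex.I with hw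
  have hwre : w.re = 0 := by rw [hw, Complex.re_ofReal_mul, Complex.I_re, mul_zero]
  have hi := integrable_expExtension n c ha
  have e0 : ∀ t : ℝ, Complex.exp ((-2 * Real.pi * t * τ : ℝ) * Complex.I) = Complex.exp (-w * t) :=
    fun t => by rw [hw]; congr 1; push_cast; ring
  have hi2 : Integrable (fun t : ℝ => Complex.exp (-w * t) * expExtension n c a t) volume := by
    have hc : Continuous fun t : ℝ => Complex.exp (-w * t) := by fun_prop
    refine hi.mono (hc.aestronglyMeasurable.mul hi.1) (Filter.Eventually.of_forall fun t => ?_)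
    rw [norm_mul, Complex.norm_exp, Complex.mul_re]
    simp [hwre]
  rw [Real.fourier_real_eq_integral_exp_smul]
  simp only [smul_eq_mul, e0]
  rw [← intervalIntegral.integral_Iic_add_Ioi (b := 0) hi2.integrableOn hi2.integrableOn, add_comm]
  congr 1
  · have h1 : (-(a + w)).re < 0 := by rw [Complex.neg_re, Complex.add_re, hwre]; linarith
    calc _ = ∫ t in Ioi (0 : ℝ), Complex.exp (-(a + w) * t) := by
          refine setIntegral_congr_fun measurableSet_Ioi fun t ht => ?_
          simp only [expExtension, if_pos (mem_Ioi.mp ht)]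
          rw [← Complex.exp_add]; ring_nf
      _ = _ := by
          rw [integral_exp_mul_complex_Ioi h1, Complex.ofReal_zero, mul_zero, Complex.exp_zero,
            neg_div_neg_eq]
  · calc _ = ∫ t in Iic (0 : ℝ), ∑ j ∈ Finset.range n,
            c j * Complex.exp (((j + 1) * a - w) * t) := by
          refine setIntegral_congr_fun measurableSet_Iic fun t ht => ?_
          simp only [expExtension, if_neg (not_lt.mpr (mem_Iic.mp ht))]
          rw [Finset.mul_sum]
          refine Finset.sum_congr rfl fun j _ => ?_
          rw [mul_left_comm, ← Complex.exp_add]; ring_nf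
      _ = _ := by
          have h1 : ∀ j : ℕ, 0 < (((j : ℂ) + 1) * a - w).re := fun j => by
            rw [Complex.sub_re, hwre, sub_zero]; exact add_one_mul_re_pos ha j
          rw [integral_finsetSum _ fun j _ =>
            (integrableOn_exp_mul_complex_Iic (h1 j) 0).const_mul _]
          refine Finset.sum_congr rfl fun j _ => ?_
          rw [integral_const_mul, integral_exp_mul_complex_Iic (h1 j)]
          simp [div_eq_mul_inv]

/-- With `z = 2πiτ/a` the transform is `a⁻¹ B zᴺ/((1+z)∏(j+1-z))`. By `weight_add_le_norm` each of
the `2N+1` denominators is at least a multiple of `(X+Y)/|a|`. The powers of `|a|` combine to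
`|a|ᴺ`, which is `O(Xᴺ)`. -/
theorem exists_norm_fourier_expExtension_le (δ : ℝ) (N : ℕ) : ∃ (c : ℕ → ℂ) (C : ℝ), 0 ≤ C ∧
    ∀ ξ : ℝ, 1 < |ξ| → ∀ τ : ℝ, ‖𝓕 (expExtension (2 * N) c (symb δ ξ)) τ‖ ≤
      C * (freqWeight ξ ^ N * timeWeight τ ^ N / (freqWeight ξ + timeWeight τ) ^ (2 * N + 1)) := by
  obtain ⟨c, B, h⟩ := exists_partial_fraction N
  -- The constant of `weight_add_le_norm` at the largest coefficient `c = 2N+1`, so that it serves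
  -- for all factors at once.
  set K : ℝ := 3 + (2 * N + 1) * (1 + |δ|) with hK
  have hK0 : 0 < K := by positivity
  refine ⟨c, ‖B‖ * K ^ (2 * N + 1) * (2 * Real.pi) ^ N * ((1 + |δ|) * (2 * Real.pi) ^ 4) ^ N,
    by positivity, fun ξ hξ τ => ?_⟩
  have hX := freqWeight_pos ξ
  have hY := timeWeight_pos τ
  set a := symb δ ξ with ha
  set w : ℂ := (2 * Real.pi * τ : ℝ) * Complex.I with hw
  have hre : 0 < a.re := hX.trans_le (freqWeight_le_of_one_lt hξ δ)
  have ha0 : a ≠ 0 := fun h => by rw [h] at hre; simp at hre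
  have han : 0 < ‖a‖ := norm_pos_iff.mpr ha0
  have low1 : freqWeight ξ + timeWeight τ ≤ K * ‖a + w‖ := by
    have := weight_add_le_norm hξ δ (c := 1) le_rfl τ (ε := 1) (by simp)
    rw [Complex.ofReal_one, one_mul, one_mul, one_mul] at this
    refine this.trans ?_
    gcongr
    rw [hK]; nlinarith [abs_nonneg δ, (Nat.cast_nonneg N : (0 : ℝ) ≤ N)]
  have low2 : ∀ j ∈ Finset.range (2 * N),
      freqWeight ξ + timeWeight τ ≤ K * ‖((j : ℂ) + 1) * a - w‖ := by
    intro j hj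
    have hj2 : ((j : ℝ) + 1) ≤ 2 * N + 1 := by
      have : j < 2 * N := Finset.mem_range.mp hj
      have h2 : (j : ℝ) < 2 * N := by exact_mod_cast this
      linarith
    have := weight_add_le_norm hξ δ (c := (j : ℝ) + 1)
      (by linarith [(Nat.cast_nonneg j : (0 : ℝ) ≤ j)])
      τ (ε := -1) (by simp)
    have e : (((j : ℝ) + 1 : ℝ) : ℂ) * symb δ ξ + (((-1) * (2 * Real.pi * τ) : ℝ) : ℂ) * Complex.I =
        ((j : ℂ) + 1) * a - w := by rw [ha, hw]; push_cast; ring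
    rw [e] at this
    refine this.trans ?_
    gcongr
    rw [hK]; gcongr
  have hXY : 0 < freqWeight ξ + timeWeight τ := by positivity
  have ne1 : a + w ≠ 0 := fun h0 => by rw [h0, norm_zero, mul_zero] at low1; linarith
  have ne2 : ∀ j ∈ Finset.range (2 * N), ((j : ℂ) + 1) * a - w ≠ 0 := fun j hj h0 => by
    have := low2 j hj
    rw [h0, norm_zero, mul_zero] at this; linarith
  have e1 : 1 + w / a = (a + w) / a := by field_simp
  have e2 : ∀ j : ℕ, ((j : ℂ) + 1) - w / a = (((j : ℂ) + 1) * a - w) / a := fun j => by field_simp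
  have hz := h (w / a) (fun h0 => ne1 (by
      have := e1; rw [h0] at this
      rw [eq_comm, add_neg_cancel, div_eq_zero_iff] at this; exact this.resolve_right ha0))
    (fun j hj h0 => ne2 j hj (by
      have := e2 j; rw [h0] at this
      rw [eq_comm, sub_self, div_eq_zero_iff] at this; exact this.resolve_right ha0))
  have hF : 𝓕 (expExtension (2 * N) c a) τ = a⁻¹ * (B * (w / a) ^ N /
      ((1 + w / a) * ∏ j ∈ Finset.range (2 * N), ((j + 1 : ℂ) - w / a))) := by
    rw [fourier_expExtension _ _ hre, ← hw, ← hz, mul_add, Finset.mul_sum]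
    congr 1
    · rw [e1]; field_simp
    · refine Finset.sum_congr rfl fun j hj => ?_
      have := ne2 j hj
      rw [e2]; field_simp
  have hden : ((freqWeight ξ + timeWeight τ) / (K * ‖a‖)) ^ (2 * N + 1) ≤
      ‖(1 + w / a) * ∏ j ∈ Finset.range (2 * N), ((j + 1 : ℂ) - w / a)‖ := by
    rw [norm_mul, norm_prod, pow_succ']
    have b1 : (freqWeight ξ + timeWeight τ) / (K * ‖a‖) ≤ ‖1 + w / a‖ := by
      rw [e1, norm_div, div_le_div_iff₀ (by positivity) han]
      nlinarith
    have b2 : ∀ j ∈ Finset.range (2 * N),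
        (freqWeight ξ + timeWeight τ) / (K * ‖a‖) ≤ ‖(j + 1 : ℂ) - w / a‖ := fun j hj => by
      rw [e2, norm_div, div_le_div_iff₀ (by positivity) han]
      have := low2 j hj
      nlinarith
    gcongr
    calc _ = ∏ j ∈ Finset.range (2 * N), (freqWeight ξ + timeWeight τ) / (K * ‖a‖) := by
          rw [Finset.prod_const, Finset.card_range]
      _ ≤ _ := Finset.prod_le_prod (fun _ _ => by positivity) b2
  have hwn : ‖w‖ ≤ 2 * Real.pi * timeWeight τ := by
    rw [hw, norm_mul, Complex.norm_I, Complex.norm_real, Real.norm_eq_abs, abs_mul, mul_one,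
      abs_of_pos (by positivity : 0 < 2 * Real.pi)]
    gcongr
    exact abs_le_timeWeight τ
  have hna : ‖a‖ ≤ (1 + |δ|) * (2 * Real.pi) ^ 4 * freqWeight ξ := by
    refine (norm_symb_le_of_one_lt hξ δ).trans ?_
    rw [mul_assoc]
    gcongr
    exact symb_re_le δ ξ
  rw [hF, norm_mul, norm_inv, norm_div, norm_mul, norm_pow, norm_div]
  calc _ ≤ ‖a‖⁻¹ * (‖B‖ * (‖w‖ / ‖a‖) ^ N /
        ((freqWeight ξ + timeWeight τ) / (K * ‖a‖)) ^ (2 * N + 1)) := by gcongr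
    _ = ‖B‖ * K ^ (2 * N + 1) * (‖w‖ ^ N * ‖a‖ ^ N) /
        (freqWeight ξ + timeWeight τ) ^ (2 * N + 1) := by
        rw [div_pow, div_pow, mul_pow, pow_succ ‖a‖, two_mul, pow_add ‖a‖ N N]
        field_simp
    _ ≤ ‖B‖ * K ^ (2 * N + 1) * ((2 * Real.pi * timeWeight τ) ^ N *
        ((1 + |δ|) * (2 * Real.pi) ^ 4 * freqWeight ξ) ^ N) /
        (freqWeight ξ + timeWeight τ) ^ (2 * N + 1) := by gcongr
    _ = _ := by
        rw [mul_pow _ (timeWeight τ), mul_pow _ (freqWeight ξ)]; ring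

/-! ### Time extensions for the traces, and their domination by the model kernel -/

/-- The family of extensions to `ℝ` of the functions `e^{-ta}`, `t ∈ (0,T)`. -/
def traceFamily (δ : ℝ) (χ : ℝ → ℂ) (n : ℕ) (c : ℕ → ℂ) (ξ t : ℝ) : ℂ :=
  if |ξ| ≤ 1 then χ t * Complex.exp (-(t * symb δ ξ)) else expExtension n c (symb δ ξ) t

/-- For `|ξ| > 1` the exponential extension is used. For `|ξ| ≤ 1` the real part of `a` may vanish,
so the function is cut off in time instead; there `X` is bounded and only decay in `τ` is at stake.
-/
theorem exists_traceFamily (δ T : ℝ) (hT : 0 < T) (N : ℕ) : ∃ m : ℝ → ℝ → ℂ,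
    Measurable (Function.uncurry m) ∧ (∀ ξ, Integrable (m ξ) volume) ∧
    (∀ ξ, ∀ t ∈ Ioo 0 T, m ξ t = Complex.exp (-(t * symb δ ξ))) ∧
    ∃ C : ℝ, 0 ≤ C ∧ ∀ ξ τ, ‖𝓕 (m ξ) τ‖ ≤
      C * (freqWeight ξ ^ N * timeWeight τ ^ N / (freqWeight ξ + timeWeight τ) ^ (2 * N + 1)) := by
  obtain ⟨c, C₁, hC₁, h₁⟩ := exists_norm_fourier_expExtension_le δ N
  -- The ball of radius `T` about `T/2` contains `(0,T)`, so the cutoff equals one there.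
  let bump : ContDiffBump (T / 2) := ⟨T, 2 * T, hT, by linarith⟩
  set χ : ℝ → ℂ := fun t => (bump t : ℂ) with hχ
  have hχs : ContDiff ℝ ∞ χ := Complex.ofRealCLM.contDiff.comp bump.contDiff
  have hχc : HasCompactSupport χ := bump.hasCompactSupport.comp_left (g := fun x : ℝ => (x : ℂ)) rfl
  have hχ1 : ∀ t ∈ Ioo 0 T, χ t = 1 := fun t ht => by
    rw [hχ]
    simp only
    rw [bump.one_of_mem_closedBall, Complex.ofReal_one]
    rw [mem_closedBall_iff_norm, Real.norm_eq_abs, abs_le]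
    exact ⟨by linarith [ht.1], by linarith [ht.2]⟩
  -- Absorbing `exp(t)` into the cutoff replaces `a` by `a + 1`, whose real part is at least one.
  set f : ℝ → ℂ := fun t => χ t * Complex.exp t with hf
  have hfs : ContDiff ℝ ∞ f := hχs.mul (Complex.contDiff_exp.comp Complex.ofRealCLM.contDiff)
  have hfc : HasCompactSupport f := hχc.mul_right
  set R : ℝ := (2 * Real.pi) ^ 4 + |δ| * (2 * Real.pi) ^ 3 + 1
  -- For bounded `X` the target `XᴺYᴺ/(X+Y)^{2N+1}` is of size `Y^{-(N+1)}`, hence `N+1`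
  -- integrations by parts.
  obtain ⟨C₂, hC₂, h₂⟩ := exists_norm_fourier_mul_exp_le (N + 1) hfs hfc R
  have hfe : ∀ ξ t : ℝ, χ t * Complex.exp (-(t * symb δ ξ)) =
      f t * Complex.exp (-(t * (symb δ ξ + 1))) := fun ξ t => by
    rw [hf, mul_assoc, ← Complex.exp_add]; ring_nf
  have hms := continuous_symb δ
  refine ⟨traceFamily δ χ (2 * N) c, ?_, fun ξ => ?_, fun ξ t ht => ?_,
    C₁ + C₂ * 5 ^ (2 * N + 1), by positivity, fun ξ τ => ?_⟩
  · refine Measurable.ite (measurableSet_le (by fun_prop) measurable_const) ?_ ?_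
    · have := hχs.continuous
      fun_prop
    · refine Measurable.ite (measurableSet_lt measurable_const measurable_snd) ?_ ?_
      · fun_prop
      · fun_prop
  · by_cases h : |ξ| ≤ 1
    · have e : traceFamily δ χ (2 * N) c ξ = fun t => χ t * Complex.exp (-(t * symb δ ξ)) := by
        funext t; simp [traceFamily, h]
      rw [e]
      exact (hχs.continuous.mul (by fun_prop)).integrable_of_hasCompactSupport hχc.mul_right
    · have e : traceFamily δ χ (2 * N) c ξ = expExtension (2 * N) c (symb δ ξ) := by
        funext t; simp [traceFamily, h]
      rw [e]
      exact integrable_expExtension _ _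
        ((freqWeight_pos ξ).trans_le (freqWeight_le_of_one_lt (not_le.mp h) δ))
  · simp only [traceFamily, expExtension, hχ1 t ht, ht.1, if_true, one_mul, ite_self]
  · have hX := freqWeight_pos ξ
    have hY := timeWeight_pos τ
    have hX1 := one_le_freqWeight ξ
    have hY1 := one_le_timeWeight τ
    by_cases h : |ξ| ≤ 1
    · have e : traceFamily δ χ (2 * N) c ξ =
          fun t : ℝ => f t * Complex.exp (-(t * (symb δ ξ + 1))) := by
        funext t; simp [traceFamily, h, hfe]
      have hX4 := freqWeight_le_four h
      have key := h₂ (symb δ ξ + 1) (by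
          rw [Complex.add_re, Complex.one_re]; linarith [symb_re_nonneg δ ξ])
        ((norm_add_le _ _).trans (by
          rw [norm_one]; exact add_le_add_left (norm_symb_le_of_le_one h δ) 1)) τ
      rw [← e] at key
      have b : ((timeWeight τ) ^ (N + 1))⁻¹ ≤ 5 ^ (2 * N + 1) *
          (freqWeight ξ ^ N * timeWeight τ ^ N / (freqWeight ξ + timeWeight τ) ^ (2 * N + 1)) := by
        -- Here `X ≤ 4 ≤ 4Y`, which is the origin of the factor `5`.
        have b1 : (freqWeight ξ + timeWeight τ) ^ (2 * N + 1) ≤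
            (5 * timeWeight τ) ^ (2 * N + 1) := by
          gcongr; linarith
        calc _ = 5 ^ (2 * N + 1) *
              (1 ^ N * timeWeight τ ^ N / (5 * timeWeight τ) ^ (2 * N + 1)) := by
              rw [mul_pow]; field_simp; ring
          _ ≤ _ := by gcongr
      calc _ ≤ C₂ * ((timeWeight τ) ^ (N + 1))⁻¹ := by
            rw [← div_eq_mul_inv, le_div_iff₀ (by positivity), mul_comm]; exact key
        _ ≤ C₂ * (5 ^ (2 * N + 1) * (freqWeight ξ ^ N * timeWeight τ ^ N /
            (freqWeight ξ + timeWeight τ) ^ (2 * N + 1))) := by gcongr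
        _ ≤ _ := by
            rw [← mul_assoc]
            gcongr
            linarith
    · have e : traceFamily δ χ (2 * N) c ξ = expExtension (2 * N) c (symb δ ξ) := by
        funext t; simp [traceFamily, h]
      rw [e]
      refine (h₁ ξ (not_le.mp h) τ).trans ?_
      gcongr
      exact le_add_of_nonneg_right (by positivity)

theorem freq_factor_le (s : ℝ) (k : ℕ) (ξ : ℝ) : (2 * Real.pi * |ξ|) ^ k * (1 + ξ ^ 2) ^ (-s / 2) ≤
    (2 * Real.pi) ^ k * freqWeight ξ ^ ((k - s) / 4) := by
  have h : |ξ| ^ k ≤ (1 + ξ ^ 2) ^ ((k : ℝ) / 2) := by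
    have h1 := abs_le_weight ξ
    calc |ξ| ^ k ≤ ((1 + ξ ^ 2) ^ (1 / 2 : ℝ)) ^ k := by gcongr
      _ = _ := by
        rw [← Real.rpow_natCast, ← Real.rpow_mul (by positivity)]; ring_nf
  rw [← freqWeight_rpow, mul_pow, mul_assoc]
  gcongr
  calc _ ≤ (1 + ξ ^ 2) ^ ((k : ℝ) / 2) * (1 + ξ ^ 2) ^ (-s / 2) := by gcongr
    _ = _ := by rw [← Real.rpow_add (by positivity)]; ring_nf

/-- The frequency factor is `O(X^{3/8-r})`. What must be absorbed is `Y^r X^{-r}`, and since `N ± r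
≥ 0`, `Y^{N+r} X^{N-r} ≤ (X+Y)^{2N}`; there remains `X^{3/8}/(X+Y)`. -/
theorem le_kap_of_le {r s C Q : ℝ} {k N : ℕ} (hr : r = (s - k) / 4 + 3 / 8) (hN : |r| ≤ N)
    (hC : 0 ≤ C) (τ ξ : ℝ) (hQ : Q ≤ C * (freqWeight ξ ^ N * timeWeight τ ^ N /
      (freqWeight ξ + timeWeight τ) ^ (2 * N + 1))) :
    (1 + τ ^ 2) ^ (r / 2) * Q * ((2 * Real.pi * |ξ|) ^ k * (1 + ξ ^ 2) ^ (-s / 2)) ≤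
      C * (2 * Real.pi) ^ k * kap τ ξ := by
  have hX := freqWeight_pos ξ
  have hY := timeWeight_pos τ
  have hfac := freq_factor_le s k ξ
  rw [timeWeight_rpow, kap_eq]
  set X := freqWeight ξ
  set Y := timeWeight τ
  have hS : 0 < X + Y := by positivity
  have e : ((k : ℝ) - s) / 4 = 3 / 8 - r := by rw [hr]; ring
  rw [e] at hfac
  have key : Y ^ r * X ^ (-r) * (X ^ N * Y ^ N) ≤ (X + Y) ^ (2 * N) := by
    have h1 : 0 ≤ (N : ℝ) + r := by linarith [neg_abs_le r]
    have h2 : 0 ≤ (N : ℝ) - r := by linarith [le_abs_self r]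
    calc Y ^ r * X ^ (-r) * (X ^ N * Y ^ N) = Y ^ ((N : ℝ) + r) * X ^ ((N : ℝ) - r) := by
          rw [Real.rpow_add hY, sub_eq_add_neg, Real.rpow_add hX, Real.rpow_natCast,
            Real.rpow_natCast]; ring
      _ ≤ (X + Y) ^ ((N : ℝ) + r) * (X + Y) ^ ((N : ℝ) - r) := by
          gcongr <;> linarith
      _ = _ := by
          rw [← Real.rpow_add hS, ← Real.rpow_natCast]; push_cast; ring_nf
  calc _ ≤ Y ^ r * (C * (X ^ N * Y ^ N / (X + Y) ^ (2 * N + 1))) *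
        ((2 * Real.pi) ^ k * X ^ (3 / 8 - r)) := by gcongr
    _ = C * (2 * Real.pi) ^ k * X ^ (3 / 8 : ℝ) *
        ((Y ^ r * X ^ (-r) * (X ^ N * Y ^ N)) / (X + Y) ^ (2 * N + 1)) := by
        rw [sub_eq_add_neg, Real.rpow_add hX]; ring
    _ ≤ C * (2 * Real.pi) ^ k * X ^ (3 / 8 : ℝ) * ((X + Y) ^ (2 * N) / (X + Y) ^ (2 * N + 1)) := by
        gcongr
    _ = C * (2 * Real.pi) ^ k * (X ^ (3 / 8 : ℝ) / (X + Y)) := by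
        rw [pow_succ]; field_simp
    _ ≤ _ := by
        gcongr
        exact le_add_of_nonneg_right (by positivity)

/-- The factor `X^{s/4}` cancels `⟨ξ⟩^{-s}`, and `Y^{3/8-k/4} X^{k/4}` is at most the `3/8` power of
the larger of `X` and `Y`. The exponent `3/8 - k/4` is nonnegative because `k ≤ 1`. -/
theorem le_kap_of_le_weighted {s C Q : ℝ} {k : ℕ} (hk : k ≤ 1) (hC : 0 ≤ C) (τ ξ : ℝ)
    (hQ : Q ≤ C * (freqWeight ξ ^ (s / 4) / (freqWeight ξ + timeWeight τ))) :
    (1 + τ ^ 2) ^ ((-(k : ℝ) / 4 + 3 / 8) / 2) * Q *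
      ((2 * Real.pi * |ξ|) ^ k * (1 + ξ ^ 2) ^ (-s / 2)) ≤ C * (2 * Real.pi) ^ k * kap τ ξ := by
  have hX := freqWeight_pos ξ
  have hY := timeWeight_pos τ
  have hfac := freq_factor_le s k ξ
  rw [timeWeight_rpow, kap_eq]
  set X := freqWeight ξ
  set Y := timeWeight τ
  have hS : 0 < X + Y := by positivity
  have key : Y ^ (-(k : ℝ) / 4 + 3 / 8) * X ^ ((k : ℝ) / 4) ≤
      X ^ (3 / 8 : ℝ) + Y ^ (3 / 8 : ℝ) := by
    have hk' : (k : ℝ) ≤ 1 := by exact_mod_cast hk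
    have h1 : 0 ≤ -(k : ℝ) / 4 + 3 / 8 := by linarith
    rcases le_total X Y with h | h
    · calc _ ≤ Y ^ (-(k : ℝ) / 4 + 3 / 8) * Y ^ ((k : ℝ) / 4) := by gcongr
        _ = Y ^ (3 / 8 : ℝ) := by rw [← Real.rpow_add hY]; ring_nf
        _ ≤ _ := le_add_of_nonneg_left (by positivity)
    · calc _ ≤ X ^ (-(k : ℝ) / 4 + 3 / 8) * X ^ ((k : ℝ) / 4) := by gcongr
        _ = X ^ (3 / 8 : ℝ) := by rw [← Real.rpow_add hX]; ring_nf
        _ ≤ _ := le_add_of_nonneg_right (by positivity)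
  calc _ ≤ Y ^ (-(k : ℝ) / 4 + 3 / 8) * (C * (X ^ (s / 4) / (X + Y))) *
        ((2 * Real.pi) ^ k * X ^ (((k : ℝ) - s) / 4)) := by gcongr
    _ = C * (2 * Real.pi) ^ k * ((Y ^ (-(k : ℝ) / 4 + 3 / 8) * X ^ ((k : ℝ) / 4)) / (X + Y)) := by
        have : X ^ (((k : ℝ) - s) / 4) = X ^ ((k : ℝ) / 4) * (X ^ (s / 4))⁻¹ := by
          rw [sub_div, Real.rpow_sub hX, div_eq_mul_inv]
        have h0 : X ^ (s / 4) ≠ 0 := (Real.rpow_pos_of_pos hX _).ne'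
        rw [this]; field_simp
    _ ≤ _ := by gcongr

/-! ### Extensions for the weighted traces -/

/-- The functions `t^b e^{-ta}` on `(0,T)`, extended by zero to the negative half-line. -/
def weightedFamily (δ b T : ℝ) (ξ t : ℝ) : ℂ :=
  if 0 < t ∧ (1 < |ξ| ∨ t < T) then ((t ^ b : ℝ) : ℂ) * Complex.exp (-(t * symb δ ξ)) else 0

theorem measurable_weightedFamily (δ b T : ℝ) :
    Measurable (Function.uncurry (weightedFamily δ b T)) := by
  have hms := continuous_symb δ
  refine Measurable.ite ((measurableSet_lt measurable_const measurable_snd).inter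
    ((measurableSet_lt measurable_const (measurable_fst.abs)).union
      (measurableSet_lt measurable_snd measurable_const))) ?_ measurable_const
  change Measurable fun z : ℝ × ℝ => ((z.2 ^ b : ℝ) : ℂ) * Complex.exp (-(z.2 * symb δ z.1))
  fun_prop

theorem weightedFamily_of_one_lt {δ b T ξ : ℝ} (h : 1 < |ξ|) : weightedFamily δ b T ξ =
    (Ioi 0).indicator fun t : ℝ => ((t ^ b : ℝ) : ℂ) * Complex.exp (-(t * symb δ ξ)) := by
  funext t; simp [weightedFamily, h, indicator]

theorem weightedFamily_of_le_one {δ b T ξ : ℝ} (h : |ξ| ≤ 1) : weightedFamily δ b T ξ =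
    (Ioo 0 T).indicator fun t : ℝ => ((t ^ b : ℝ) : ℂ) * Complex.exp (-(t * symb δ ξ)) := by
  funext t; simp [weightedFamily, not_lt.mpr h, indicator]

theorem norm_exp_neg_mul_symb {t : ℝ} (ht : 0 ≤ t) (δ ξ : ℝ) :
    ‖Complex.exp (-(t * symb δ ξ))‖ ≤ 1 := by
  rw [Complex.norm_exp, Complex.neg_re, Complex.re_ofReal_mul, Real.exp_le_one_iff]
  have := mul_nonneg ht (symb_re_nonneg δ ξ)
  linarith

theorem integrableOn_rpow_mul_exp {b r : ℝ} (hb : -1 < b) (hr : 0 < r) :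
    IntegrableOn (fun t : ℝ => t ^ b * Real.exp (-r * t)) (Ioi 0) volume := by
  refine (integrableOn_rpow_mul_exp_neg_mul_rpow (p := 1) hb one_pos hr).congr_fun
    (fun t _ => ?_) measurableSet_Ioi
  simp only [Real.rpow_one]

theorem norm_rpow_mul_cexp {t : ℝ} (ht : 0 < t) (b : ℝ) (c : ℂ) :
    ‖((t ^ b : ℝ) : ℂ) * Complex.exp (-(t * c))‖ = t ^ b * Real.exp (-c.re * t) := by
  rw [norm_mul, Complex.norm_real, Real.norm_of_nonneg (by positivity), Complex.norm_exp,
    Complex.neg_re, Complex.re_ofReal_mul, neg_mul, mul_comm t]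

theorem integrableOn_rpow_mul_cexp {b : ℝ} (hb : -1 < b) {c : ℂ} (hc : 0 < c.re) :
    IntegrableOn (fun t : ℝ => ((t ^ b : ℝ) : ℂ) * Complex.exp (-(t * c))) (Ioi 0) volume := by
  refine (integrableOn_rpow_mul_exp hb hc).mono'
    (Measurable.aestronglyMeasurable (by fun_prop)) ?_
  filter_upwards [ae_restrict_mem measurableSet_Ioi] with t ht
  exact (norm_rpow_mul_cexp ht b c).le

theorem integrable_weightedFamily (δ : ℝ) {b T : ℝ} (hb : 0 < b) (ξ : ℝ) :
    Integrable (weightedFamily δ b T ξ) volume := by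
  by_cases h : |ξ| ≤ 1
  · rw [weightedFamily_of_le_one h, integrable_indicator_iff measurableSet_Ioo]
    refine IntegrableOn.mono_set (t := Icc 0 T) ?_ Ioo_subset_Icc_self
    refine ContinuousOn.integrableOn_Icc (Continuous.continuousOn ?_)
    have := Real.continuous_rpow_const hb.le
    fun_prop
  · rw [weightedFamily_of_one_lt (not_le.mp h), integrable_indicator_iff measurableSet_Ioi]
    exact integrableOn_rpow_mul_cexp (by linarith)
      ((freqWeight_pos ξ).trans_le (freqWeight_le_of_one_lt (not_le.mp h) δ))

theorem hasDerivAt_rpow_mul_cexp (b : ℝ) (c : ℂ) {t : ℝ} (ht : 0 < t) :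
    HasDerivAt (fun t : ℝ => ((t ^ b : ℝ) : ℂ) * Complex.exp (-(t * c)))
      (b * (((t ^ (b - 1) : ℝ) : ℂ) * Complex.exp (-(t * c))) -
        c * (((t ^ b : ℝ) : ℂ) * Complex.exp (-(t * c)))) t := by
  have h1 : HasDerivAt (fun t : ℝ => Complex.exp (-(t * c)))
      (Complex.exp (-(t * c)) * (-(1 * c))) t :=
    (((hasDerivAt_id t).ofReal_comp.mul_const c).neg).cexp
  have h2 : HasDerivAt (fun t : ℝ => ((t ^ b : ℝ) : ℂ)) ((b * t ^ (b - 1) : ℝ) : ℂ) t :=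
    (Real.hasDerivAt_rpow_const (Or.inl ht.ne')).ofReal_comp
  refine (h2.mul h1).congr_deriv ?_
  push_cast
  ring

/-- Integration by parts; the boundary term at `0` vanishes because `b > 0`, and `t^{b-1}` is still
integrable there. -/
theorem mul_integral_Ioi_rpow_mul_cexp {b : ℝ} (hb : 0 < b) {c : ℂ} (hc : 0 < c.re) :
    c * ∫ t in Ioi (0 : ℝ), ((t ^ b : ℝ) : ℂ) * Complex.exp (-(t * c)) =
      b * ∫ t in Ioi (0 : ℝ), ((t ^ (b - 1) : ℝ) : ℂ) * Complex.exp (-(t * c)) := by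
  have i1 := integrableOn_rpow_mul_cexp (b := b) (by linarith) hc
  have i2 := integrableOn_rpow_mul_cexp (b := b - 1) (by linarith) hc
  have hcont := Real.continuous_rpow_const hb.le
  have h := integral_Ioi_of_hasDerivAt_of_tendsto (m := 0)
    (f := fun t : ℝ => ((t ^ b : ℝ) : ℂ) * Complex.exp (-(t * c))) (a := 0)
    (Continuous.continuousWithinAt (by fun_prop))
    (fun t ht => hasDerivAt_rpow_mul_cexp b c ht)
    ((i2.const_mul (b : ℂ)).sub (i1.const_mul c)) (by
      rw [tendsto_zero_iff_norm_tendsto_zero]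
      refine (tendsto_rpow_mul_exp_neg_mul_atTop_nhds_zero b c.re hc).congr' ?_
      filter_upwards [Filter.eventually_gt_atTop 0] with t ht
      exact (norm_rpow_mul_cexp ht b c).symm)
  rw [integral_sub (i2.const_mul (b : ℂ)) (i1.const_mul c), integral_const_mul,
    integral_const_mul] at h
  simp only [Real.zero_rpow hb.ne', Complex.ofReal_zero, zero_mul, sub_zero] at h
  exact (sub_eq_zero.mp h).symm

theorem fourier_indicator_mul_cexp {S : Set ℝ} (hS : MeasurableSet S) (b : ℝ) (a : ℂ) (τ : ℝ) :
    𝓕 (S.indicator fun t : ℝ => ((t ^ b : ℝ) : ℂ) * Complex.exp (-(t * a))) τ =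
      ∫ t in S, ((t ^ b : ℝ) : ℂ) *
        Complex.exp (-(t * (a + (2 * Real.pi * τ : ℝ) * Complex.I))) := by
  rw [Real.fourier_real_eq_integral_exp_smul, ← integral_indicator hS]
  refine integral_congr_ae (Filter.Eventually.of_forall fun t => ?_)
  by_cases ht : t ∈ S
  · simp only [indicator_of_mem ht, smul_eq_mul]
    rw [mul_left_comm, ← Complex.exp_add]
    push_cast
    ring_nf
  · simp only [indicator_of_notMem ht, smul_zero]

/-- With `c = a + 2πiτ` and `F` the transform, integration by parts gives `|cF| ≤ bΓ(b)(Re c)^{-b}`,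
which is `O(X^{-b})`, while `|c|` is at least a multiple of `X + Y`. The weight `t^b` thus provides
exactly the factor `X^{-b}`. -/
theorem exists_norm_fourier_weightedFamily_high_le (δ T : ℝ) {b : ℝ} (hb : 0 < b) :
    ∃ C : ℝ, 0 ≤ C ∧ ∀ ξ : ℝ, 1 < |ξ| → ∀ τ : ℝ, ‖𝓕 (weightedFamily δ b T ξ) τ‖ ≤
      C * (freqWeight ξ ^ (-b) / (freqWeight ξ + timeWeight τ)) := by
  have hG : 0 < Real.Gamma b := Real.Gamma_pos_of_pos hb
  set K : ℝ := 3 + (1 + |δ|)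
  have hK : 0 < K := by positivity
  refine ⟨K * (b * Real.Gamma b), by positivity, fun ξ hξ τ => ?_⟩
  have hX := freqWeight_pos ξ
  have hY := timeWeight_pos τ
  set c : ℂ := symb δ ξ + (2 * Real.pi * τ : ℝ) * Complex.I with hc
  have hcre : c.re = (symb δ ξ).re := by
    rw [hc, Complex.add_re, Complex.re_ofReal_mul, Complex.I_re, mul_zero, add_zero]
  have hXc : freqWeight ξ ≤ c.re := hcre ▸ freqWeight_le_of_one_lt hξ δ
  have hre : 0 < c.re := hX.trans_le hXc
  have low : freqWeight ξ + timeWeight τ ≤ K * ‖c‖ := by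
    have := weight_add_le_norm hξ δ (c := 1) le_rfl τ (ε := 1) (by simp)
    rwa [Complex.ofReal_one, one_mul, one_mul, one_mul] at this
  rw [weightedFamily_of_one_lt hξ, fourier_indicator_mul_cexp measurableSet_Ioi, ← hc]
  set F := ∫ t in Ioi (0 : ℝ), ((t ^ b : ℝ) : ℂ) * Complex.exp (-(t * c))
  have h1 : ‖c‖ * ‖F‖ ≤ b * Real.Gamma b * freqWeight ξ ^ (-b) := by
    rw [← norm_mul, mul_integral_Ioi_rpow_mul_cexp hb hre, norm_mul, Complex.norm_real,
      Real.norm_of_nonneg hb.le, mul_assoc]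
    gcongr
    calc _ ≤ ∫ t in Ioi (0 : ℝ), t ^ (b - 1) * Real.exp (-(c.re * t)) := by
          refine (norm_integral_le_integral_norm _).trans_eq ?_
          refine setIntegral_congr_fun measurableSet_Ioi fun t ht => ?_
          rw [norm_rpow_mul_cexp ht, neg_mul]
      _ = (1 / c.re) ^ b * Real.Gamma b := Real.integral_rpow_mul_exp_neg_mul_Ioi hb hre
      _ = Real.Gamma b * c.re ^ (-b) := by
          rw [one_div, Real.inv_rpow hre.le, Real.rpow_neg hre.le, mul_comm]
      _ ≤ _ := by
          gcongr ?_ * ?_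
          exact Real.rpow_le_rpow_of_nonpos hX hXc (by linarith)
  have hS : 0 < freqWeight ξ + timeWeight τ := by positivity
  rw [← mul_div_assoc, le_div_iff₀ hS]
  calc _ ≤ ‖F‖ * (K * ‖c‖) := by gcongr
    _ = K * (‖c‖ * ‖F‖) := by ring
    _ ≤ K * (b * Real.Gamma b * freqWeight ξ ^ (-b)) := by gcongr
    _ = _ := by ring

theorem norm_integral_rpow_mul_cexp_le {b T : ℝ} (hT : 0 < T) (hb : -1 < b) {c : ℂ}
    (hc : 0 ≤ c.re) : ‖∫ t in (0 : ℝ)..T, ((t ^ b : ℝ) : ℂ) * Complex.exp (-(t * c))‖ ≤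
      T ^ (b + 1) / (b + 1) := by
  have h := intervalIntegral.norm_integral_le_of_norm_le
    (f := fun t : ℝ => ((t ^ b : ℝ) : ℂ) * Complex.exp (-(t * c))) (g := fun t => t ^ b)
    hT.le (Filter.Eventually.of_forall fun t ht => by
      rw [norm_rpow_mul_cexp ht.1]
      have h0 : 0 ≤ t ^ b := Real.rpow_nonneg ht.1.le _
      refine mul_le_of_le_one_right h0 (Real.exp_le_one_iff.mpr ?_)
      have := mul_nonneg hc ht.1.le
      linarith) (intervalIntegral.intervalIntegrable_rpow' hb)
  refine h.trans_eq ?_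
  rw [integral_rpow (Or.inl hb), Real.zero_rpow (by linarith), sub_zero]

/-- The same integration by parts on `(0,T)`, with the additional boundary term `T^b exp(-Tc)`; the
two contributions to `cF` are bounded by `T^b` each. -/
theorem norm_fourier_weightedFamily_low_le {δ T b ξ : ℝ} (hT : 0 < T) (hb : 0 < b) (h : |ξ| ≤ 1)
    (τ : ℝ) : timeWeight τ * ‖𝓕 (weightedFamily δ b T ξ) τ‖ ≤
      (1 + ‖symb δ ξ‖) * T ^ (b + 1) + 2 * T ^ b := by
  set w : ℂ := (2 * Real.pi * τ : ℝ) * Complex.I with hw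
  set c : ℂ := symb δ ξ + w with hc
  have hcre : 0 ≤ c.re := by
    rw [hc, Complex.add_re, hw, Complex.re_ofReal_mul, Complex.I_re, mul_zero, add_zero]
    exact symb_re_nonneg δ ξ
  rw [weightedFamily_of_le_one h, fourier_indicator_mul_cexp measurableSet_Ioo, ← hw, ← hc,
    ← integral_Ioc_eq_integral_Ioo, ← intervalIntegral.integral_of_le hT.le]
  set F := ∫ t in (0 : ℝ)..T, ((t ^ b : ℝ) : ℂ) * Complex.exp (-(t * c))
  have hF : ‖F‖ ≤ T ^ (b + 1) := (norm_integral_rpow_mul_cexp_le hT (by linarith) hcre).trans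
    (div_le_self (by positivity) (by linarith))
  have hcont := Real.continuous_rpow_const hb.le
  have hce : Continuous fun t : ℝ => Complex.exp (-(t * c)) := by fun_prop
  have i1 : IntervalIntegrable (fun t : ℝ => ((t ^ b : ℝ) : ℂ) * Complex.exp (-(t * c)))
      volume 0 T := Continuous.intervalIntegrable (by fun_prop) _ _
  have i2 : IntervalIntegrable (fun t : ℝ => ((t ^ (b - 1) : ℝ) : ℂ) * Complex.exp (-(t * c)))
      volume 0 T := by
    have h0 : IntervalIntegrable (fun t : ℝ => ((t ^ (b - 1) : ℝ) : ℂ)) volume 0 T := by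
      have h : IntervalIntegrable (fun t : ℝ => t ^ (b - 1)) volume 0 T :=
        intervalIntegral.intervalIntegrable_rpow' (by linarith)
      exact ⟨h.1.ofReal, h.2.ofReal⟩
    exact h0.mul_continuousOn hce.continuousOn
  have ibp := intervalIntegral.integral_eq_sub_of_hasDerivAt_of_le hT.le
    (f := fun t : ℝ => ((t ^ b : ℝ) : ℂ) * Complex.exp (-(t * c)))
    (Continuous.continuousOn (by fun_prop)) (fun t ht => hasDerivAt_rpow_mul_cexp b c ht.1)
    ((i2.const_mul (b : ℂ)).sub (i1.const_mul c))
  rw [intervalIntegral.integral_sub (i2.const_mul (b : ℂ)) (i1.const_mul c),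
    intervalIntegral.integral_const_mul, intervalIntegral.integral_const_mul] at ibp
  simp only [Real.zero_rpow hb.ne', Complex.ofReal_zero, zero_mul, sub_zero] at ibp
  have hb1 := norm_integral_rpow_mul_cexp_le hT (b := b - 1) (by linarith) hcre
  have hcF : ‖c * F‖ ≤ 2 * T ^ b := by
    have e : c * F = b * (∫ t in (0 : ℝ)..T, ((t ^ (b - 1) : ℝ) : ℂ) * Complex.exp (-(t * c))) -
        ((T ^ b : ℝ) : ℂ) * Complex.exp (-(T * c)) := by rw [← ibp]; ring
    rw [e]
    refine (norm_sub_le _ _).trans ?_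
    rw [norm_rpow_mul_cexp hT, norm_mul, Complex.norm_real, Real.norm_of_nonneg hb.le]
    rw [sub_add_cancel] at hb1
    have h2 : Real.exp (-c.re * T) ≤ 1 := Real.exp_le_one_iff.mpr (by
      have := mul_nonneg hcre hT.le; linarith)
    have h3 : 0 ≤ T ^ b := by positivity
    calc _ ≤ b * (T ^ b / b) + T ^ b * 1 := by gcongr
      _ = _ := by field_simp; ring
  have hwF : |τ| * ‖F‖ ≤ ‖c * F‖ + ‖symb δ ξ‖ * ‖F‖ := by
    have h1 : ‖w * F‖ ≤ ‖c * F‖ + ‖symb δ ξ * F‖ := by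
      have := norm_sub_le (c * F) (symb δ ξ * F)
      rwa [← sub_mul, hc, add_sub_cancel_left] at this
    rw [norm_mul, norm_mul (symb δ ξ), hw, norm_mul, Complex.norm_I, Complex.norm_real,
      Real.norm_eq_abs, abs_mul, mul_one, abs_of_pos (by positivity : 0 < 2 * Real.pi)] at h1
    refine le_trans ?_ h1
    gcongr
    nlinarith [Real.pi_gt_three, abs_nonneg τ]
  calc _ ≤ (1 + |τ|) * ‖F‖ := by gcongr; exact timeWeight_le τ
    _ = ‖F‖ + |τ| * ‖F‖ := by ring
    _ ≤ ‖F‖ + (‖c * F‖ + ‖symb δ ξ‖ * ‖F‖) := by gcongr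
    _ = (1 + ‖symb δ ξ‖) * ‖F‖ + ‖c * F‖ := by ring
    _ ≤ _ := by gcongr

theorem exists_weightedFamily (δ T : ℝ) (hT : 0 < T) {b : ℝ} (hb : 0 < b) : ∃ m : ℝ → ℝ → ℂ,
    Measurable (Function.uncurry m) ∧ (∀ ξ, Integrable (m ξ) volume) ∧
    (∀ ξ, ∀ t ∈ Ioo 0 T, m ξ t = ((t ^ b : ℝ) : ℂ) * Complex.exp (-(t * symb δ ξ))) ∧
    ∃ C : ℝ, 0 ≤ C ∧ ∀ ξ τ, ‖𝓕 (m ξ) τ‖ ≤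
      C * (freqWeight ξ ^ (-b) / (freqWeight ξ + timeWeight τ)) := by
  obtain ⟨C₁, hC₁, h₁⟩ := exists_norm_fourier_weightedFamily_high_le δ T hb
  set R : ℝ := (2 * Real.pi) ^ 4 + |δ| * (2 * Real.pi) ^ 3
  have hR : 0 ≤ R := by positivity
  set C₂ : ℝ := (1 + R) * T ^ (b + 1) + 2 * T ^ b
  have hC₂ : 0 ≤ C₂ := by positivity
  refine ⟨weightedFamily δ b T, measurable_weightedFamily δ b T, integrable_weightedFamily δ hb,
    fun ξ t ht => ?_, C₁ + C₂ * (4 ^ b * 5), by positivity, fun ξ τ => ?_⟩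
  · simp [weightedFamily, ht.1, ht.2]
  · have hX := freqWeight_pos ξ
    have hY := timeWeight_pos τ
    have hX1 := one_le_freqWeight ξ
    have hY1 := one_le_timeWeight τ
    by_cases h : |ξ| ≤ 1
    · have hX4 := freqWeight_le_four h
      have key := norm_fourier_weightedFamily_low_le (δ := δ) hT hb h τ
      have key2 : timeWeight τ * ‖𝓕 (weightedFamily δ b T ξ) τ‖ ≤ C₂ := by
        refine key.trans ?_
        have : ‖symb δ ξ‖ ≤ R := norm_symb_le_of_le_one h δ
        have : 0 ≤ T ^ (b + 1) := by positivity
        have : (1 + ‖symb δ ξ‖) * T ^ (b + 1) ≤ (1 + R) * T ^ (b + 1) := by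
          apply mul_le_mul_of_nonneg_right _ this
          linarith
        exact add_le_add_left this _
      -- Since `1 ≤ X ≤ 4`, one has `X^{-b} ≥ 4^{-b}` and `X + Y ≤ 5Y`, whence the factor `4^b * 5`.
      have hb4 : 4 ^ (-b) ≤ freqWeight ξ ^ (-b) :=
        Real.rpow_le_rpow_of_nonpos hX hX4 (by linarith)
      calc _ ≤ C₂ * (timeWeight τ)⁻¹ := by
            rw [← div_eq_mul_inv, le_div_iff₀ hY, mul_comm]; exact key2
        _ = C₂ * (4 ^ b * 5) * (4 ^ (-b) / (5 * timeWeight τ)) := by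
            rw [Real.rpow_neg (by norm_num)]
            have : (4 : ℝ) ^ b ≠ 0 := (Real.rpow_pos_of_pos (by norm_num) _).ne'
            field_simp
        _ ≤ C₂ * (4 ^ b * 5) * (freqWeight ξ ^ (-b) / (freqWeight ξ + timeWeight τ)) := by
            have : freqWeight ξ + timeWeight τ ≤ 5 * timeWeight τ := by linarith
            gcongr ?_ * (?_ / ?_)
        _ ≤ _ := by
            gcongr ?_ * ?_
            exact le_add_of_nonneg_left hC₁
    · refine (h₁ ξ (not_le.mp h) τ).trans ?_
      gcongr
      exact le_add_of_nonneg_right (by positivity)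

end LinearKS

end

noncomputable section

namespace LinearKS

open FourierTransform SobolevSpace
open scoped ENNReal

/-! ### Multiplier bounds -/

theorem exists_rpow_mul_exp_neg_le {c : ℝ} (hc : 0 ≤ c) :
    ∃ K : ℝ, 0 ≤ K ∧ ∀ y : ℝ, 0 < y → y ^ c * Real.exp (-y) ≤ K := by
  set n := ⌈c⌉₊
  refine ⟨n.factorial * Real.exp 1, by positivity, fun y hy => ?_⟩
  have h1 : y ^ c ≤ (1 + y) ^ n := by
    rw [← Real.rpow_natCast]
    calc y ^ c ≤ (1 + y) ^ c := by gcongr; linarith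
      _ ≤ _ := Real.rpow_le_rpow_of_exponent_le (by linarith) (Nat.le_ceil c)
  have h2 : (1 + y) ^ n ≤ n.factorial * Real.exp (1 + y) := by
    have := Real.pow_div_factorial_le_exp (1 + y) (by linarith) n
    rwa [div_le_iff₀ (by positivity), mul_comm] at this
  calc _ ≤ (n.factorial * Real.exp (1 + y)) * Real.exp (-y) := by
        gcongr; exact h1.trans h2
    _ = n.factorial * (Real.exp (1 + y) * Real.exp (-y)) := by ring
    _ = _ := by rw [← Real.exp_add]; ring_nf

/-- Treats low and high frequencies together: on `[0,T]` the factor `|exp(-ta)|` is at most `exp(4T)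
exp(-tX)`. -/
theorem freqWeight_sub_four_le (δ ξ : ℝ) : freqWeight ξ - 4 ≤ (symb δ ξ).re := by
  by_cases h : |ξ| ≤ 1
  · linarith [freqWeight_le_four h, symb_re_nonneg δ ξ]
  · linarith [freqWeight_le_of_one_lt (not_le.mp h) δ]

/-- The Fourier multiplier `t^b (1+ξ²)^r e^{-ta}`. -/
def heatMul (δ b r t ξ : ℝ) : ℂ :=
  ((t ^ b * (1 + ξ ^ 2) ^ r : ℝ) : ℂ) * Complex.exp (-(t * symb δ ξ))

theorem norm_heatMul_le (δ b r : ℝ) {t T : ℝ} (ht : 0 ≤ t) (hT : t ≤ T) (ξ : ℝ) :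
    ‖heatMul δ b r t ξ‖ ≤
      Real.exp (4 * T) * (t ^ b * freqWeight ξ ^ (r / 2) * Real.exp (-(t * freqWeight ξ))) := by
  have hX := freqWeight_pos ξ
  have h : (1 + ξ ^ 2) ^ r = freqWeight ξ ^ (r / 2) := by
    rw [← freqWeight_rpow]; ring_nf
  have hre := mul_le_mul_of_nonneg_left (freqWeight_sub_four_le δ ξ) ht
  rw [heatMul, norm_mul, Complex.norm_real, h, Real.norm_of_nonneg (by positivity),
    Complex.norm_exp, Complex.neg_re, Complex.re_ofReal_mul, mul_left_comm, ← Real.exp_add]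
  gcongr
  linarith

/-- Up to `exp(4T)` the multiplier is `(tX)^b exp(-tX)`, a bounded function of `tX`. -/
theorem exists_norm_heatMul_le (δ T : ℝ) {b : ℝ} (hb : 0 ≤ b) :
    ∃ C : ℝ, 0 ≤ C ∧ ∀ t ∈ Ioc 0 T, ∀ ξ, ‖heatMul δ b (2 * b) t ξ‖ ≤ C := by
  obtain ⟨K, hK, h⟩ := exists_rpow_mul_exp_neg_le hb
  refine ⟨Real.exp (4 * T) * K, by positivity, fun t ht ξ => ?_⟩
  have hX := freqWeight_pos ξ
  have ht0 := ht.1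
  refine (norm_heatMul_le δ b _ ht0.le ht.2 ξ).trans ?_
  rw [mul_div_cancel_left₀ _ two_ne_zero, ← Real.mul_rpow ht0.le hX.le]
  gcongr
  exact h _ (by positivity)

/-- Away from `t = 0` every power of `X` is absorbed. The constant depends on `ε`, so this serves
only for membership in `L²` and continuity in time. -/
theorem exists_norm_heatMul_le_of_le (δ b r : ℝ) {ε T : ℝ} (hε : 0 < ε) :
    ∃ C : ℝ, 0 ≤ C ∧ ∀ t ∈ Icc ε T, ∀ ξ, ‖heatMul δ b r t ξ‖ ≤ C := by
  obtain ⟨K, hK, h⟩ := exists_rpow_mul_exp_neg_le (abs_nonneg (r / 2))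
  set B := max (ε ^ b) (T ^ b)
  refine ⟨Real.exp (4 * T) * (B * (ε ^ (-|r / 2|) * K)), ?_, fun t ht ξ => ?_⟩
  · have : 0 ≤ B := le_max_of_le_left (by positivity)
    positivity
  have hX := freqWeight_pos ξ
  have ht0 : 0 < t := hε.trans_le ht.1
  have htb : t ^ b ≤ B := by
    rcases le_total 0 b with hb | hb
    · exact le_max_of_le_right (Real.rpow_le_rpow ht0.le ht.2 hb)
    · exact le_max_of_le_left (Real.rpow_le_rpow_of_nonpos hε ht.1 hb)
  have hB : 0 ≤ B := le_trans (by positivity) htb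
  refine (norm_heatMul_le δ b _ ht0.le ht.2 ξ).trans ?_
  rw [mul_assoc (t ^ b)]
  refine mul_le_mul_of_nonneg_left (mul_le_mul htb ?_ (by positivity) hB) (Real.exp_nonneg _)
  calc _ ≤ freqWeight ξ ^ |r / 2| * Real.exp (-(ε * freqWeight ξ)) := by
        have h1 := Real.rpow_le_rpow_of_exponent_le (one_le_freqWeight ξ) (le_abs_self (r / 2))
        have h2 := mul_le_mul_of_nonneg_right ht.1 hX.le
        gcongr
    _ = ε ^ (-|r / 2|) * ((ε * freqWeight ξ) ^ |r / 2| * Real.exp (-(ε * freqWeight ξ))) := by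
        rw [Real.mul_rpow hε.le hX.le, Real.rpow_neg hε.le]
        have := (Real.rpow_pos_of_pos hε |r / 2|).ne'
        field_simp
    _ ≤ _ := by
        exact mul_le_mul_of_nonneg_left (h _ (by positivity)) (by positivity)

theorem lintegral_Ioi_mul_exp {X : ℝ} (hX : 0 < X) :
    ∫⁻ t in Ioi (0 : ℝ), ENNReal.ofReal (X * Real.exp (-(t * X))) = 1 := by
  have e : (fun t : ℝ => Real.exp (-(t * X))) = fun t => Real.exp (-X * t) := by
    funext t; rw [neg_mul, mul_comm t]
  have hi : IntegrableOn (fun t : ℝ => X * Real.exp (-(t * X))) (Ioi 0) volume := by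
    refine Integrable.const_mul ?_ X
    rw [e]
    exact integrableOn_exp_mul_Ioi (neg_neg_of_pos hX) 0
  rw [← ofReal_integral_eq_lintegral_ofReal hi
    (Filter.Eventually.of_forall fun t => by positivity), integral_const_mul]
  rw [e, integral_exp_mul_Ioi (neg_neg_of_pos hX) 0]
  simp [hX.ne']

/-- The square is at most `exp(8T) (tX)^{2b} exp(-tX)` times `X exp(-tX)`: the first factor is
bounded and the second has integral one over `(0,∞)`, whatever `ξ`. This is the gain of two
derivatives. -/
theorem exists_lintegral_heatMul_sq_le (δ T : ℝ) {b : ℝ} (hb : 0 ≤ b) :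
    ∃ C : ℝ, 0 ≤ C ∧ ∀ ξ, ∫⁻ t in Ioo 0 T, ‖heatMul δ b (2 * b + 1) t ξ‖ₑ ^ 2 ≤
      ENNReal.ofReal (C ^ 2) := by
  obtain ⟨K, hK, h⟩ := exists_rpow_mul_exp_neg_le (c := 2 * b) (by positivity)
  set C : ℝ := √(Real.exp (8 * T) * K)
  refine ⟨C, Real.sqrt_nonneg _, fun ξ => ?_⟩
  have hX := freqWeight_pos ξ
  rw [Real.sq_sqrt (by positivity)]
  calc _ ≤ ∫⁻ t in Ioo 0 T, ENNReal.ofReal (Real.exp (8 * T) * K) *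
        ENNReal.ofReal (freqWeight ξ * Real.exp (-(t * freqWeight ξ))) := by
        refine setLIntegral_mono_ae (Measurable.aemeasurable (by fun_prop))
          (Filter.Eventually.of_forall fun t ht => ?_)
        have ht0 := ht.1
        rw [← ofReal_norm, ← ENNReal.ofReal_pow (norm_nonneg _),
          ← ENNReal.ofReal_mul (by positivity)]
        refine ENNReal.ofReal_le_ofReal ?_
        calc _ ≤ (Real.exp (4 * T) * (t ^ b * freqWeight ξ ^ ((2 * b + 1) / 2) *
              Real.exp (-(t * freqWeight ξ)))) ^ 2 := by
              gcongr; exact norm_heatMul_le δ b _ ht.1.le ht.2.le ξ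
          _ = Real.exp (8 * T) * ((t * freqWeight ξ) ^ (2 * b) *
              Real.exp (-(t * freqWeight ξ))) *
                (freqWeight ξ * Real.exp (-(t * freqWeight ξ))) := by
              have e1 : Real.exp (8 * T) = Real.exp (4 * T) ^ 2 := by
                rw [← Real.exp_nat_mul]; push_cast; ring_nf
              have e2 : (t ^ b) ^ 2 = t ^ (2 * b) := by
                rw [← Real.rpow_natCast, ← Real.rpow_mul ht0.le]; push_cast; ring_nf
              have e3 : (freqWeight ξ ^ ((2 * b + 1) / 2)) ^ 2 =
                  freqWeight ξ ^ (2 * b) * freqWeight ξ := by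
                rw [← Real.rpow_natCast, ← Real.rpow_mul hX.le, ← Real.rpow_add_one hX.ne']
                push_cast; ring_nf
              rw [mul_pow, mul_pow, mul_pow, e2, e3, e1, Real.mul_rpow ht0.le hX.le]
              ring
          _ ≤ _ := by
              gcongr
              exact h _ (by positivity)
    _ = ENNReal.ofReal (Real.exp (8 * T) * K) *
        ∫⁻ t in Ioo 0 T, ENNReal.ofReal (freqWeight ξ * Real.exp (-(t * freqWeight ξ))) :=
        lintegral_const_mul _ (by fun_prop)
    _ ≤ ENNReal.ofReal (Real.exp (8 * T) * K) * 1 := by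
        gcongr
        rw [← lintegral_Ioi_mul_exp hX]
        exact lintegral_mono_set Ioo_subset_Ioi_self
    _ = _ := mul_one _

theorem measurable_heatMul (δ b r : ℝ) :
    Measurable fun z : ℝ × ℝ => heatMul δ b r z.1 z.2 := by
  have hms := continuous_symb δ
  unfold heatMul
  fun_prop

theorem continuousOn_heatMul (δ b r ξ : ℝ) :
    ContinuousOn (fun t => heatMul δ b r t ξ) (Ioi 0) := by
  have h : ContinuousOn (fun t : ℝ => t ^ b) (Ioi 0) := fun t ht =>
    (Real.continuousAt_rpow_const t b (Or.inl (ne_of_gt ht))).continuousWithinAt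
  unfold heatMul
  have h2 : ContinuousOn (fun t : ℝ => Complex.exp (-(t * symb δ ξ))) (Ioi 0) := by fun_prop
  exact (Complex.continuous_ofReal.comp_continuousOn (h.mul continuousOn_const)).mul h2

/-! ### The solution operator -/

theorem memLp_bounded_mul {f g : ℝ → ℂ} (hf : Measurable f) (hg : MemLp g 2 volume) {C : ℝ}
    (hC : ∀ ξ, ‖f ξ‖ ≤ C) : MemLp (fun ξ => f ξ * g ξ) 2 volume :=
  MemLp.of_le_mul (c := C) hg (hf.aestronglyMeasurable.mul hg.1)
    (Filter.Eventually.of_forall fun ξ => by rw [norm_mul]; gcongr; exact hC ξ)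

theorem eLpNorm_bounded_mul_le {f g : ℝ → ℂ} {C : ℝ} (hC : ∀ ξ, ‖f ξ‖ ≤ C) :
    eLpNorm (fun ξ => f ξ * g ξ) 2 volume ≤ ENNReal.ofReal C * eLpNorm g 2 volume :=
  eLpNorm_le_mul_eLpNorm_of_ae_le_mul
    (Filter.Eventually.of_forall fun ξ => by rw [norm_mul]; gcongr; exact hC ξ) 2

/-- Tonelli: integrating in time first leaves the uniform bound `hb` times `|φ̂|²`. -/
theorem memLp_ofFun_heatMul (σ δ T : ℝ) {b : ℝ} {C : ℝ} (hC : 0 ≤ C)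
    (hb : ∀ ξ, ∫⁻ t in Ioo 0 T, ‖heatMul δ b (2 * b + 1) t ξ‖ₑ ^ 2 ≤ ENNReal.ofReal (C ^ 2))
    {s : ℝ} (φ : SobolevSpace s) :
    MemLp (fun t => ofFun σ fun ξ => heatMul δ b (2 * b + 1) t ξ * hat φ ξ) 2
        (volume.restrict (Ioo 0 T)) ∧
      eLpNorm (fun t => ofFun σ fun ξ => heatMul δ b (2 * b + 1) t ξ * hat φ ξ) 2
        (volume.restrict (Ioo 0 T)) ≤ ENNReal.ofReal (C * ‖φ‖) := by
  have hφ : MemLp (hat φ) 2 volume := Lp.memLp _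
  have hφm : Measurable (hat φ) := (Lp.stronglyMeasurable (hat φ)).measurable
  have hm := measurable_heatMul δ b (2 * b + 1)
  have hmt : ∀ t, Measurable (heatMul δ b (2 * b + 1) t) := fun t =>
    hm.comp measurable_prodMk_left
  have hL : ∀ t ∈ Ioo 0 T, MemLp (fun ξ => heatMul δ b (2 * b + 1) t ξ * hat φ ξ) 2 volume := by
    intro t ht
    obtain ⟨B, -, hB⟩ := exists_norm_heatMul_le_of_le δ b (2 * b + 1) (T := T) ht.1
    exact memLp_bounded_mul (hmt t) hφ (hB t ⟨le_rfl, ht.2.le⟩)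
  -- Continuity provides strong measurability in `t`. The multiplier is bounded only away from `t =
  -- 0`, hence the localization to `(t/2, T)`.
  have hcont : ContinuousOn (fun t => ofFun σ fun ξ => heatMul δ b (2 * b + 1) t ξ * hat φ ξ)
      (Ioo 0 T) := by
    intro t ht
    obtain ⟨B, hB0, hB⟩ := exists_norm_heatMul_le_of_le δ b (2 * b + 1) (T := T) (half_pos ht.1)
    have hin : t ∈ Ioo (t / 2) T := ⟨half_lt_self ht.1, ht.2⟩
    have h := continuousWithinAt_ofFun (s := σ) (S := Ioo (t / 2) T) hin
      (f := fun t ξ => heatMul δ b (2 * b + 1) t ξ * hat φ ξ)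
      (hφ.norm.const_mul B)
      (fun t => ((hmt t).mul hφm).aestronglyMeasurable)
      (fun t ht => Filter.Eventually.of_forall fun ξ => by
        rw [norm_mul]; gcongr; exact hB t ⟨ht.1.le, ht.2.le⟩ ξ)
      (Filter.Eventually.of_forall fun ξ => by
        refine ContinuousWithinAt.mul ?_ continuousWithinAt_const
        exact (continuousOn_heatMul δ b _ ξ t ht.1).mono fun x hx =>
          (half_pos ht.1).trans hx.1)
    exact (h.continuousAt (isOpen_Ioo.mem_nhds hin)).continuousWithinAt
  have hE : eLpNorm (fun t => ofFun σ fun ξ => heatMul δ b (2 * b + 1) t ξ * hat φ ξ) 2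
        (volume.restrict (Ioo 0 T)) ≤ ENNReal.ofReal (C * ‖φ‖) := by
    have hsq : ∀ f : ℝ → ℂ, ∫⁻ ξ, ‖f ξ‖ₑ ^ 2 = eLpNorm f 2 volume ^ 2 := fun f => by
      rw [eLpNorm_eq_lintegral_rpow_enorm_toReal two_ne_zero ENNReal.ofNat_ne_top]
      simp [← ENNReal.rpow_mul_natCast]
    have key : ∫⁻ t in Ioo 0 T, ‖ofFun σ fun ξ => heatMul δ b (2 * b + 1) t ξ * hat φ ξ‖ₑ ^ 2 ≤
        ENNReal.ofReal (C * ‖φ‖) ^ 2 := by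
      calc _ = ∫⁻ t in Ioo 0 T, ∫⁻ ξ, ‖heatMul δ b (2 * b + 1) t ξ‖ₑ ^ 2 * ‖hat φ ξ‖ₑ ^ 2 := by
            refine setLIntegral_congr_fun measurableSet_Ioo fun t ht => ?_
            rw [enorm_ofFun (hL t ht), ← hsq]
            refine lintegral_congr fun ξ => ?_
            rw [enorm_mul, mul_pow]
        _ = ∫⁻ ξ, ∫⁻ t in Ioo 0 T, ‖heatMul δ b (2 * b + 1) t ξ‖ₑ ^ 2 * ‖hat φ ξ‖ₑ ^ 2 := by
            refine lintegral_lintegral_swap (Measurable.aemeasurable ?_)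
            exact (hm.enorm.pow_const 2).mul ((hφm.comp measurable_snd).enorm.pow_const 2)
        _ ≤ ∫⁻ ξ, ENNReal.ofReal (C ^ 2) * ‖hat φ ξ‖ₑ ^ 2 := by
            refine lintegral_mono fun ξ => ?_
            rw [lintegral_mul_const]
            · gcongr; exact hb ξ
            · exact (hm.comp measurable_prodMk_right).enorm.pow_const 2
        _ = ENNReal.ofReal (C ^ 2) * ENNReal.ofReal ‖φ‖ ^ 2 := by
            rw [lintegral_const_mul _ (hφm.enorm.pow_const 2), hsq, eLpNorm_hat]
        _ = _ := by rw [ENNReal.ofReal_mul hC, mul_pow, ENNReal.ofReal_pow hC]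
    rw [eLpNorm_eq_lintegral_rpow_enorm_toReal two_ne_zero ENNReal.ofNat_ne_top]
    simp only [ENNReal.toReal_ofNat, ENNReal.rpow_ofNat, one_div]
    rw [ENNReal.rpow_inv_le_iff two_pos, ENNReal.rpow_ofNat]
    exact key
  exact ⟨⟨hcont.aestronglyMeasurable measurableSet_Ioo, hE.trans_lt ENNReal.ofReal_lt_top⟩, hE⟩

/-- The solution with initial datum `φ`, constant for negative times. -/
def heatFlow {s : ℝ} (δ : ℝ) (φ : SobolevSpace s) (t : ℝ) : SobolevSpace s :=
  ofFun s fun ξ => Complex.exp (-((max t 0 : ℝ) * symb δ ξ)) * hat φ ξ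

variable {s : ℝ}

theorem memLp_heatFlow (δ : ℝ) (φ : SobolevSpace s) {t : ℝ} (ht : 0 ≤ t) :
    MemLp (fun ξ => Complex.exp (-(t * symb δ ξ)) * hat φ ξ) 2 volume := by
  have hms := continuous_symb δ
  exact memLp_bounded_mul (Continuous.measurable (by fun_prop)) (Lp.memLp _)
    (norm_exp_neg_mul_symb ht δ)

theorem heatFlow_of_nonneg (δ : ℝ) (φ : SobolevSpace s) {t : ℝ} (ht : 0 ≤ t) :
    heatFlow δ φ t = ofFun s fun ξ => Complex.exp (-(t * symb δ ξ)) * hat φ ξ := by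
  rw [heatFlow, max_eq_left ht]

theorem heatFlow_zero (δ : ℝ) (φ : SobolevSpace s) : heatFlow δ φ 0 = φ := by
  rw [heatFlow_of_nonneg δ φ le_rfl]
  simp [ofFun_hat]

theorem norm_heatFlow_le (δ : ℝ) (φ : SobolevSpace s) {t : ℝ} (ht : 0 ≤ t) :
    ‖heatFlow δ φ t‖ ≤ ‖φ‖ := by
  rw [heatFlow_of_nonneg δ φ ht]
  refine norm_ofFun_le (memLp_heatFlow δ φ ht) (norm_nonneg _) ?_
  refine (eLpNorm_bounded_mul_le (C := 1) (norm_exp_neg_mul_symb ht δ)).trans_eq ?_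
  rw [ENNReal.ofReal_one, one_mul, eLpNorm_hat]

theorem continuous_heatFlow (δ : ℝ) (φ : SobolevSpace s) : Continuous (heatFlow δ φ) := by
  have hms := continuous_symb δ
  rw [← continuousOn_univ]
  intro t ht
  refine continuousWithinAt_ofFun ht (Lp.memLp (hat φ)).norm (fun t => ?_) (fun t _ => ?_) ?_
  · exact (Continuous.aestronglyMeasurable (by fun_prop)).mul (Lp.aestronglyMeasurable _)
  · refine Filter.Eventually.of_forall fun ξ => ?_
    rw [norm_mul]
    exact mul_le_of_le_one_left (norm_nonneg _) (norm_exp_neg_mul_symb (le_max_right _ _) δ ξ)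
  · refine Filter.Eventually.of_forall fun ξ => Continuous.continuousWithinAt ?_
    fun_prop

theorem dx_heatFlow (δ : ℝ) (φ : SobolevSpace s) {t : ℝ} (ht : 0 ≤ t) (k : ℕ) (ψ : 𝓢(ℝ, ℂ)) :
    dx k (toDistr (heatFlow δ φ t)) ψ = ∫ ξ, Complex.exp (-(t * symb δ ξ)) *
      ((2 * Real.pi * Complex.I * ξ) ^ k * (((1 + ξ ^ 2) ^ (-s / 2) : ℝ) : ℂ) * (𝓕⁻ ψ) ξ *
        hat φ ξ) := by
  rw [dx_toDistr_apply, heatFlow_of_nonneg δ φ ht]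
  refine integral_congr_ae ?_
  filter_upwards [coeFn_hat_ofFun (s := s) (memLp_heatFlow δ φ ht)] with ξ h
  rw [h]
  ring

/-- The factor `(1+ξ²)^r` is exactly compensated by the change of weight from `H^s` to `H^{s+2r}`,
so the distribution does not see it. -/
theorem toDistr_ofFun_heatMul (δ : ℝ) (φ : SobolevSpace s) {b r t σ : ℝ} (ht : 0 ≤ t)
    (hσ : σ = s + 2 * r)
    (h : MemLp (fun ξ => heatMul δ b r t ξ * hat φ ξ) 2 volume) :
    toDistr (ofFun σ fun ξ => heatMul δ b r t ξ * hat φ ξ) =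
      ((t ^ b : ℝ) : ℂ) • toDistr (heatFlow δ φ t) := by
  ext ψ
  rw [toDistr_ofFun h, heatFlow_of_nonneg δ φ ht]
  change _ = ((t ^ b : ℝ) : ℂ) • toDistr (ofFun s _) ψ
  rw [toDistr_ofFun (memLp_heatFlow δ φ ht), smul_eq_mul, ← integral_const_mul]
  refine integral_congr_ae (Filter.Eventually.of_forall fun ξ => ?_)
  have e : (1 + ξ ^ 2) ^ (-s / 2) = (1 + ξ ^ 2) ^ (-σ / 2) * (1 + ξ ^ 2) ^ r := by
    rw [← Real.rpow_add (by positivity), hσ]; ring_nf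
  beta_reduce
  rw [e, heatMul]
  push_cast
  ring

theorem isL2Version_heatFlow (δ T : ℝ) {b : ℝ} {C : ℝ} (hC : 0 ≤ C)
    (hb : ∀ ξ, ∫⁻ t in Ioo 0 T, ‖heatMul δ b (2 * b + 1) t ξ‖ₑ ^ 2 ≤ ENNReal.ofReal (C ^ 2))
    {σ : ℝ} (hσ : σ = s + 2 * (2 * b + 1)) (φ : SobolevSpace s) :
    ∃ q : ℝ → SobolevSpace σ,
      IsL2Version T (fun t => ((t ^ b : ℝ) : ℂ) • toDistr (heatFlow δ φ t)) q ∧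
      eLpNorm q 2 (volume.restrict (Ioo 0 T)) ≤ ENNReal.ofReal (C * ‖φ‖) := by
  obtain ⟨h1, h2⟩ := memLp_ofFun_heatMul σ δ T hC hb φ
  refine ⟨_, ⟨h1, ?_⟩, h2⟩
  filter_upwards [ae_restrict_mem measurableSet_Ioo] with t ht
  obtain ⟨B, -, hB⟩ := exists_norm_heatMul_le_of_le δ b (2 * b + 1) (T := T) ht.1
  exact toDistr_ofFun_heatMul δ φ ht.1.le hσ
    (memLp_bounded_mul ((measurable_heatMul δ b _).comp measurable_prodMk_left) (Lp.memLp _)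
      (hB t ⟨le_rfl, ht.2.le⟩))

/-- The weighted `L^∞(0,T; L²)` bound. -/
theorem exists_lp_heatFlow (δ T : ℝ) {b : ℝ} {C : ℝ} (hC : 0 ≤ C) (hb0 : 0 < b)
    (hb : ∀ t ∈ Ioc 0 T, ∀ ξ, ‖heatMul δ b (2 * b) t ξ‖ ≤ C) (hs : s = -(4 * b))
    (φ : SobolevSpace s) {t : ℝ} (ht : t ∈ Icc 0 T) :
    ∃ w : Lp ℂ 2 (volume : Measure ℝ),
      (w : 𝓢'(ℝ, ℂ)) = ((t ^ b : ℝ) : ℂ) • toDistr (heatFlow δ φ t) ∧ ‖w‖ ≤ C * ‖φ‖ := by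
  rcases ht.1.eq_or_lt with h0 | h0
  · refine ⟨0, ?_, by rw [norm_zero]; positivity⟩
    rw [← h0, Real.zero_rpow hb0.ne', Complex.ofReal_zero]
    refine Eq.trans ?_ (zero_smul ℂ (toDistr (heatFlow δ φ 0))).symm
    exact map_zero (Lp.toTemperedDistributionCLM ℂ (volume : Measure ℝ) 2)
  have hB := hb t ⟨h0, ht.2⟩
  have hL : MemLp (fun ξ => heatMul δ b (2 * b) t ξ * hat φ ξ) 2 volume :=
    memLp_bounded_mul ((measurable_heatMul δ b _).comp measurable_prodMk_left) (Lp.memLp _) hB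
  -- Here `s + 4b = 0`, and in `H^0` the Bessel potential is the identity, so `toL2` gives the
  -- distribution itself.
  refine ⟨toL2 (ofFun 0 fun ξ => heatMul δ b (2 * b) t ξ * hat φ ξ), ?_, ?_⟩
  · rw [← toDistr_ofFun_heatMul δ φ h0.le (σ := 0) (by rw [hs]; ring) hL, ← besselPotential_toDistr]
    simp
  · rw [← norm_eq]
    refine norm_ofFun_le hL (by positivity) ?_
    refine (eLpNorm_bounded_mul_le hB).trans_eq ?_
    rw [eLpNorm_hat, ENNReal.ofReal_mul hC]

open scoped ContDiff

theorem integrable_exp_mul (δ : ℝ) {t : ℝ} (ht : 0 ≤ t) {G : ℝ → ℂ} (hG : Integrable G volume) :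
    Integrable (fun ξ => Complex.exp (-(t * symb δ ξ)) * G ξ) volume := by
  have hms := continuous_symb δ
  refine hG.mono ((Continuous.aestronglyMeasurable (by fun_prop)).mul hG.1)
    (Filter.Eventually.of_forall fun ξ => ?_)
  rw [norm_mul]
  exact mul_le_of_le_one_left (norm_nonneg _) (norm_exp_neg_mul_symb ht δ ξ)

/-- Replacing `t` by `max t 0` makes the exponential continuous and bounded by one on the whole
plane, without changing it on `(0,T)`. -/
theorem integrable_prod_mul_exp_mul (δ T : ℝ) {f G : ℝ → ℂ} (hf : Integrable f volume)
    (hG : Integrable G volume) :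
    Integrable (fun z : ℝ × ℝ => f z.1 * (Complex.exp (-((max z.1 0 : ℝ) * symb δ z.2)) * G z.2))
      ((volume.restrict (Ioo 0 T)).prod volume) := by
  have hms := continuous_symb δ
  have h := (hf.restrict (s := Ioo 0 T)).mul_prod hG
  have hc : Continuous fun z : ℝ × ℝ => Complex.exp (-((max z.1 0 : ℝ) * symb δ z.2)) := by
    fun_prop
  have h2 := h.bdd_mul (c := 1) (hc.aestronglyMeasurable)
    (Filter.Eventually.of_forall fun z => norm_exp_neg_mul_symb (le_max_right z.1 0) δ z.2)
  refine h2.congr (Filter.Eventually.of_forall fun z => ?_)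
  simp only
  ring

theorem integrableOn_mul_integral_exp (δ T : ℝ) {f G : ℝ → ℂ} (hf : Integrable f volume)
    (hG : Integrable G volume) :
    IntegrableOn (fun t => f t * ∫ ξ, Complex.exp (-(t * symb δ ξ)) * G ξ) (Ioo 0 T) volume := by
  have h := (integrable_prod_mul_exp_mul δ T hf hG).integral_prod_left
  refine h.congr ?_
  filter_upwards [ae_restrict_mem measurableSet_Ioo] with t ht
  rw [integral_const_mul, max_eq_left ht.1.le]

theorem setIntegral_mul_integral_exp (δ T : ℝ) {f G : ℝ → ℂ} (hf : Integrable f volume)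
    (hG : Integrable G volume) :
    ∫ t in Ioo 0 T, f t * ∫ ξ, Complex.exp (-(t * symb δ ξ)) * G ξ =
      ∫ ξ, (∫ t in Ioo 0 T, f t * Complex.exp (-(t * symb δ ξ))) * G ξ := by
  have h := integral_integral_swap (f := fun t ξ =>
    f t * (Complex.exp (-((max t 0 : ℝ) * symb δ ξ)) * G ξ)) (integrable_prod_mul_exp_mul δ T hf hG)
  calc _ = ∫ t in Ioo 0 T, ∫ ξ, f t * (Complex.exp (-((max t 0 : ℝ) * symb δ ξ)) * G ξ) := by
        refine setIntegral_congr_fun measurableSet_Ioo fun t ht => ?_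
        rw [integral_const_mul, max_eq_left ht.1.le]
    _ = _ := h
    _ = _ := by
        refine integral_congr_ae (Filter.Eventually.of_forall fun ξ => ?_)
        beta_reduce
        rw [← integral_mul_const]
        refine setIntegral_congr_fun measurableSet_Ioo fun t ht => ?_
        rw [max_eq_left ht.1.le, mul_assoc]

theorem IntervalTest.eq_zero {T : ℝ} (η : IntervalTest T) {t : ℝ} (ht : t ∉ Ioo 0 T) : η.1 t = 0 :=
  image_eq_zero_of_notMem_tsupport fun h => ht (η.2 h)

theorem setIntegral_deriv_mul_exp {T : ℝ} (hT : 0 < T) (η : IntervalTest T) (a : ℂ) :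
    ∫ t in Ioo 0 T, -(deriv η.1 t) * Complex.exp (-(t * a)) =
      -(a * ∫ t in Ioo 0 T, η.1 t * Complex.exp (-(t * a))) := by
  have hd : Continuous (deriv η.1) := (SchwartzMap.derivCLM ℂ ℂ η.1).continuous
  have hη : Continuous η.1 := η.1.continuous
  have i1 : IntervalIntegrable (fun t : ℝ => deriv η.1 t * Complex.exp (-(t * a))) volume 0 T :=
    Continuous.intervalIntegrable (by fun_prop) _ _
  have i2 : IntervalIntegrable (fun t : ℝ => a * (η.1 t * Complex.exp (-(t * a)))) volume 0 T :=
    Continuous.intervalIntegrable (by fun_prop) _ _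
  have h := intervalIntegral.integral_eq_sub_of_hasDerivAt
    (fun t _ => hasDerivAt_mul_exp η.1.differentiable a t) (i1.sub i2)
  rw [intervalIntegral.integral_sub i1 i2, η.eq_zero (t := 0) (by simp),
    η.eq_zero (t := T) (by simp), zero_mul, zero_mul, sub_zero,
    intervalIntegral.integral_const_mul, intervalIntegral.integral_of_le hT.le,
    intervalIntegral.integral_of_le hT.le, integral_Ioc_eq_integral_Ioo,
    integral_Ioc_eq_integral_Ioo, sub_eq_zero] at h
  simp only [neg_mul]
  rw [integral_neg, h]

/-- By Fubini it suffices to test for each `ξ`, where `exp(-ta)` solves `f' + a f = 0` and `η`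
vanishes at the endpoints. -/
theorem heatFlow_equation (δ : ℝ) {T : ℝ} (hT : 0 < T) (φ : SobolevSpace s) (ψ : 𝓢(ℝ, ℂ))
    (η : IntervalTest T) :
    ∫ t in Ioo 0 T, (-(deriv η.1 t) * toDistr (heatFlow δ φ t) ψ +
      η.1 t * (dx 4 (toDistr (heatFlow δ φ t)) ψ +
        (δ : ℂ) * dx 3 (toDistr (heatFlow δ φ t)) ψ)) = 0 := by
  set G : ℕ → ℝ → ℂ := fun k ξ => (2 * Real.pi * Complex.I * ξ) ^ k *
    (((1 + ξ ^ 2) ^ (-s / 2) : ℝ) : ℂ) * (𝓕⁻ ψ) ξ * hat φ ξ with hGdef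
  have hG : ∀ k, Integrable (G k) volume := fun k => integrable_dx k s (Lp.memLp (hat φ)) ψ
  have hdx : ∀ k, ∀ t, 0 ≤ t → dx k (toDistr (heatFlow δ φ t)) ψ =
      ∫ ξ, Complex.exp (-(t * symb δ ξ)) * G k ξ := fun k t ht => dx_heatFlow δ φ ht k ψ
  have hsG : (fun ξ => symb δ ξ * G 0 ξ) = fun ξ => G 4 ξ + δ * G 3 ξ := by
    funext ξ
    simp only [hGdef, symb]
    ring
  have hsGi : Integrable (fun ξ => symb δ ξ * G 0 ξ) volume := by
    rw [hsG]; exact (hG 4).add ((hG 3).const_mul _)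
  have hηi : Integrable η.1 volume := η.1.integrable
  have hdi : Integrable (fun t => -(deriv η.1 t)) volume :=
    (SchwartzMap.derivCLM ℂ ℂ η.1).integrable.neg
  calc _ = ∫ t in Ioo 0 T, ((-(deriv η.1 t) * ∫ ξ, Complex.exp (-(t * symb δ ξ)) * G 0 ξ) +
        η.1 t * ∫ ξ, Complex.exp (-(t * symb δ ξ)) * (symb δ ξ * G 0 ξ)) := by
        refine setIntegral_congr_fun measurableSet_Ioo fun t ht => ?_
        have h0 := hdx 0 t ht.1.le
        change toDistr (heatFlow δ φ t) ψ = _ at h0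
        rw [h0, hdx 4 t ht.1.le, hdx 3 t ht.1.le, ← integral_const_mul (δ : ℂ),
          ← integral_add (integrable_exp_mul δ ht.1.le (hG 4))
            ((integrable_exp_mul δ ht.1.le (hG 3)).const_mul _)]
        congr 2
        refine integral_congr_ae (Filter.Eventually.of_forall fun ξ => ?_)
        beta_reduce
        rw [congrFun hsG ξ]
        ring
    _ = 0 := by
        rw [integral_add (integrableOn_mul_integral_exp δ T hdi (hG 0))
          (integrableOn_mul_integral_exp δ T hηi hsGi), setIntegral_mul_integral_exp δ T hdi (hG 0),
          setIntegral_mul_integral_exp δ T hηi hsGi, add_eq_zero_iff_eq_neg, ← integral_neg]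
        refine integral_congr_ae (Filter.Eventually.of_forall fun ξ => ?_)
        beta_reduce
        rw [setIntegral_deriv_mul_exp hT η]
        ring

theorem isSolution_heatFlow (δ : ℝ) {T : ℝ} (hT : 0 < T) (φ : SobolevSpace s) :
    IsSolution δ s T φ (heatFlow δ φ) where
  continuousOn := (continuous_heatFlow δ φ).continuousOn
  memL2 := by
    obtain ⟨C, hC, hb⟩ := exists_lintegral_heatMul_sq_le δ T (b := 0) le_rfl
    obtain ⟨q, hq, -⟩ := isL2Version_heatFlow δ T hC hb (s := s) (σ := s + 2) (by ring) φ
    exact ⟨q, by simpa using hq⟩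
  initial := heatFlow_zero δ φ
  equation := heatFlow_equation δ hT φ

/-! ### Traces -/

theorem integral_mul_osc (ψ : 𝓢(ℝ, ℂ)) (ξ : ℝ) : ∫ x, ψ x * osc x ξ = (𝓕⁻ ψ) ξ := by
  rw [SchwartzMap.fourierInv_coe, Real.fourierInv_eq']
  refine integral_congr_ae (Filter.Eventually.of_forall fun x => ?_)
  simp only [osc, smul_eq_mul, RCLike.inner_apply, conj_trivial]
  rw [mul_comm]
  congr 3
  push_cast
  ring

theorem integral_mul_integral_osc (ψ : 𝓢(ℝ, ℂ)) {J : ℝ → ℂ} (hJ : Integrable J volume) :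
    ∫ x, ψ x * ∫ ξ, osc x ξ * J ξ = ∫ ξ, (𝓕⁻ ψ) ξ * J ξ := by
  have hψ : Integrable ψ volume := ψ.integrable
  have hc : Continuous fun z : ℝ × ℝ => osc z.1 z.2 := by unfold osc; fun_prop
  have h : Integrable (fun z : ℝ × ℝ => ψ z.1 * (osc z.1 z.2 * J z.2)) (volume.prod volume) := by
    have h2 := (hψ.mul_prod hJ).bdd_mul (c := 1) (hc.aestronglyMeasurable)
      (Filter.Eventually.of_forall fun z => (norm_osc z.1 z.2).le)
    refine h2.congr (Filter.Eventually.of_forall fun z => ?_)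
    simp only
    ring
  calc _ = ∫ x, ∫ ξ, ψ x * (osc x ξ * J ξ) := by simp only [integral_const_mul]
    _ = ∫ ξ, ∫ x, ψ x * (osc x ξ * J ξ) := integral_integral_swap h
    _ = _ := by
      refine integral_congr_ae (Filter.Eventually.of_forall fun ξ => ?_)
      beta_reduce
      rw [← integral_mul_osc, ← integral_mul_const]
      simp only [mul_assoc]

theorem integral_mul_intervalTest {T : ℝ} (η : IntervalTest T) {m m' : ℝ → ℂ}
    (h : ∀ t ∈ Ioo 0 T, m t = m' t) :
    ∫ t, m t * η.1 t = ∫ t in Ioo 0 T, η.1 t * m' t := by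
  rw [← integral_indicator measurableSet_Ioo]
  refine integral_congr_ae (Filter.Eventually.of_forall fun t => ?_)
  by_cases ht : t ∈ Ioo 0 T
  · simp only [indicator_of_mem ht, h t ht, mul_comm]
  · simp only [indicator_of_notMem ht, η.eq_zero ht, mul_zero]

theorem setIntegral_mul_dx_heatFlow (δ T : ℝ) (φ : SobolevSpace s) (k : ℕ) (ψ : 𝓢(ℝ, ℂ))
    (η : IntervalTest T) {m : ℝ → ℝ → ℂ}
    (hm : ∀ ξ, ∀ t ∈ Ioo 0 T, m ξ t = Complex.exp (-(t * symb δ ξ))) :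
    ∫ t in Ioo 0 T, η.1 t * dx k (toDistr (heatFlow δ φ t)) ψ =
      ∫ ξ, (𝓕⁻ ψ) ξ * ((∫ t, m ξ t * η.1 t) * ((2 * Real.pi * Complex.I * ξ) ^ k *
        (((1 + ξ ^ 2) ^ (-s / 2) : ℝ) : ℂ) * hat φ ξ)) := by
  set G : ℝ → ℂ := fun ξ => (2 * Real.pi * Complex.I * ξ) ^ k *
    (((1 + ξ ^ 2) ^ (-s / 2) : ℝ) : ℂ) * (𝓕⁻ ψ) ξ * hat φ ξ with hGdef
  have hG : Integrable G volume := integrable_dx k s (Lp.memLp (hat φ)) ψ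
  have hη : Integrable (fun t => η.1 t) volume := η.1.integrable
  calc _ = ∫ t in Ioo 0 T, η.1 t * ∫ ξ, Complex.exp (-(t * symb δ ξ)) * G ξ := by
        refine setIntegral_congr_fun measurableSet_Ioo fun t ht => ?_
        rw [dx_heatFlow δ φ ht.1.le]
    _ = _ := setIntegral_mul_integral_exp δ T (f := fun t => η.1 t) (G := G) hη hG
    _ = _ := by
        refine integral_congr_ae (Filter.Eventually.of_forall fun ξ => ?_)
        beta_reduce
        rw [integral_mul_intervalTest η (hm ξ), hGdef]
        ring

theorem exists_weighted_trace (δ : ℝ) {s T : ℝ} (hT : 0 < T) (hs : s < 0) {k : ℕ} (hk : k ≤ 1) :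
    ∃ C : ℝ, 0 ≤ C ∧ ∃ m : ℝ → ℝ → ℂ,
      (∀ ξ, ∀ t ∈ Ioo 0 T, m ξ t = ((t ^ (|s| / 4) : ℝ) : ℂ) * Complex.exp (-(t * symb δ ξ))) ∧
      ∀ φ : SobolevSpace s, ∃ g : ℝ → SobolevInterval (-(k : ℝ) / 4 + 3 / 8) T,
        (∀ x, ‖g x‖ ≤ C * ‖φ‖) ∧ ∀ (η : IntervalTest T) (x : ℝ),
          pairing (g x) η = ∫ ξ, osc x ξ * ((∫ t, m ξ t * η.1 t) *
            ((2 * Real.pi * Complex.I * ξ) ^ k *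
              (((1 + ξ ^ 2) ^ (-s / 2) : ℝ) : ℂ) * hat φ ξ)) := by
  obtain ⟨m, hm, hmi, hmt, C₀, hC₀, hb⟩ := exists_weightedFamily δ T hT
    (b := |s| / 4) (by have := abs_pos.mpr hs.ne; positivity)
  have e : -(|s| / 4) = s / 4 := by rw [abs_of_neg hs]; ring
  rw [e] at hb
  obtain ⟨C, hC, H⟩ := exists_trace (-(k : ℝ) / 4 + 3 / 8) s T k hm hmi
    (C := C₀ * (2 * Real.pi) ^ k) (by positivity)
    fun τ ξ => le_kap_of_le_weighted hk hC₀ τ ξ (hb ξ τ)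
  refine ⟨C, hC, m, hmt, fun φ => ?_⟩
  obtain ⟨g, -, hg, hp⟩ := H φ
  exact ⟨g, hg, fun η => (hp η).2⟩

theorem integral_mul_intervalTest_pow {T b : ℝ} {m m' e : ℝ → ℂ} (hm : ∀ t ∈ Ioo 0 T, m t = e t)
    (hm' : ∀ t ∈ Ioo 0 T, m' t = ((t ^ b : ℝ) : ℂ) * e t) (η ζ : IntervalTest T)
    (hζ : ∀ t : ℝ, ζ.1 t = ((t ^ b : ℝ) : ℂ) * η.1 t) :
    ∫ t, m' t * η.1 t = ∫ t, m t * ζ.1 t := by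
  rw [integral_mul_intervalTest η hm', integral_mul_intervalTest ζ hm]
  refine setIntegral_congr_fun measurableSet_Ioo fun t _ => ?_
  rw [hζ t]
  ring

/-- The extension of order `N = ⌈|r|⌉` suffices for the trace space of order `r`. The pairing
formula is kept in the conclusion so that the weighted trace can be compared with this one. -/
theorem exists_trace_heatFlow (δ s : ℝ) {T : ℝ} (hT : 0 < T) (k : ℕ) :
    ∃ C : ℝ, 0 ≤ C ∧ ∃ m : ℝ → ℝ → ℂ,
      (∀ ξ, ∀ t ∈ Ioo 0 T, m ξ t = Complex.exp (-(t * symb δ ξ))) ∧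
      ∀ φ : SobolevSpace s, ∃ h : ℝ → SobolevInterval ((s - k) / 4 + 3 / 8) T,
        IsTrace k (heatFlow δ φ) h ∧ (∀ x, ‖h x‖ ≤ C * ‖φ‖) ∧
        ∀ (η : IntervalTest T) (x : ℝ), pairing (h x) η = ∫ ξ, osc x ξ * ((∫ t, m ξ t * η.1 t) *
          ((2 * Real.pi * Complex.I * ξ) ^ k *
            (((1 + ξ ^ 2) ^ (-s / 2) : ℝ) : ℂ) * hat φ ξ)) := by
  obtain ⟨m, hm, hmi, hmt, C₀, hC₀, hb⟩ := exists_traceFamily δ T hT ⌈|(s - k) / 4 + 3 / 8|⌉₊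
  obtain ⟨C, hC, H⟩ := exists_trace ((s - k) / 4 + 3 / 8) s T k hm hmi
    (C := C₀ * (2 * Real.pi) ^ k) (by positivity)
    fun τ ξ => le_kap_of_le rfl (Nat.le_ceil _) hC₀ τ ξ (hb ξ τ)
  refine ⟨C, hC, m, hmt, fun φ => ?_⟩
  obtain ⟨h, hcont, hbound, hpair⟩ := H φ
  refine ⟨h, ⟨hcont, fun ψ η _ => ?_⟩, hbound, fun η => (hpair η).2⟩
  simp only [(hpair η).2]
  rw [integral_mul_integral_osc ψ (hpair η).1]
  exact setIntegral_mul_dx_heatFlow δ T φ k ψ η hmt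

/-- The traces of the solution, with the weighted traces for negative `s`. -/
theorem exists_traces_heatFlow (δ s : ℝ) {T : ℝ} (hT : 0 < T) (k : ℕ) (hk : k ≤ 1) :
    ∃ C : ℝ, 0 ≤ C ∧ ∀ φ : SobolevSpace s,
      ∃ h : ℝ → SobolevInterval ((s - k) / 4 + 3 / 8) T, IsTrace k (heatFlow δ φ) h ∧
        (∀ x, ‖h x‖ ≤ C * ‖φ‖) ∧
        (s < 0 → ∀ x, ∃ g : SobolevInterval (-(k : ℝ) / 4 + 3 / 8) T,
          IsPowMul (|s| / 4) (h x) g ∧ ‖g‖ ≤ C * ‖φ‖) := by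
  obtain ⟨C₁, hC₁, m, hm, H⟩ := exists_trace_heatFlow δ s hT k
  by_cases hs : s < 0
  · obtain ⟨C₂, hC₂, m', hm', H'⟩ := exists_weighted_trace δ hT hs hk
    refine ⟨C₁ + C₂, by positivity, fun φ => ?_⟩
    obtain ⟨h, htr, hbd, hp⟩ := H φ
    obtain ⟨g, hg, hp'⟩ := H' φ
    have e1 : C₁ * ‖φ‖ ≤ (C₁ + C₂) * ‖φ‖ := by gcongr; exact le_add_of_nonneg_right hC₂
    have e2 : C₂ * ‖φ‖ ≤ (C₁ + C₂) * ‖φ‖ := by gcongr; exact le_add_of_nonneg_left hC₁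
    refine ⟨h, htr, fun x => (hbd x).trans e1, fun _ x => ⟨g x, fun η ζ hζ => ?_,
      (hg x).trans e2⟩⟩
    -- Both pairings are the same integral in `ξ`, up to whether `t^b` sits on the extension or on
    -- the test function; only times in `(0,T)` matter.
    rw [hp' η x, hp ζ x]
    refine integral_congr_ae (Filter.Eventually.of_forall fun ξ => ?_)
    beta_reduce
    rw [integral_mul_intervalTest_pow (hm ξ) (hm' ξ) η ζ hζ]
  · refine ⟨C₁, hC₁, fun φ => ?_⟩
    obtain ⟨h, htr, hbd, -⟩ := H φ
    exact ⟨h, htr, hbd, fun h => absurd h hs⟩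

/-! ### The lemma of du Bois-Reymond -/

/-- The primitive of `κ` vanishes to the left of the support trivially and to the right because `κ`
has mean zero. -/
theorem exists_intervalTest_deriv_eq {T : ℝ} {κ : ℝ → ℝ} (hκ : ContDiff ℝ ∞ κ)
    (hc : HasCompactSupport κ) (hs : tsupport κ ⊆ Ioo 0 T) (h0 : ∫ t, κ t = 0) :
    ∃ η : IntervalTest T, ∀ t, deriv η.1 t = (κ t : ℂ) := by
  set P : ℝ → ℝ := fun t => ∫ x in (0 : ℝ)..t, κ x with hP
  have hd : ∀ t, HasDerivAt P (κ t) t := fun t =>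
    (hκ.continuous.integral_hasStrictDerivAt 0 t).hasDerivAt
  have hP' : ContDiff ℝ ∞ P := by
    rw [contDiff_infty_iff_deriv]
    refine ⟨fun t => (hd t).differentiableAt, ?_⟩
    rwa [funext fun t => (hd t).deriv]
  have hPc : ContDiff ℝ ∞ fun t => (P t : ℂ) := Complex.ofRealCLM.contDiff.comp hP'
  have hκ0 : ∀ t, t ∉ tsupport κ → κ t = 0 := fun t ht => image_eq_zero_of_notMem_tsupport ht
  obtain ⟨a, b, ha, hb, hab⟩ : ∃ a b : ℝ, 0 < a ∧ b < T ∧ tsupport κ ⊆ Icc a b := by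
    rcases (tsupport κ).eq_empty_or_nonempty with he | hne
    -- If the support is empty, any endpoints satisfying the two inequalities will do.
    · exact ⟨1, T - 1, one_pos, by linarith, by simp [he]⟩
    · obtain ⟨a, ha⟩ := hc.isCompact.exists_isLeast hne
      obtain ⟨b, hb⟩ := hc.isCompact.exists_isGreatest hne
      exact ⟨a, b, (hs ha.1).1, (hs hb.1).2, fun t ht => ⟨ha.2 ht, hb.2 ht⟩⟩
  have hint : Integrable κ volume := hκ.continuous.integrable_of_hasCompactSupport hc
  have hlow : ∀ t, t < a → ∫ x in Iic t, κ x = 0 := fun t ht => by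
    refine setIntegral_eq_zero_of_forall_eq_zero fun x hx => hκ0 x fun h => ?_
    exact absurd ((hab h).1.trans hx) (not_le.mpr ht)
  have hPe : ∀ t, P t = ∫ x in Iic t, κ x := fun t => by
    have h := intervalIntegral.integral_Iic_sub_Iic (μ := volume) (a := 0) (b := t) (f := κ)
      hint.integrableOn hint.integrableOn
    rw [hlow 0 ha, sub_zero] at h
    exact h.symm
  have hsupp : Function.support (fun t => (P t : ℂ)) ⊆ Icc a b := by
    intro t ht
    by_contra hn
    refine ht ?_
    beta_reduce
    rw [Complex.ofReal_eq_zero, hPe]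
    rcases lt_or_ge t a with h | h
    · exact hlow t h
    · have htb : b < t := not_le.mp fun h' => hn ⟨h, h'⟩
      rw [← h0, ← integral_indicator measurableSet_Iic]
      refine integral_congr_ae (Filter.Eventually.of_forall fun x => ?_)
      by_cases hx : x ∈ Iic t
      · simp only [indicator_of_mem hx]
      · rw [indicator_of_notMem hx, hκ0 x fun h' => hx ((hab h').2.trans htb.le)]
  have hts : tsupport (fun t => (P t : ℂ)) ⊆ Icc a b := closure_minimal hsupp isClosed_Icc
  have hcs : HasCompactSupport fun t => (P t : ℂ) :=
    HasCompactSupport.of_support_subset_isCompact isCompact_Icc hsupp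
  refine ⟨⟨hcs.toSchwartzMap hPc, fun t ht => ?_⟩, fun t => ?_⟩
  · have := hts ht
    exact ⟨ha.trans_le this.1, this.2.trans_lt hb⟩
  · exact (hd t).ofReal_comp.deriv

theorem exists_integral_eq_one {T : ℝ} (hT : 0 < T) : ∃ ρ : ℝ → ℝ, ContDiff ℝ ∞ ρ ∧
    HasCompactSupport ρ ∧ tsupport ρ ⊆ Ioo 0 T ∧ ∫ t, ρ t = 1 := by
  let f : ContDiffBump (T / 2) := ⟨T / 8, T / 4, by positivity, by linarith⟩
  refine ⟨f.normed volume, f.contDiff_normed, f.hasCompactSupport_normed, ?_, f.integral_normed⟩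
  rw [f.tsupport_normed_eq, Real.closedBall_eq_Icc]
  change Icc (T / 2 - T / 4) (T / 2 + T / 4) ⊆ _
  exact fun t ht => ⟨by linarith [ht.1], by linarith [ht.2]⟩

/-- For a test function `χ`, subtracting `(∫χ)ρ` with `∫ρ = 1` gives the derivative of a test
function. Hence `F - c` with `c = ∫ρF` annihilates every `χ`. -/
theorem eqOn_const_of_integral_deriv_mul_eq_zero {T : ℝ} (hT : 0 < T) {F : ℝ → ℂ}
    (hF : Continuous F) (h : ∀ η : IntervalTest T, ∫ t, deriv η.1 t * F t = 0) :
    ∃ c : ℂ, EqOn F (fun _ => c) (Icc 0 T) := by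
  obtain ⟨ρ, hρ, hρc, hρs, hρ1⟩ := exists_integral_eq_one hT
  have hint : ∀ χ : ℝ → ℝ, Continuous χ → HasCompactSupport χ →
      Integrable (fun t => (χ t : ℂ) * F t) volume := fun χ hχ hχc =>
    ((Complex.continuous_ofReal.comp hχ).mul hF).integrable_of_hasCompactSupport
      ((hχc.comp_left Complex.ofReal_zero).mul_right)
  set c : ℂ := ∫ t, (ρ t : ℂ) * F t with hc
  refine ⟨c, ?_⟩
  have hae : ∀ᵐ t ∂(volume : Measure ℝ), t ∈ Ioo 0 T → F t - c = 0 := by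
    refine isOpen_Ioo.ae_eq_zero_of_integral_contDiff_smul_eq_zero
      ((hF.sub continuous_const).locallyIntegrable.locallyIntegrableOn _) fun χ hχ hχc hχs => ?_
    set I : ℝ := ∫ t, χ t with hI
    have hχi : Integrable χ volume := hχ.continuous.integrable_of_hasCompactSupport hχc
    have hρi : Integrable ρ volume := hρ.continuous.integrable_of_hasCompactSupport hρc
    obtain ⟨η, hη⟩ := exists_intervalTest_deriv_eq (T := T) (κ := fun t => χ t - I * ρ t)
      (hχ.sub (contDiff_const.mul hρ)) (hχc.sub hρc.mul_left)
      ((tsupport_sub _ _).trans (union_subset hχs ((tsupport_mul_subset_right).trans hρs))) (by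
        rw [integral_sub hχi (hρi.const_mul I), integral_const_mul, hρ1, mul_one, sub_self])
    have h1 := h η
    have h2 : ∫ t, ((χ t : ℂ) * F t - I * ((ρ t : ℂ) * F t)) = 0 := by
      rw [← h1]
      refine integral_congr_ae (Filter.Eventually.of_forall fun t => ?_)
      beta_reduce
      rw [hη]
      push_cast
      ring
    rw [integral_sub (hint χ hχ.continuous hχc) ((hint ρ hρ.continuous hρc).const_mul _),
      integral_const_mul, ← hc] at h2
    have h3 : ∫ t, χ t • (F t - c) = ∫ t, ((χ t : ℂ) * F t - (χ t : ℂ) * c) := by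
      refine integral_congr_ae (Filter.Eventually.of_forall fun t => ?_)
      beta_reduce
      rw [Complex.real_smul, mul_sub]
    have i3 : Integrable (fun t => (χ t : ℂ) * c) volume := hχi.ofReal.mul_const c
    rw [h3, integral_sub (hint χ hχ.continuous hχc) i3, integral_mul_const]
    have h4 : ∫ t, (χ t : ℂ) = (I : ℂ) := integral_ofReal
    rw [h4, h2]
  refine Measure.eqOn_Icc_of_ae_eq volume hT.ne ?_ hF.continuousOn continuousOn_const
  rw [← restrict_Ioo_eq_restrict_Icc]
  filter_upwards [ae_restrict_of_ae hae, ae_restrict_mem measurableSet_Ioo] with t h1 h2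
  exact sub_eq_zero.mp (h1 h2)

theorem integral_deriv_mul_intervalTest {T : ℝ} (η : IntervalTest T) (F : ℝ → ℂ) :
    ∫ t, deriv η.1 t * F t = ∫ t in Ioo 0 T, deriv η.1 t * F t := by
  refine (setIntegral_eq_integral_of_forall_compl_eq_zero fun t ht => ?_).symm
  have h : deriv η.1 t = 0 :=
    image_eq_zero_of_notMem_tsupport fun h => ht (η.2 (tsupport_deriv_subset h))
  rw [h, zero_mul]

/-- If `G` is the primitive of `g`, then `f + G` has zero weak derivative and is constant; its value
is read off at `0`. -/
theorem eq_sub_integral_of_continuous {T : ℝ} (hT : 0 < T) {f g : ℝ → ℂ} (hf : Continuous f)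
    (hg : Continuous g) (h : ∀ η : IntervalTest T,
      ∫ t in Ioo 0 T, (-(deriv η.1 t) * f t + η.1 t * g t) = 0) {t : ℝ} (ht : t ∈ Icc 0 T) :
    f t = f 0 - ∫ x in (0 : ℝ)..t, g x := by
  set G : ℝ → ℂ := fun t => ∫ x in (0 : ℝ)..t, g x with hG
  have hd : ∀ t, HasDerivAt G (g t) t := fun t =>
    (hg.integral_hasStrictDerivAt 0 t).hasDerivAt
  have hGc : Continuous G := continuous_iff_continuousAt.mpr fun t => (hd t).continuousAt
  obtain ⟨c, hc⟩ := eqOn_const_of_integral_deriv_mul_eq_zero hT (F := fun t => f t + G t)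
    (hf.add hGc) fun η => by
      have hηc : Continuous η.1 := η.1.continuous
      have hηd : Continuous (deriv η.1) := (SchwartzMap.derivCLM ℂ ℂ η.1).continuous
      have hi : ∀ F : ℝ → ℂ, Continuous F → IntegrableOn F (Ioo 0 T) volume := fun F hF =>
        (hF.continuousOn.integrableOn_Icc (μ := volume)).mono_set Ioo_subset_Icc_self
      have i1 : IntegrableOn (fun t => deriv η.1 t * G t) (Ioo 0 T) volume := hi _ (hηd.mul hGc)
      have i2 : IntegrableOn (fun t => η.1 t * g t) (Ioo 0 T) volume := hi _ (hηc.mul hg)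
      have i3 : IntegrableOn (fun t => deriv η.1 t * f t) (Ioo 0 T) volume := hi _ (hηd.mul hf)
      have ibp := intervalIntegral.integral_eq_sub_of_hasDerivAt (a := 0) (b := T)
        (fun t _ => (η.1.differentiable t).hasDerivAt.mul (hd t))
        (((hηd.mul hGc).add (hηc.mul hg)).intervalIntegrable _ _)
      rw [Pi.mul_apply, Pi.mul_apply, η.eq_zero (t := 0) (by simp), η.eq_zero (t := T) (by simp),
        zero_mul, zero_mul, sub_zero, intervalIntegral.integral_of_le hT.le,
        integral_Ioc_eq_integral_Ioo] at ibp
      replace ibp := (integral_add i1 i2).symm.trans ibp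
      have h1 := h η
      simp only [neg_mul] at h1
      replace h1 := (integral_add i3.neg i2).symm.trans h1
      simp only [Pi.neg_apply] at h1
      rw [integral_neg] at h1
      rw [integral_deriv_mul_intervalTest]
      simp only [mul_add]
      rw [integral_add i3 i1]
      linear_combination ibp - h1
  have h0 := hc (left_mem_Icc.mpr hT.le)
  have h1 := hc ht
  have hG0 : G 0 = 0 := intervalIntegral.integral_same
  simp only [hG0, add_zero] at h0 h1
  linear_combination h1 - h0

/-- A weak solution of `f' + g = 0` on `(0,T)` is a classical one. -/
theorem eq_sub_integral_of_continuousOn {T : ℝ} (hT : 0 < T) {f g : ℝ → ℂ}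
    (hf : ContinuousOn f (Icc 0 T)) (hg : ContinuousOn g (Icc 0 T)) (h : ∀ η : IntervalTest T,
      ∫ t in Ioo 0 T, (-(deriv η.1 t) * f t + η.1 t * g t) = 0) {t : ℝ} (ht : t ∈ Icc 0 T) :
    f t = f 0 - ∫ x in (0 : ℝ)..t, g x := by
  -- Composition with the projection onto `[0,T]` extends `f` and `g` continuously to `ℝ`.
  set c : ℝ → ℝ := fun t => max 0 (min T t) with hc
  have hcc : Continuous c := by fun_prop
  have hcm : ∀ t, c t ∈ Icc 0 T := fun t => ⟨le_max_left _ _, max_le hT.le (min_le_left _ _)⟩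
  have hce : ∀ t ∈ Icc 0 T, c t = t := fun t ht => by
    rw [hc]; simp only [min_eq_right ht.2, max_eq_right ht.1]
  have key := eq_sub_integral_of_continuous hT (f := fun t => f (c t)) (g := fun t => g (c t))
    (hf.comp_continuous hcc hcm) (hg.comp_continuous hcc hcm) (fun η => by
      rw [← h η]
      refine setIntegral_congr_fun measurableSet_Ioo fun t ht => ?_
      rw [hce t (Ioo_subset_Icc_self ht)]) ht
  beta_reduce at key
  rw [hce t ht, hce 0 (left_mem_Icc.mpr hT.le)] at key
  rw [key]
  congr 1
  refine intervalIntegral.integral_congr fun x hx => ?_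
  rw [uIcc_of_le ht.1] at hx
  rw [hce x ⟨hx.1, hx.2.trans ht.2⟩]

/-! ### Uniqueness -/

/-- There is a test function with inverse Fourier transform `(1+ξ²)^{s/2} a^j θ`. -/
theorem exists_test_symb_pow (δ s : ℝ) {θ : ℝ → ℝ} (hθ : ContDiff ℝ ∞ θ)
    (hc : HasCompactSupport θ) (j : ℕ) : ∃ ψ : 𝓢(ℝ, ℂ), ∀ u : SobolevSpace s,
      toDistr u ψ = ∫ ξ, symb δ ξ ^ j * θ ξ * hat u ξ ∧
      dx 4 (toDistr u) ψ + (δ : ℂ) * dx 3 (toDistr u) ψ =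
        ∫ ξ, symb δ ξ ^ (j + 1) * θ ξ * hat u ξ := by
  have hsy : ContDiff ℝ ∞ (symb δ) := by
    unfold symb
    have : ContDiff ℝ ∞ fun ξ : ℝ => (ξ : ℂ) := Complex.ofRealCLM.contDiff
    fun_prop
  have hw : ContDiff ℝ ∞ fun ξ : ℝ => (((1 + ξ ^ 2) ^ (s / 2) : ℝ) : ℂ) := by
    have := (hasTemperateGrowth_weight (s / 2)).1
    simpa using this
  have hθc : ContDiff ℝ ∞ fun ξ => (θ ξ : ℂ) := Complex.ofRealCLM.contDiff.comp hθ
  have hcc : HasCompactSupport fun ξ => (θ ξ : ℂ) := hc.comp_left Complex.ofReal_zero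
  set χ : 𝓢(ℝ, ℂ) := HasCompactSupport.toSchwartzMap
    (f := fun ξ : ℝ => (((1 + ξ ^ 2) ^ (s / 2) : ℝ) : ℂ) * symb δ ξ ^ j * θ ξ)
    hcc.mul_left ((hw.mul (hsy.pow j)).mul hθc) with hχ
  have hinv : ∀ ξ, (𝓕⁻ (𝓕 χ) : 𝓢(ℝ, ℂ)) ξ =
      (((1 + ξ ^ 2) ^ (s / 2) : ℝ) : ℂ) * symb δ ξ ^ j * θ ξ := fun ξ => by
    rw [FourierTransform.fourierInv_fourier_eq]
    rfl
  have hww : ∀ ξ : ℝ, (((1 + ξ ^ 2) ^ (-s / 2) : ℝ) : ℂ) * (((1 + ξ ^ 2) ^ (s / 2) : ℝ) : ℂ) = 1 :=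
    fun ξ => by
      rw [← Complex.ofReal_mul, ← Real.rpow_add (by positivity)]
      have : -s / 2 + s / 2 = 0 := by ring
      rw [this, Real.rpow_zero, Complex.ofReal_one]
  have hdx : ∀ (u : SobolevSpace s) (k : ℕ), dx k (toDistr u) (𝓕 χ) =
      ∫ ξ, (2 * Real.pi * Complex.I * ξ) ^ k * (symb δ ξ ^ j * θ ξ * hat u ξ) := fun u k => by
    rw [dx_toDistr_apply]
    refine integral_congr_ae (Filter.Eventually.of_forall fun ξ => ?_)
    beta_reduce
    rw [hinv]
    linear_combination ((2 * Real.pi * Complex.I * ξ) ^ k * (symb δ ξ ^ j * θ ξ * hat u ξ)) * hww ξ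
  have hint : ∀ (u : SobolevSpace s) (k : ℕ), Integrable (fun ξ : ℝ =>
      (2 * Real.pi * Complex.I * ξ) ^ k * (symb δ ξ ^ j * θ ξ * hat u ξ)) volume := fun u k => by
    refine (integrable_dx k s (Lp.memLp (hat u)) (𝓕 χ)).congr
      (Filter.Eventually.of_forall fun ξ => ?_)
    beta_reduce
    rw [hinv]
    linear_combination ((2 * Real.pi * Complex.I * ξ) ^ k * (symb δ ξ ^ j * θ ξ * hat u ξ)) * hww ξ
  refine ⟨𝓕 χ, fun u => ⟨?_, ?_⟩⟩
  · have h := hdx u 0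
    simp only [pow_zero, one_mul] at h
    exact h
  · rw [hdx, hdx, ← integral_const_mul, ← integral_add (hint u 4) ((hint u 3).const_mul _)]
    refine integral_congr_ae (Filter.Eventually.of_forall fun ξ => ?_)
    beta_reduce
    rw [pow_succ]
    conv_rhs => rw [symb]
    conv_lhs => rw [symb]
    ring

/-- The moment `∫ a^j θ û`. -/
def symbMoment (δ : ℝ) (θ : ℝ → ℝ) (j : ℕ) (u : SobolevSpace s) : ℂ :=
  ∫ ξ, symb δ ξ ^ j * θ ξ * hat u ξ

theorem continuousOn_symbMoment (δ : ℝ) {θ : ℝ → ℝ} (hθ : ContDiff ℝ ∞ θ)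
    (hc : HasCompactSupport θ) (j : ℕ) {p : ℝ → SobolevSpace s} {S : Set ℝ}
    (hp : ContinuousOn p S) : ContinuousOn (fun t => symbMoment δ θ j (p t)) S := by
  obtain ⟨ψ, hψ⟩ := exists_test_symb_pow δ s hθ hc j
  refine ((continuous_toDistr_apply ψ).comp_continuousOn hp).congr fun t _ => ?_
  exact ((hψ (p t)).1).symm

/-- Testing the equation with the function of `exists_test_symb_pow` gives `z_j' + z_{j+1} = 0`
weakly for the moments `z_j`. Working with moments avoids choosing representatives of `û(t)` jointly
measurable in `(t,ξ)`. -/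
theorem IsSolution.symbMoment_eq {δ T : ℝ} (hT : 0 < T) {φ : SobolevSpace s}
    {p : ℝ → SobolevSpace s} (hp : IsSolution δ s T φ p) {θ : ℝ → ℝ} (hθ : ContDiff ℝ ∞ θ)
    (hc : HasCompactSupport θ) (j : ℕ) {t : ℝ} (ht : t ∈ Icc 0 T) :
    symbMoment δ θ j (p t) =
      symbMoment δ θ j φ - ∫ x in (0 : ℝ)..t, symbMoment δ θ (j + 1) (p x) := by
  obtain ⟨ψ, hψ⟩ := exists_test_symb_pow δ s hθ hc j
  have h := eq_sub_integral_of_continuousOn hT (f := fun t => symbMoment δ θ j (p t))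
    (g := fun t => symbMoment δ θ (j + 1) (p t))
    (continuousOn_symbMoment δ hθ hc j hp.continuousOn)
    (continuousOn_symbMoment δ hθ hc (j + 1) hp.continuousOn) (fun η => by
      rw [← hp.equation ψ η]
      refine setIntegral_congr_fun measurableSet_Ioo fun t _ => ?_
      rw [(hψ (p t)).1, (hψ (p t)).2]
      rfl) ht
  beta_reduce at h
  rwa [hp.initial] at h

/-- On the compact support of `θ` the symbol is bounded by some `B`; Cauchy–Schwarz with the `L²`
norm of `θ` gives a constant `M` that does not depend on `j`. -/
theorem norm_symbMoment_sub_le (δ : ℝ) {θ : ℝ → ℝ} (hθ : ContDiff ℝ ∞ θ)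
    (hc : HasCompactSupport θ) : ∃ M B : ℝ, 0 ≤ M ∧ 0 ≤ B ∧ ∀ (j : ℕ) (u v : SobolevSpace s),
      ‖symbMoment δ θ j u - symbMoment δ θ j v‖ ≤ M * B ^ j * ‖u - v‖ := by
  obtain ⟨B, hB⟩ := hc.isCompact.exists_bound_of_continuousOn (continuous_symb δ).continuousOn
  have hθL : MemLp (fun ξ => (θ ξ : ℂ)) 2 volume :=
    (Complex.continuous_ofReal.comp hθ.continuous).memLp_of_hasCompactSupport
      (hc.comp_left Complex.ofReal_zero)
  have hsm := continuous_symb δ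
  have hpw : ∀ (j : ℕ) (ξ : ℝ), ‖symb δ ξ ^ j * θ ξ‖ ≤ max B 0 ^ j * ‖(θ ξ : ℂ)‖ := fun j ξ => by
    rw [norm_mul, norm_pow]
    by_cases h : ξ ∈ tsupport θ
    · gcongr
      exact (hB ξ h).trans (le_max_left _ _)
    · simp [image_eq_zero_of_notMem_tsupport h]
  have hL : ∀ j : ℕ, MemLp (fun ξ => symb δ ξ ^ j * θ ξ) 2 volume := fun j =>
    MemLp.of_le_mul (c := max B 0 ^ j) hθL (by
      have := hθ.continuous
      exact Continuous.aestronglyMeasurable (by fun_prop))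
      (Filter.Eventually.of_forall (hpw j))
  set N : ℝ := (eLpNorm (fun ξ => (θ ξ : ℂ)) 2 volume).toReal
  refine ⟨N, max B 0, ENNReal.toReal_nonneg, le_max_right _ _, fun j u v => ?_⟩
  have hi : ∀ w : SobolevSpace s, Integrable (fun ξ => symb δ ξ ^ j * θ ξ * hat w ξ) volume :=
    fun w => (hL j).integrable_mul (Lp.memLp (hat w))
  have e : symbMoment δ θ j u - symbMoment δ θ j v = symbMoment δ θ j (u - v) := by
    rw [symbMoment, symbMoment, symbMoment, ← integral_sub (hi u) (hi v), hat_sub]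
    refine integral_congr_ae ?_
    filter_upwards [Lp.coeFn_sub (hat u) (hat v)] with ξ h
    rw [h, Pi.sub_apply, mul_sub]
  rw [e]
  have hnn : 0 ≤ N * max B 0 ^ j * ‖u - v‖ :=
    mul_nonneg (mul_nonneg ENNReal.toReal_nonneg (pow_nonneg (le_max_right _ _) _)) (norm_nonneg _)
  rw [← ENNReal.ofReal_le_ofReal_iff hnn, ofReal_norm]
  calc ‖symbMoment δ θ j (u - v)‖ₑ ≤ ∫⁻ ξ, ‖symb δ ξ ^ j * θ ξ * hat (u - v) ξ‖ₑ :=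
        enorm_integral_le_lintegral_enorm _
    _ = eLpNorm (fun ξ => symb δ ξ ^ j * θ ξ * hat (u - v) ξ) 1 volume :=
        eLpNorm_one_eq_lintegral_enorm.symm
    _ ≤ eLpNorm (fun ξ => symb δ ξ ^ j * θ ξ) 2 volume * eLpNorm (hat (u - v)) 2 volume :=
        eLpNorm_smul_le_mul_eLpNorm (𝕜 := ℂ) (p := 2) (q := 2) (r := 1)
          (Lp.aestronglyMeasurable (hat (u - v))) (hL j).1
    _ ≤ (ENNReal.ofReal (max B 0 ^ j) * eLpNorm (fun ξ => (θ ξ : ℂ)) 2 volume) *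
        ENNReal.ofReal ‖u - v‖ := by
        rw [eLpNorm_hat]
        gcongr
        exact eLpNorm_le_mul_eLpNorm_of_ae_le_mul (Filter.Eventually.of_forall (hpw j)) 2
    _ = _ := by
        rw [ENNReal.ofReal_mul (by positivity), ENNReal.ofReal_mul ENNReal.toReal_nonneg,
          ENNReal.ofReal_toReal hθL.2.ne]
        ring

/-- Each use of the integral relation raises `j` by one, at the cost of a factor `B`, and integrates
`xⁿ/n!` once more. -/
theorem norm_le_pow_div_factorial {T M B : ℝ} {z : ℕ → ℝ → ℂ}
    (hz : ∀ j, ∀ t ∈ Icc 0 T, ‖z j t‖ ≤ M * B ^ j)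
    (h : ∀ j, ∀ t ∈ Icc 0 T, z j t = -∫ x in (0 : ℝ)..t, z (j + 1) x) (n j : ℕ) {t : ℝ}
    (ht : t ∈ Icc 0 T) : ‖z j t‖ ≤ M * B ^ j * ((B * t) ^ n / n.factorial) := by
  induction n generalizing j t with
  | zero => simpa using hz j t ht
  | succ n ih =>
    rw [h j t ht, norm_neg]
    have h1 := intervalIntegral.norm_integral_le_of_norm_le
      (f := z (j + 1)) (g := fun x => M * B ^ (j + 1) * ((B * x) ^ n / n.factorial))
      (μ := volume) ht.1 (Filter.Eventually.of_forall fun x hx =>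
        ih (j + 1) ⟨hx.1.le, hx.2.trans ht.2⟩)
      (Continuous.intervalIntegrable (by fun_prop) _ _)
    refine h1.trans_eq ?_
    simp only [mul_pow, intervalIntegral.integral_const_mul, intervalIntegral.integral_div,
      integral_pow]
    rw [Nat.factorial_succ]
    push_cast
    field_simp
    ring

theorem eq_zero_of_eq_neg_integral {T M B : ℝ} {z : ℕ → ℝ → ℂ}
    (hz : ∀ j, ∀ t ∈ Icc 0 T, ‖z j t‖ ≤ M * B ^ j)
    (h : ∀ j, ∀ t ∈ Icc 0 T, z j t = -∫ x in (0 : ℝ)..t, z (j + 1) x) {t : ℝ}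
    (ht : t ∈ Icc 0 T) : z 0 t = 0 := by
  have hl := (FloorSemiring.tendsto_pow_div_factorial_atTop (B * t)).const_mul (M * B ^ 0)
  rw [mul_zero] at hl
  exact norm_le_zero_iff.mp (ge_of_tendsto' hl fun n => norm_le_pow_div_factorial hz h n 0 ht)

/-- The zeroth moments of `p - p'` vanish for every `θ`, and a locally integrable function
annihilated by all test functions is zero. -/
theorem IsSolution.eqOn {δ T : ℝ} (hT : 0 < T) {φ : SobolevSpace s} {p p' : ℝ → SobolevSpace s}
    (hp : IsSolution δ s T φ p) (hp' : IsSolution δ s T φ p') : EqOn p p' (Icc 0 T) := by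
  obtain ⟨D, hD⟩ := isCompact_Icc.exists_bound_of_continuousOn
    (hp.continuousOn.sub hp'.continuousOn)
  have hD0 : 0 ≤ D := (norm_nonneg _).trans (hD 0 (left_mem_Icc.mpr hT.le))
  intro t ht
  apply hat_injective
  rw [← sub_eq_zero, ← hat_sub]
  have hloc : LocallyIntegrable (hat (p t - p' t)) volume :=
    (Lp.memLp (hat (p t - p' t))).locallyIntegrable (by norm_num)
  refine (Lp.eq_zero_iff_ae_eq_zero (f := hat (p t - p' t))).mpr ?_
  refine ae_eq_zero_of_integral_contDiff_smul_eq_zero hloc fun θ hθ hc => ?_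
  obtain ⟨M, B, hM, hB, hMB⟩ := norm_symbMoment_sub_le (s := s) δ hθ hc
  have hi : ∀ j, ∀ t ∈ Icc 0 T, ∀ q : ℝ → SobolevSpace s, ContinuousOn q (Icc 0 T) →
      IntervalIntegrable (fun x => symbMoment δ θ j (q x)) volume 0 t := fun j t ht q hq => by
    refine ContinuousOn.intervalIntegrable ?_
    rw [uIcc_of_le ht.1]
    exact continuousOn_symbMoment δ hθ hc j (hq.mono (Icc_subset_Icc_right ht.2))
  have h0 := eq_zero_of_eq_neg_integral (T := T) (M := M * D) (B := B)
    (z := fun j t => symbMoment δ θ j (p t) - symbMoment δ θ j (p' t))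
    (fun j t ht => by
      refine (hMB j _ _).trans ?_
      calc _ ≤ M * B ^ j * D := by gcongr; exact hD t ht
        _ = _ := by ring)
    (fun j t ht => by
      rw [hp.symbMoment_eq hT hθ hc j ht, hp'.symbMoment_eq hT hθ hc j ht,
        intervalIntegral.integral_sub (hi _ t ht p hp.continuousOn)
          (hi _ t ht p' hp'.continuousOn)]
      ring) ht
  beta_reduce at h0
  obtain ⟨ψ, hψ⟩ := exists_test_symb_pow δ s hθ hc 0
  have e : symbMoment δ θ 0 (p t - p' t) = 0 := by
    have h1 := fun u : SobolevSpace s => (hψ u).1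
    unfold symbMoment at h0 ⊢
    rw [← h1] at h0 ⊢
    rw [← h1] at h0
    rw [map_sub]
    exact h0
  rw [← e, symbMoment]
  simp only [pow_zero, one_mul, Complex.real_smul]

/-! ### Transfer to an arbitrary solution -/

theorem IsL2Version.congr {T σ : ℝ} {w w' : ℝ → 𝓢'(ℝ, ℂ)} {q : ℝ → SobolevSpace σ}
    (h : IsL2Version T w q) (hw : EqOn w w' (Ioo 0 T)) : IsL2Version T w' q := by
  refine ⟨h.1, ?_⟩
  filter_upwards [h.2, ae_restrict_mem measurableSet_Ioo] with t h1 h2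
  rw [h1, hw h2]

theorem IsTrace.congr {r T : ℝ} {k : ℕ} {p p' : ℝ → SobolevSpace s}
    {h : ℝ → SobolevInterval r T} (hh : IsTrace k p h) (hp : EqOn p p' (Ioo 0 T)) :
    IsTrace k p' h := by
  refine ⟨hh.1, fun ψ η hψ => ?_⟩
  rw [← hh.2 ψ η hψ]
  refine setIntegral_congr_fun measurableSet_Ioo fun t ht => ?_
  rw [hp ht]

theorem IsSolution.eqOn_heatFlow {δ T : ℝ} (hT : 0 < T) {φ : SobolevSpace s}
    {p : ℝ → SobolevSpace s} (hp : IsSolution δ s T φ p) : EqOn (heatFlow δ φ) p (Icc 0 T) :=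
  (isSolution_heatFlow δ hT φ).eqOn hT hp

end LinearKS

end

/-! ### The main theorem -/

theorem proposition2p1 (δ s T : ℝ) (hT : 0 < T) :
    -- existence and uniqueness
    (∀ φ : LinearKS.SobolevSpace s,
      (∃ p : ℝ → LinearKS.SobolevSpace s, LinearKS.IsSolution δ s T φ p) ∧
      ∀ p p' : ℝ → LinearKS.SobolevSpace s, LinearKS.IsSolution δ s T φ p →
        LinearKS.IsSolution δ s T φ p' → EqOn p p' (Icc 0 T)) ∧
    ∃ C : ℝ, 0 < C ∧ ∀ (φ : LinearKS.SobolevSpace s) (p : ℝ → LinearKS.SobolevSpace s),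
      LinearKS.IsSolution δ s T φ p →
      -- bounds in `C([0,T]; H^s)` and in `L²(0,T; H^{s+2})`
      (∀ t ∈ Icc 0 T, ‖p t‖ ≤ C * ‖φ‖) ∧
      (∃ q : ℝ → LinearKS.SobolevSpace (s + 2),
        LinearKS.IsL2Version T (fun t => LinearKS.SobolevSpace.toDistr (p t)) q ∧
        eLpNorm q 2 (volume.restrict (Ioo 0 T)) ≤ ENNReal.ofReal (C * ‖φ‖)) ∧
      -- traces, their bounds and, for negative `s`, their weighted bounds
      (∀ k : ℕ, k ≤ 1 → ∃ h : ℝ → LinearKS.SobolevInterval ((s - k) / 4 + 3 / 8) T,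
        LinearKS.IsTrace k p h ∧ (∀ x, ‖h x‖ ≤ C * ‖φ‖) ∧
        (s < 0 → T ≤ 1 → ∀ x, ∃ g : LinearKS.SobolevInterval (-(k : ℝ) / 4 + 3 / 8) T,
          LinearKS.IsPowMul (|s| / 4) (h x) g ∧ ‖g‖ ≤ C * ‖φ‖)) ∧
      -- weighted bounds in `L^∞(0,T; L²)` and in `L²(0,T; H²)` for negative `s`
      (s < 0 → T ≤ 1 →
        (∀ t ∈ Icc 0 T, ∃ w : Lp ℂ 2 (volume : Measure ℝ),
          (w : 𝓢'(ℝ, ℂ)) = ((t ^ (|s| / 4) : ℝ) : ℂ) • LinearKS.SobolevSpace.toDistr (p t) ∧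
          ‖w‖ ≤ C * ‖φ‖) ∧
        ∃ q : ℝ → LinearKS.SobolevSpace 2,
          LinearKS.IsL2Version T
            (fun t => ((t ^ (|s| / 4) : ℝ) : ℂ) • LinearKS.SobolevSpace.toDistr (p t)) q ∧
          eLpNorm q 2 (volume.restrict (Ioo 0 T)) ≤ ENNReal.ofReal (C * ‖φ‖)) := by
  refine ⟨fun φ => ⟨⟨LinearKS.heatFlow δ φ, LinearKS.isSolution_heatFlow δ hT φ⟩, fun p p' hp hp' =>
    hp.eqOn hT hp'⟩, ?_⟩
  -- The same bound gives both `L²` estimates, since the multiplier with weight `t^b` maps `H^s` to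
  -- `H^{s+4b+2}`: `b = 0` gives `H^{s+2}`, `b = |s|/4` gives `H²` for `s < 0`.
  obtain ⟨A, hA, hAb⟩ := LinearKS.exists_lintegral_heatMul_sq_le δ T (b := 0) le_rfl
  obtain ⟨A', hA', hAb'⟩ := LinearKS.exists_lintegral_heatMul_sq_le δ T (b := |s| / 4)
    (by positivity)
  obtain ⟨B, hB, hBb⟩ := LinearKS.exists_norm_heatMul_le δ T (b := |s| / 4) (by positivity)
  obtain ⟨C₀, hC₀, h₀⟩ := LinearKS.exists_traces_heatFlow δ s hT 0 (by norm_num)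
  obtain ⟨C₁, hC₁, h₁⟩ := LinearKS.exists_traces_heatFlow δ s hT 1 le_rfl
  refine ⟨1 + A + A' + B + C₀ + C₁, by positivity, fun φ p hp => ?_⟩
  -- By uniqueness every solution coincides on `[0,T]` with the explicit flow, so it is enough to
  -- estimate the latter.
  have heq := hp.eqOn_heatFlow hT
  have heq' : EqOn (LinearKS.heatFlow δ φ) p (Ioo 0 T) := heq.mono Ioo_subset_Icc_self
  have le : ∀ c, c ≤ 1 + A + A' + B + C₀ + C₁ → c * ‖φ‖ ≤ (1 + A + A' + B + C₀ + C₁) * ‖φ‖ :=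
    fun c hc => mul_le_mul_of_nonneg_right hc (norm_nonneg _)
  refine ⟨fun t ht => ?_, ?_, fun k hk => ?_, fun hs _ => ⟨fun t ht => ?_, ?_⟩⟩
  · rw [← heq ht]
    exact (LinearKS.norm_heatFlow_le δ φ ht.1).trans
      ((one_mul _).symm.le.trans (le 1 (by linarith)))
  · obtain ⟨q, hq, hqb⟩ := LinearKS.isL2Version_heatFlow δ T hA hAb (s := s)
      (σ := s + 2) (by ring) φ
    refine ⟨q, hq.congr fun t ht => ?_, hqb.trans (ENNReal.ofReal_le_ofReal (le A (by linarith)))⟩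
    beta_reduce
    rw [Real.rpow_zero, Complex.ofReal_one, one_smul, heq' ht]
  · have key : ∃ c, c ≤ 1 + A + A' + B + C₀ + C₁ ∧
        ∃ h : ℝ → LinearKS.SobolevInterval ((s - k) / 4 + 3 / 8) T,
          LinearKS.IsTrace k (LinearKS.heatFlow δ φ) h ∧
          (∀ x, ‖h x‖ ≤ c * ‖φ‖) ∧
          (s < 0 → ∀ x, ∃ g : LinearKS.SobolevInterval (-(k : ℝ) / 4 + 3 / 8) T,
            LinearKS.IsPowMul (|s| / 4) (h x) g ∧ ‖g‖ ≤ c * ‖φ‖) := by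
      interval_cases k
      · exact ⟨C₀, by linarith, h₀ φ⟩
      · exact ⟨C₁, by linarith, h₁ φ⟩
    obtain ⟨c, hc, h, htr, hbd, hw⟩ := key
    refine ⟨h, htr.congr heq', fun x => (hbd x).trans (le c hc), fun hs _ x => ?_⟩
    obtain ⟨g, hg, hgb⟩ := hw hs x
    exact ⟨g, hg, hgb.trans (le c hc)⟩
  · obtain ⟨w, hw, hwb⟩ := LinearKS.exists_lp_heatFlow δ T hB
      (by have := abs_pos.mpr hs.ne; positivity) hBb
      (by rw [abs_of_neg hs]; ring) φ ht
    exact ⟨w, by rw [hw, heq ht], hwb.trans (le B (by linarith))⟩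
  · obtain ⟨q, hq, hqb⟩ := LinearKS.isL2Version_heatFlow δ T hA' hAb' (s := s) (σ := 2)
      (by rw [abs_of_neg hs]; ring) φ
    refine ⟨q, hq.congr fun t ht => ?_, hqb.trans (ENNReal.ofReal_le_ofReal (le A' (by linarith)))⟩
    beta_reduce
    rw [heq' ht]
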